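/- **Conventions.** Manifolds are connected, Hausdorff, second countable and smooth, and so are all tensor fields. $R$ denotes the curvature tensor of the Levi-Civita connection, $R(X,Y)Z=([\nabla_X,\nabla_Y]-\nabla_{[X,Y]})Z$. For 1-forms, $2\,d\eta(X,Y)=X(\eta(Y))-Y(\eta(X))-\eta([X,Y])$. A Lorentzian metric has exactly one minus sign. A *Lorentzian $\mathcal S$-manifold* $(M,\varphi,\xi_\alpha,\eta^\alpha,g)$, $\alpha=1,\dots,s$, of dimension $2n+s$ is a Lorentzian manifold $(M,g)$ with a $(1,1)$-tensor field $\varphi$, vector fields $\xi_\alpha$ and 1-forms $\eta^\alpha$ such that $\varphi^3+\varphi=0$, $\varphi^2=-I+\sum_\alpha\eta^\alpha\otimes\xi_\alpha$, $\eta^\alpha(\xi_\beta)=\delta^\alpha_\beta$; $g(\varphi X,\varphi Y)=g(X,Y)-\sum_\alpha\varepsilon_\alpha\eta^\alpha(X)\eta^\alpha(Y)$ with $\varepsilon_\alpha=g(\xi_\alpha,\xi_\alpha)=\pm1$; $g(X,\varphi Y)=d\eta^\alpha(X,Y)$ for every $\alpha$; and $[\varphi,\varphi]+2\sum_\alpha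 d\eta^\alpha\otimes\xi_\alpha=0$, where $[\varphi,\varphi](X,Y)=\varphi^2[X,Y]+[\varphi X,\varphi Y]-\varphi[\varphi X,Y]-\varphi[X,\varphi Y]$. The numbering is such that $\xi_1$ is timelike. Put $\tilde\xi=\sum_\alpha\xi_\alpha$, $\tilde\eta=\sum_\alpha\varepsilon_\alpha\eta^\alpha$. Fix $p\in M$. Let $N_\varphi(\xi_1)$ be the set of $u=(\xi_1)_p+x$ with $x\in\mathrm{Im}(\varphi_p)$, $g(x,\xi_1)=0$ and $g(x,x)=1$; such $u$ are null. For $u\in N_\varphi(\xi_1)$ the Jacobi operator $\bar R_u$ acts on $u^\perp/\mathrm{span}(u)$ by $\bar R_u(\bar y)=\overline{R_p(y,u)u}$. The manifold $M$ is *$\varphi$-null Osserman at $p$* if the eigenvalues of $\bar R_u$ and their multiplicities do not depend on $u\in N_\varphi(\xi_1)$. For $u=(\xi_1)_p+x$ let $\bar R_u^\varphi$ be the restriction of $\bar R_u$ to the $(2n-1)$-dimensional space $x^\perp\cap\mathrm{Im}(\varphi_p)$, regarded as a subspace of $u^\perp/\mathrm{span}(u)$. On $T_pM$ put $$T(x,y)z=g(\varphi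 y,\varphi z)\tilde\eta(x)\tilde\xi-g(\varphi x,\varphi z)\tilde\eta(y)\tilde\xi-\tilde\eta(y)\tilde\eta(z)\varphi^2x+\tilde\eta(x)\tilde\eta(z)\varphi^2y,$$ $$S(x,y)z=g(\varphi x,\varphi z)\varphi^2y-g(\varphi y,\varphi z)\varphi^2x,$$ $$R^0(x,y)z=g(\varphi^2y,\varphi^2z)\varphi^2x-g(\varphi^2x,\varphi^2z)\varphi^2y,$$ and, for an endomorphism $J$ of $\mathrm{Im}(\varphi_p)$, $$R^J(x,y)z=g(J\varphi^2y,\varphi^2z)J\varphi^2x-g(J\varphi^2x,\varphi^2z)J\varphi^2y+2g(\varphi^2x,J\varphi^2y)J\varphi^2z.$$ **Theorem.** Let $(M,\varphi,\xi_\alpha,\eta^\alpha,g)$ be a Lorentzian $\mathcal S$-manifold of dimension $2n+s$ with $n>1$ and $s\ge1$, let $p\in M$, and let $c_1\ne c_2$ be real numbers. The following are equivalent. (a) $M$ is $\varphi$-null Osserman at $p$, and for every $u\in N_\varphi(\xi_1)$ the operator $\bar R_u^\varphi$ has exactly the two eigenvalues $c_1$ and $c_2$, with multiplicities $1$ and $2n-2$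 respectively. (b) There is an almost Hermitian structure $J$ on $\mathrm{Im}(\varphi_p)$ (a linear $J$ with $J^2=-I$ and $g(Jx,Jy)=g(x,y)$) such that for all $x,y,z\in T_pM$ $$R_p(x,y)z=T(x,y)z-S(x,y)z-c_2R^0(x,y)z-\frac{c_1-c_2}{3}R^J(x,y)z.$$ -/

import Mathlib

open Module
open scoped Manifold ContDiff Bundle

set_option maxSynthPendingDepth 3

noncomputable section

namespace LorentzS

section Fields

variable {E : Type*} [NormedAddCommGroup E] [NormedSpace ℝ E]
  {M : Type*} [TopologicalSpace M] [ChartedSpace E M]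

/-! ### Tensor fields and metrics -/

/-- The vector field `X` is smooth near the point `p`. -/
def SmoothFieldAt [IsManifold 𝓘(ℝ, E) ∞ M] (X : (q : M) → TangentSpace 𝓘(ℝ, E) q) (p : M) : Prop :=
  ContMDiffAt 𝓘(ℝ, E) (𝓘(ℝ, E).prod 𝓘(ℝ, E)) ∞
    (fun q => (⟨q, X q⟩ : TangentBundle 𝓘(ℝ, E) M)) p

/-- A smooth Lorentzian metric on `M`: a smooth symmetric `(0,2)`-tensor field which at each point
has a timelike vector on whose orthogonal complement it is positive definite, that is, which is
nondegenerate with exactly one minus sign. -/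
structure LorentzMetric (E : Type*) [NormedAddCommGroup E] [NormedSpace ℝ E]
    (M : Type*) [TopologicalSpace M] [ChartedSpace E M] [IsManifold 𝓘(ℝ, E) ∞ M] where
  /-- the value of the metric at a point -/
  val : (p : M) → TangentSpace 𝓘(ℝ, E) p →L[ℝ] TangentSpace 𝓘(ℝ, E) p →L[ℝ] ℝ
  smooth : ContMDiff 𝓘(ℝ, E) (𝓘(ℝ, E).prod 𝓘(ℝ, E →L[ℝ] E →L[ℝ] ℝ)) ∞
    (fun p => Bundle.TotalSpace.mk' (E →L[ℝ] E →L[ℝ] ℝ)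
      (E := fun p : M => TangentSpace 𝓘(ℝ, E) p →L[ℝ] TangentSpace 𝓘(ℝ, E) p →L[ℝ] ℝ) p (val p))
  symm : ∀ p v w, val p v w = val p w v
  signature : ∀ p, ∃ t, val p t t < 0 ∧ ∀ v, val p t v = 0 → v ≠ 0 → 0 < val p v v

/-- A globally framed `f`-structure `(φ, ξ_α, η^α)`, `α = 1, …, s` (indexed here by `Fin s`):
`φ³ + φ = 0`, `φ² = -I + ∑ η^α ⊗ ξ_α` and `η^α(ξ_β) = δ^α_β`. -/
structure FramedFStructure (E : Type*) [NormedAddCommGroup E] [NormedSpace ℝ E]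
    (M : Type*) [TopologicalSpace M] [ChartedSpace E M] [IsManifold 𝓘(ℝ, E) ∞ M] (s : ℕ) where
  /-- the `(1,1)`-tensor field `φ` -/
  φ : (p : M) → TangentSpace 𝓘(ℝ, E) p →L[ℝ] TangentSpace 𝓘(ℝ, E) p
  /-- the characteristic vector fields -/
  ξ : Fin s → (p : M) → TangentSpace 𝓘(ℝ, E) p
  /-- the dual `1`-forms -/
  η : Fin s → (p : M) → TangentSpace 𝓘(ℝ, E) p →L[ℝ] ℝ
  smooth_φ : ContMDiff 𝓘(ℝ, E) (𝓘(ℝ, E).prod 𝓘(ℝ, E →L[ℝ] E)) ∞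
    (fun p => Bundle.TotalSpace.mk' (E →L[ℝ] E)
      (E := fun p : M => TangentSpace 𝓘(ℝ, E) p →L[ℝ] TangentSpace 𝓘(ℝ, E) p) p (φ p))
  smooth_ξ : ∀ α p, SmoothFieldAt (ξ α) p
  smooth_η : ∀ α, ContMDiff 𝓘(ℝ, E) (𝓘(ℝ, E).prod 𝓘(ℝ, E →L[ℝ] ℝ)) ∞
    (fun p => Bundle.TotalSpace.mk' (E →L[ℝ] ℝ)
      (E := fun p : M => TangentSpace 𝓘(ℝ, E) p →L[ℝ] ℝ) p (η α p))
  φ_cube : ∀ p v, φ p (φ p (φ p v)) + φ p v = 0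
  φ_sq : ∀ p v, φ p (φ p v) = -v + ∑ α, η α p v • ξ α p
  η_ξ : ∀ α β p, η α p (ξ β p) = if α = β then 1 else 0

/-- The exterior derivative of a `1`-form, with the convention
`2 dη(X, Y) = X(η(Y)) - Y(η(X)) - η([X, Y])`. -/
def extDer (η : (q : M) → TangentSpace 𝓘(ℝ, E) q →L[ℝ] ℝ)
    (X Y : (q : M) → TangentSpace 𝓘(ℝ, E) q) (p : M) : ℝ :=
  (1 / 2) * (mvfderiv 𝓘(ℝ, E) (fun q => η q (Y q)) p (X p)
    - mvfderiv 𝓘(ℝ, E) (fun q => η q (X q)) p (Y p)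
    - η p (VectorField.mlieBracket 𝓘(ℝ, E) X Y p))

/-- The Nijenhuis tensor `[φ, φ](X, Y) = φ²[X, Y] + [φX, φY] - φ[φX, Y] - φ[X, φY]`. -/
def nijenhuis (φ : (q : M) → TangentSpace 𝓘(ℝ, E) q →L[ℝ] TangentSpace 𝓘(ℝ, E) q)
    (X Y : (q : M) → TangentSpace 𝓘(ℝ, E) q) (p : M) : TangentSpace 𝓘(ℝ, E) p :=
  φ p (φ p (VectorField.mlieBracket 𝓘(ℝ, E) X Y p))
    + VectorField.mlieBracket 𝓘(ℝ, E) (fun q => φ q (X q)) (fun q => φ q (Y q)) p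
    - φ p (VectorField.mlieBracket 𝓘(ℝ, E) (fun q => φ q (X q)) Y p)
    - φ p (VectorField.mlieBracket 𝓘(ℝ, E) X (fun q => φ q (Y q)) p)

/-! ### The curvature tensor, in the coordinates of a chart

For a point `p`, `χ = extChartAt 𝓘(ℝ, E) p` is the preferred chart at `p`, and coordinate vectors
are elements of `E`. -/

/-- For `v : E` and `x` in the domain of the chart at `p`, `coordFrame p x v` is the tangent vector
at `x` whose coordinates in that chart are `v` (a constant linear combination of the coordinate
vector fields). -/
def coordFrame (p x : M) : E →L[ℝ] TangentSpace 𝓘(ℝ, E) x :=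
  (mvfderiv 𝓘(ℝ, E) (extChartAt 𝓘(ℝ, E) p : M → E) x).inverse

/-- The coefficients `g_{ij}` of a `(0,2)`-tensor field in the chart at `p`, as a function on
`E` (meaningful on the target of the chart). -/
def chartMetric (g : (q : M) → TangentSpace 𝓘(ℝ, E) q →L[ℝ] TangentSpace 𝓘(ℝ, E) q →L[ℝ] ℝ)
    (p : M) (y : E) : E →L[ℝ] E →L[ℝ] ℝ :=
  (ContinuousLinearMap.precomp ℝ (coordFrame p ((extChartAt 𝓘(ℝ, E) p).symm y))).comp
    ((g ((extChartAt 𝓘(ℝ, E) p).symm y)).comp (coordFrame p ((extChartAt 𝓘(ℝ, E) p).symm y)))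

/-- Twice the Christoffel symbols of the first kind of `G`:
`christoffelFirst G y v w z = ∂_v G(w, z) + ∂_w G(v, z) - ∂_z G(v, w)`. -/
def christoffelFirst (G : E → E →L[ℝ] E →L[ℝ] ℝ) (y : E) : E →L[ℝ] E →L[ℝ] E →L[ℝ] ℝ :=
  fderiv ℝ G y + (fderiv ℝ G y).flip
    - (ContinuousLinearMap.flipₗᵢ ℝ E E ℝ).toContinuousLinearEquiv.toContinuousLinearMap.comp
        (fderiv ℝ G y).flip

theorem christoffelFirst_apply (G : E → E →L[ℝ] E →L[ℝ] ℝ) (y v w z : E) :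
    christoffelFirst G y v w z
      = fderiv ℝ G y v w z + fderiv ℝ G y w v z - fderiv ℝ G y z v w := by
  simp [christoffelFirst]

/-- The Christoffel symbols (of the second kind) of the Levi-Civita connection of `G`:
`2 G(Γ(v, w), z) = ∂_v G(w, z) + ∂_w G(v, z) - ∂_z G(v, w)`, so that `∇_v w = Γ(v, w)` for
constant vector fields `v, w`. -/
def christoffel (G : E → E →L[ℝ] E →L[ℝ] ℝ) (y : E) : E →L[ℝ] E →L[ℝ] E :=
  (2⁻¹ : ℝ) • (ContinuousLinearMap.compL ℝ E (E →L[ℝ] ℝ) E (G y).inverse).comp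
    (christoffelFirst G y)

theorem christoffel_apply (G : E → E →L[ℝ] E →L[ℝ] ℝ) (y v w : E) :
    christoffel G y v w = (2⁻¹ : ℝ) • (G y).inverse (christoffelFirst G y v w) := by
  simp [christoffel]

/-- The curvature `R(v, w)z = ∇_v ∇_w z - ∇_w ∇_v z` of `G` on constant vector fields of `E`. -/
def coordCurvature (G : E → E →L[ℝ] E →L[ℝ] ℝ) (y v w z : E) : E :=
  fderiv ℝ (christoffel G) y v w z - fderiv ℝ (christoffel G) y w v z
    + christoffel G y v (christoffel G y w z) - christoffel G y w (christoffel G y v z)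

/-- The `(1,3)` curvature tensor `R_p(x, y)z = ([∇_x, ∇_y] - ∇_{[x, y]})z` of the Levi-Civita
connection of `g`, computed in the chart at `p`. -/
def curvature (g : (q : M) → TangentSpace 𝓘(ℝ, E) q →L[ℝ] TangentSpace 𝓘(ℝ, E) q →L[ℝ] ℝ)
    (p : M) (x y z : TangentSpace 𝓘(ℝ, E) p) : TangentSpace 𝓘(ℝ, E) p :=
  coordFrame p p (coordCurvature (chartMetric g p) (extChartAt 𝓘(ℝ, E) p p)
    (mvfderiv 𝓘(ℝ, E) (extChartAt 𝓘(ℝ, E) p : M → E) p x)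
    (mvfderiv 𝓘(ℝ, E) (extChartAt 𝓘(ℝ, E) p : M → E) p y)
    (mvfderiv 𝓘(ℝ, E) (extChartAt 𝓘(ℝ, E) p : M → E) p z))

theorem coordCurvature_add (G : E → E →L[ℝ] E →L[ℝ] ℝ) (y v v' w z : E) :
    coordCurvature G y (v + v') w z = coordCurvature G y v w z + coordCurvature G y v' w z := by
  simp only [coordCurvature, map_add, add_apply]
  abel

theorem coordCurvature_smul (G : E → E →L[ℝ] E →L[ℝ] ℝ) (y v w z : E) (c : ℝ) :
    coordCurvature G y (c • v) w z = c • coordCurvature G y v w z := by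
  simp only [coordCurvature, map_smul, smul_apply]
  module

theorem coordCurvature_self (G : E → E →L[ℝ] E →L[ℝ] ℝ) (y v z : E) :
    coordCurvature G y v v z = 0 := by
  simp [coordCurvature]

/-- The linear map `x ↦ R_p(x, u)u` on `T_pM`. -/
def jacobiMap (g : (q : M) → TangentSpace 𝓘(ℝ, E) q →L[ℝ] TangentSpace 𝓘(ℝ, E) q →L[ℝ] ℝ)
    (p : M) (u : TangentSpace 𝓘(ℝ, E) p) :
    TangentSpace 𝓘(ℝ, E) p →ₗ[ℝ] TangentSpace 𝓘(ℝ, E) p where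
  toFun x := curvature g p x u u
  map_add' x y := by simp only [curvature, map_add, coordCurvature_add]
  map_smul' c x := by simp only [curvature, map_smul, coordCurvature_smul, RingHom.id_apply]

theorem jacobiMap_self
    (g : (q : M) → TangentSpace 𝓘(ℝ, E) q →L[ℝ] TangentSpace 𝓘(ℝ, E) q →L[ℝ] ℝ)
    (p : M) (u : TangentSpace 𝓘(ℝ, E) p) : jacobiMap g p u u = 0 := by
  simp [jacobiMap, curvature, coordCurvature_self]

/-! ### Jacobi operators with respect to null vectors -/

/-- The orthogonal complement `u^⊥` in `T_pM`. -/
def perp (g : (q : M) → TangentSpace 𝓘(ℝ, E) q →L[ℝ] TangentSpace 𝓘(ℝ, E) q →L[ℝ] ℝ)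
    (p : M) (u : TangentSpace 𝓘(ℝ, E) p) : Submodule ℝ (TangentSpace 𝓘(ℝ, E) p) :=
  LinearMap.ker (g p u).toLinearMap

/-- The quotient `u^⊥ / span(u)`; for a null vector `u`, `span(u) ⊆ u^⊥`. -/
abbrev NullQuotient (g : (q : M) → TangentSpace 𝓘(ℝ, E) q →L[ℝ] TangentSpace 𝓘(ℝ, E) q →L[ℝ] ℝ)
    (p : M) (u : TangentSpace 𝓘(ℝ, E) p) : Type _ :=
  (perp g p u) ⧸ (Submodule.span ℝ {u}).comap (perp g p u).subtype

/-- The canonical injection of `u^⊥ / span(u)` in `T_pM / span(u)`. -/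
def nullInclusion (g : (q : M) → TangentSpace 𝓘(ℝ, E) q →L[ℝ] TangentSpace 𝓘(ℝ, E) q →L[ℝ] ℝ)
    (p : M) (u : TangentSpace 𝓘(ℝ, E) p) :
    NullQuotient g p u →ₗ[ℝ] (TangentSpace 𝓘(ℝ, E) p ⧸ Submodule.span ℝ {u}) :=
  Submodule.mapQ _ _ (perp g p u).subtype le_rfl

/-- The Jacobi operator `R̄_u`, sending the class of `x ∈ u^⊥` to the class of `R_p(x, u)u`. Its
values lie in `u^⊥ / span(u)` because `g(R_p(x, u)u, u) = 0`; they are recorded here as elements of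
the larger space `T_pM / span(u)`. -/
def nullJacobi (g : (q : M) → TangentSpace 𝓘(ℝ, E) q →L[ℝ] TangentSpace 𝓘(ℝ, E) q →L[ℝ] ℝ)
    (p : M) (u : TangentSpace 𝓘(ℝ, E) p) :
    NullQuotient g p u →ₗ[ℝ] (TangentSpace 𝓘(ℝ, E) p ⧸ Submodule.span ℝ {u}) :=
  Submodule.mapQ _ _ ((jacobiMap g p u).comp (perp g p u).subtype) (by
    intro x hx
    obtain ⟨a, ha⟩ := Submodule.mem_span_singleton.1 (Submodule.mem_comap.1 hx)
    rw [Submodule.subtype_apply] at ha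
    simp [Submodule.mem_comap, ← ha, jacobiMap_self])

/-- The eigenspace of `R̄_u` for `c`, a subspace of `u^⊥ / span(u)`. As `R̄_u` is self-adjoint for
a positive definite inner product, its dimension is the multiplicity of `c`. -/
def nullJacobiEigenspace
    (g : (q : M) → TangentSpace 𝓘(ℝ, E) q →L[ℝ] TangentSpace 𝓘(ℝ, E) q →L[ℝ] ℝ)
    (p : M) (u : TangentSpace 𝓘(ℝ, E) p) (c : ℝ) : Submodule ℝ (NullQuotient g p u) :=
  LinearMap.ker (nullJacobi g p u - c • nullInclusion g p u)

end Fields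

section SManifolds

variable {E : Type*} [NormedAddCommGroup E] [NormedSpace ℝ E]
  {M : Type*} [TopologicalSpace M] [ChartedSpace E M] [IsManifold 𝓘(ℝ, E) ∞ M]
  {s : ℕ}

/-- `(M, φ, ξ_α, η^α, g)` is a Lorentzian `S`-manifold whose timelike characteristic vector field
is the first one (index `0` of `Fin s`). -/
structure IsLorentzianSManifold [NeZero s] (g : LorentzMetric E M) (F : FramedFStructure E M s) :
    Prop where
  /-- `ε_α = g(ξ_α, ξ_α) = ±1` -/
  eps_eq : ∀ α p, g.val p (F.ξ α p) (F.ξ α p) = 1 ∨ g.val p (F.ξ α p) (F.ξ α p) = -1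
  timelike : ∀ p, g.val p (F.ξ 0 p) (F.ξ 0 p) = -1
  /-- compatibility: `g(φX, φY) = g(X, Y) - ∑ ε_α η^α(X) η^α(Y)` -/
  compat : ∀ p v w, g.val p (F.φ p v) (F.φ p w)
    = g.val p v w - ∑ α, g.val p (F.ξ α p) (F.ξ α p) * F.η α p v * F.η α p w
  /-- `Φ = dη^α` for every `α`, where `Φ(X, Y) = g(X, φY)` -/
  contact : ∀ α p X Y, SmoothFieldAt X p → SmoothFieldAt Y p →
    g.val p (X p) (F.φ p (Y p)) = extDer (F.η α) X Y p
  /-- normality: `[φ, φ] + 2 ∑ dη^α ⊗ ξ_α = 0` -/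
  normal : ∀ p X Y, SmoothFieldAt X p → SmoothFieldAt Y p →
    nijenhuis F.φ X Y p + (2 : ℝ) • ∑ α, extDer (F.η α) X Y p • F.ξ α p = 0

/-- `Im(φ_p)`. -/
def imφ (F : FramedFStructure E M s) (p : M) : Submodule ℝ (TangentSpace 𝓘(ℝ, E) p) :=
  LinearMap.range (F.φ p).toLinearMap

/-- `ξ̃ = ∑ ξ_α`. -/
def xiTilde (F : FramedFStructure E M s) (p : M) : TangentSpace 𝓘(ℝ, E) p := ∑ α, F.ξ α p

/-- `η̃ = ∑ ε_α η^α`, with `ε_α = g(ξ_α, ξ_α)`. -/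
def etaTilde (g : LorentzMetric E M) (F : FramedFStructure E M s) (p : M)
    (v : TangentSpace 𝓘(ℝ, E) p) : ℝ :=
  ∑ α, g.val p (F.ξ α p) (F.ξ α p) * F.η α p v

/-- The tensor `T`. -/
def tensorT (g : LorentzMetric E M) (F : FramedFStructure E M s) (p : M)
    (x y z : TangentSpace 𝓘(ℝ, E) p) : TangentSpace 𝓘(ℝ, E) p :=
  (g.val p (F.φ p y) (F.φ p z) * etaTilde g F p x) • xiTilde F p
    - (g.val p (F.φ p x) (F.φ p z) * etaTilde g F p y) • xiTilde F p
    - (etaTilde g F p y * etaTilde g F p z) • F.φ p (F.φ p x)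
    + (etaTilde g F p x * etaTilde g F p z) • F.φ p (F.φ p y)

/-- The tensor `S`. -/
def tensorS (g : LorentzMetric E M) (F : FramedFStructure E M s) (p : M)
    (x y z : TangentSpace 𝓘(ℝ, E) p) : TangentSpace 𝓘(ℝ, E) p :=
  g.val p (F.φ p x) (F.φ p z) • F.φ p (F.φ p y) - g.val p (F.φ p y) (F.φ p z) • F.φ p (F.φ p x)

/-- The tensor `R⁰`. -/
def tensorR0 (g : LorentzMetric E M) (F : FramedFStructure E M s) (p : M)
    (x y z : TangentSpace 𝓘(ℝ, E) p) : TangentSpace 𝓘(ℝ, E) p :=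
  g.val p (F.φ p (F.φ p y)) (F.φ p (F.φ p z)) • F.φ p (F.φ p x)
    - g.val p (F.φ p (F.φ p x)) (F.φ p (F.φ p z)) • F.φ p (F.φ p y)

/-- `φ² v` as an element of `Im(φ_p)`. -/
def φsq (F : FramedFStructure E M s) (p : M) (v : TangentSpace 𝓘(ℝ, E) p) : imφ F p :=
  ⟨F.φ p (F.φ p v), LinearMap.mem_range_self (F.φ p).toLinearMap (F.φ p v)⟩

/-- The tensor `R^J` of an endomorphism `J` of `Im(φ_p)`. -/
def tensorRJ (g : LorentzMetric E M) (F : FramedFStructure E M s) (p : M)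
    (J : imφ F p →ₗ[ℝ] imφ F p)
    (x y z : TangentSpace 𝓘(ℝ, E) p) : TangentSpace 𝓘(ℝ, E) p :=
  g.val p (J (φsq F p y) : TangentSpace 𝓘(ℝ, E) p) (φsq F p z) • (J (φsq F p x) : TangentSpace 𝓘(ℝ, E) p)
    - g.val p (J (φsq F p x) : TangentSpace 𝓘(ℝ, E) p) (φsq F p z) • (J (φsq F p y) : TangentSpace 𝓘(ℝ, E) p)
    + (2 * g.val p (φsq F p x : TangentSpace 𝓘(ℝ, E) p) (J (φsq F p y))) • (J (φsq F p z) : TangentSpace 𝓘(ℝ, E) p)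

/-- `J` is an almost Hermitian structure on `(Im(φ_p), g_p)`. -/
def IsAlmostHermitian (g : LorentzMetric E M) (F : FramedFStructure E M s) (p : M)
    (J : imφ F p →ₗ[ℝ] imφ F p) : Prop :=
  (∀ x, J (J x) = -x) ∧
    ∀ x y, g.val p (J x : TangentSpace 𝓘(ℝ, E) p) (J y) = g.val p (x : TangentSpace 𝓘(ℝ, E) p) y

variable [NeZero s]

/-- The `φ`-null congruence set `N_φ((ξ_1)_p)`: the vectors `u = (ξ_1)_p + x`, with `x` a unit
vector of `Im(φ_p)` orthogonal to `(ξ_1)_p`. -/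
def phiNullCongruence (g : LorentzMetric E M) (F : FramedFStructure E M s) (p : M) :
    Set (TangentSpace 𝓘(ℝ, E) p) :=
  {u | u - F.ξ 0 p ∈ imφ F p ∧ g.val p (u - F.ξ 0 p) (F.ξ 0 p) = 0 ∧
    g.val p (u - F.ξ 0 p) (u - F.ξ 0 p) = 1}

/-- `M` is `φ`-null Osserman at `p`: the eigenvalues of `R̄_u` and their multiplicities do not depend
on `u ∈ N_φ((ξ_1)_p)`. -/
def IsPhiNullOsserman (g : LorentzMetric E M) (F : FramedFStructure E M s) (p : M) : Prop :=
  ∀ u ∈ phiNullCongruence g F p, ∀ u' ∈ phiNullCongruence g F p, ∀ c : ℝ,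
    finrank ℝ (nullJacobiEigenspace g.val p u c) = finrank ℝ (nullJacobiEigenspace g.val p u' c)

/-- For `u = (ξ_1)_p + x`, the space `V = x^⊥ ∩ Im(φ_p)`. -/
def phiV (g : LorentzMetric E M) (F : FramedFStructure E M s) (p : M)
    (u : TangentSpace 𝓘(ℝ, E) p) : Submodule ℝ (TangentSpace 𝓘(ℝ, E) p) :=
  perp g.val p (u - F.ξ 0 p) ⊓ imφ F p

/-- The operator `R̄_u^φ`, that is, the restriction of `R̄_u` to (the image in `u^⊥ / span(u)` of)
`V`: it sends `y ∈ V` to the class of `R_p(y, u)u` modulo `span(u)`. -/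
def phiNullJacobi (g : LorentzMetric E M) (F : FramedFStructure E M s) (p : M)
    (u : TangentSpace 𝓘(ℝ, E) p) :
    phiV g F p u →ₗ[ℝ] (TangentSpace 𝓘(ℝ, E) p ⧸ Submodule.span ℝ {u}) :=
  (Submodule.mkQ _).comp ((jacobiMap g.val p u).comp (phiV g F p u).subtype)

/-- The eigenspace of `R̄_u^φ` for `c`: the `y ∈ V` with `R̄_u(ȳ) = c ȳ`. -/
def phiNullJacobiEigenspace (g : LorentzMetric E M) (F : FramedFStructure E M s) (p : M)
    (u : TangentSpace 𝓘(ℝ, E) p) (c : ℝ) : Submodule ℝ (phiV g F p u) :=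
  LinearMap.ker (phiNullJacobi g F p u - c • (Submodule.mkQ _).comp (phiV g F p u).subtype)

/-- `R̄_u^φ` has exactly the two eigenvalues `c₁` and `c₂`, of multiplicities `m₁` and `m₂`. -/
def HasTwoEigenvalues (g : LorentzMetric E M) (F : FramedFStructure E M s) (p : M)
    (u : TangentSpace 𝓘(ℝ, E) p) (c₁ c₂ : ℝ) (m₁ m₂ : ℕ) : Prop :=
  c₁ ≠ c₂ ∧ (∀ c : ℝ, phiNullJacobiEigenspace g F p u c ≠ ⊥ ↔ c = c₁ ∨ c = c₂) ∧
    finrank ℝ (phiNullJacobiEigenspace g F p u c₁) = m₁ ∧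
    finrank ℝ (phiNullJacobiEigenspace g F p u c₂) = m₂

end SManifolds

end LorentzS

end

/-!
The curvature of a Lorentzian `S`-manifold is known at once on everything but `Im φ`, and on
`Im φ` the eigenvalue condition is a statement about an algebraic curvature tensor on a Euclidean
space.

*Curvature and characteristic vectors.* The defining conditions give `∇_x ξ_α = -ε_α φx`
(`IsSJet.D_eq`) and `(∇_x φ)y = g(φx, φy) ξ̃ + η̃(y) φ²x` (`IsSJet.A_eq`). Both are pointwise
linear algebra: the first covariant derivatives of the structure tensors satisfy a list of linear
relations (`IsSJet`), which are obtained by differentiating the defining conditions in a chart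
(`IsSGerm`), and these relations have only one solution. Differentiating the first formula and
inserting the second one yields `R(x, y)ξ_α = ε_α (η̃(x) φ²y - η̃(y) φ²x)`
(`IsLorentzianSManifold.curvature_ξ`). The tensor `T - S - c₂ R⁰ - ((c₁ - c₂)/3) R^J` is an
algebraic curvature tensor with the same values on the `ξ_α`, so it equals `R` as soon as it does
so on `Im φ` (`curvature_eq_model`), where it becomes `(c₂ - 1)` times the constant curvature
tensor plus `(c₁ - c₂)/3` times the tensor of `J`.

*The Jacobi operators.* For `u = ξ₀ + x` and `y` in `x^⊥ ∩ Im φ` one has `R(y, u)u = y + R(y, x)x`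
(`jacobi_of_mem`). Hence the condition on `R̄_u^φ` says that
`R(y, x)x = (c₂ - 1)y + (c₁ - c₂) g(y, e)e` for a unit vector `e = e(x)` orthogonal to `x`
(`exists_unit_of_hasTwoEigenvalues`, `hasTwoEigenvalues_of_unit`). If `R` is the model
tensor, this holds with `e(x) = Jx`. Moreover
`u^⊥ / span(u)` is the direct sum of `x^⊥ ∩ Im φ` and the span of the `ξ_α`, `α ≠ 0`; `R̄_u`
respects this decomposition, and its matrix on the second summand in the basis of the `ξ_α` does
not depend on `u`, so the eigenvalues of `R̄_u^φ` determine the multiplicities of those of `R̄_u`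
(`finrank_nullJacobiEigenspace`, `isPhiNullOsserman`).

*From the eigenvalues to `J`.* Conversely, let `K` be the curvature tensor on `Im φ`, which is
positive definite, with the constant curvature part removed and scaled such that
`K(y, x)x = g(y, e(x))e(x)` for unit vectors `x`; put `e(tx) = t e(x)` for `t ≥ 0`. The vectors
`e(x)` are determined up to sign only. The quadratic map `x ↦ e(x) ⊗ e(x)`
has rank one everywhere, and comparing it along lines `x + t x₀` shows that the signs can be
chosen such that `e` is a linear map `J` (`exists_linear_of_rank_one`). Then `J` is isometric and
skew, hence an orthogonal complex structure, and `K` is one third of the tensor of `J`, because an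
algebraic curvature tensor is determined by its sectional curvatures (`exists_complex_structure`).
-/

set_option linter.unusedSectionVars false

namespace LorentzS

open Filter Topology Bundle

/-! ### The Levi-Civita connection and its curvature in coordinates -/

section Coordinates

variable {E : Type*} [NormedAddCommGroup E] [NormedSpace ℝ E]
  {F : Type*} [NormedAddCommGroup F] [NormedSpace ℝ F]
  {F' : Type*} [NormedAddCommGroup F'] [NormedSpace ℝ F']
  {G : E → E →L[ℝ] E →L[ℝ] ℝ} {y : E}

theorem fderiv_clm_apply_const {A : E → F →L[ℝ] F'} (hA : DifferentiableAt ℝ A y) (v : E) (w : F) :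
    fderiv ℝ (fun q => A q w) y v = fderiv ℝ A y v w := by
  rw [fderiv_clm_apply hA (differentiableAt_const w)]
  simp

theorem fderiv_clm_apply_apply {A : E → F →L[ℝ] F'} {B : E → F} (hA : DifferentiableAt ℝ A y)
    (hB : DifferentiableAt ℝ B y) (v : E) :
    fderiv ℝ (fun q => A q (B q)) y v = fderiv ℝ A y v (B y) + A y (fderiv ℝ B y v) := by
  rw [fderiv_clm_apply hA hB]
  simp [add_comm]

/-- The product rule for a bilinear form evaluated at two vector fields. -/
theorem fderiv_bilin_apply (hG : DifferentiableAt ℝ G y) {A B : E → E}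
    (hA : DifferentiableAt ℝ A y) (hB : DifferentiableAt ℝ B y) (v : E) :
    fderiv ℝ (fun q => G q (A q) (B q)) y v =
      fderiv ℝ G y v (A y) (B y) + G y (fderiv ℝ A y v) (B y) + G y (A y) (fderiv ℝ B y v) := by
  have hGA : DifferentiableAt ℝ (fun q => G q (A q)) y := hG.clm_apply hA
  rw [fderiv_clm_apply_apply hGA hB, fderiv_clm_apply_apply hG hA]
  simp

theorem fderiv_metric_symm (hG : DifferentiableAt ℝ G y)
    (hs : ∀ᶠ q in 𝓝 y, ∀ v w, G q v w = G q w v) (z v w : E) :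
    fderiv ℝ G y z v w = fderiv ℝ G y z w v := by
  have h (v w : E) : fderiv ℝ (fun q => G q v w) y z = fderiv ℝ G y z v w := by
    rw [fderiv_bilin_apply hG (differentiableAt_const v) (differentiableAt_const w)]
    simp
  rw [← h, ← h]
  have : (fun q => G q v w) =ᶠ[𝓝 y] fun q => G q w v := hs.mono fun q hq => hq v w
  rw [this.fderiv_eq]

theorem metric_christoffel (hi : (G y).IsInvertible) (v w z : E) :
    G y (christoffel G y v w) z = 2⁻¹ * (fderiv ℝ G y v w z + fderiv ℝ G y w v z
      - fderiv ℝ G y z v w) := by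
  rw [christoffel_apply, map_smul, hi.self_apply_inverse]
  simp [christoffelFirst_apply]

theorem christoffel_symm (hG : DifferentiableAt ℝ G y)
    (hs : ∀ᶠ q in 𝓝 y, ∀ v w, G q v w = G q w v) (v w : E) :
    christoffel G y v w = christoffel G y w v := by
  rw [christoffel_apply, christoffel_apply]
  congr 2
  ext z
  rw [christoffelFirst_apply, christoffelFirst_apply, fderiv_metric_symm hG hs z v w]
  ring

/-- The Levi-Civita connection is metric. -/
theorem fderiv_metric (hG : DifferentiableAt ℝ G y)
    (hs : ∀ᶠ q in 𝓝 y, ∀ v w, G q v w = G q w v) (hi : (G y).IsInvertible) (v w z : E) :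
    fderiv ℝ G y v w z = G y (christoffel G y v w) z + G y w (christoffel G y v z) := by
  rw [hs.self_of_nhds w, metric_christoffel hi, metric_christoffel hi,
    fderiv_metric_symm hG hs v z w, fderiv_metric_symm hG hs z v w, fderiv_metric_symm hG hs w v z]
  ring

theorem contDiffAt_christoffel [CompleteSpace E] (hG : ContDiffAt ℝ ∞ G y)
    (hi : (G y).IsInvertible) : ContDiffAt ℝ ∞ (christoffel G) y := by
  have hG' : ContDiffAt ℝ ∞ (fderiv ℝ G) y := hG.fderiv_right (m := ∞) le_rfl
  have h1 : ContDiffAt ℝ ∞ (fun q => (G q).inverse) y :=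
    (hi.contDiffAt_map_inverse (n := ∞)).comp y hG
  have hflip : ContDiffAt ℝ ∞ (fun q => (fderiv ℝ G q).flip) y :=
    (ContinuousLinearMap.flipₗᵢ ℝ E E (E →L[ℝ] ℝ)).contDiff.contDiffAt.comp y hG'
  have h2 : ContDiffAt ℝ ∞ (christoffelFirst G) y :=
    (hG'.add hflip).sub (contDiffAt_const.clm_comp hflip)
  exact (contDiffAt_const (c := (2⁻¹ : ℝ))).smul
    (((ContinuousLinearMap.compL ℝ E (E →L[ℝ] ℝ) E).contDiff.contDiffAt.comp y h1).clm_comp h2)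

/-! ### Symmetries of the curvature in coordinates -/

theorem coordCurvature_swap (v w z : E) :
    coordCurvature G y w v z = -coordCurvature G y v w z := by
  simp only [coordCurvature]
  abel

/-- The first Bianchi identity. -/
theorem coordCurvature_bianchi (hG : ∀ᶠ q in 𝓝 y, DifferentiableAt ℝ G q)
    (hs : ∀ᶠ q in 𝓝 y, ∀ v w, G q v w = G q w v)
    (hΓ : DifferentiableAt ℝ (christoffel G) y) (v w z : E) :
    coordCurvature G y v w z + coordCurvature G y w z v + coordCurvature G y z v w = 0 := by
  have hsym : ∀ᶠ q in 𝓝 y, ∀ v w, christoffel G q v w = christoffel G q w v := by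
    filter_upwards [hG, hs.eventually_nhds] with q hq hsq v w using christoffel_symm hq hsq v w
  have hD (u v w : E) :
      fderiv ℝ (christoffel G) y u v w = fderiv ℝ (christoffel G) y u w v := by
    have h (v w : E) : fderiv ℝ (fun q => christoffel G q v w) y u
        = fderiv ℝ (christoffel G) y u v w := by
      rw [fderiv_clm_apply_const (hΓ.clm_apply (differentiableAt_const v)),
        fderiv_clm_apply_const hΓ]
    rw [← h, ← h]
    have : (fun q => christoffel G q v w) =ᶠ[𝓝 y] fun q => christoffel G q w v :=
      hsym.mono fun q hq => hq v w
    rw [this.fderiv_eq]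
  have hs0 := hsym.self_of_nhds
  simp only [coordCurvature]
  rw [hD v w z, hD w z v, hD z v w, hs0 w z, hs0 v z, hs0 v w]
  abel

/-- The curvature endomorphisms are skew-adjoint: differentiate `fderiv_metric` once more and use
the symmetry of the second derivative of the metric. -/
theorem metric_coordCurvature_swap (hG : ∀ᶠ q in 𝓝 y, DifferentiableAt ℝ G q)
    (hG2 : ContDiffAt ℝ 2 G y)
    (hs : ∀ᶠ q in 𝓝 y, ∀ v w, G q v w = G q w v) (hi : ∀ᶠ q in 𝓝 y, (G q).IsInvertible)
    (hΓ : DifferentiableAt ℝ (christoffel G) y) (v w z z' : E) :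
    G y (coordCurvature G y v w z) z' = -G y z (coordCurvature G y v w z') := by
  have hG' : DifferentiableAt ℝ (fderiv ℝ G) y :=
    (hG2.fderiv_right (m := 1) (by norm_num)).differentiableAt (by norm_num)
  have hG0 := hG.self_of_nhds
  have hm : ∀ᶠ q in 𝓝 y, ∀ v w z, fderiv ℝ G q v w z
      = G q (christoffel G q v w) z + G q w (christoffel G q v z) := by
    filter_upwards [hG, hs.eventually_nhds, hi] with q hq hsq hiq v w z
      using fderiv_metric hq hsq hiq v w z
  have hm0 := hm.self_of_nhds
  have hΓd (v w : E) : DifferentiableAt ℝ (fun q => christoffel G q v w) y :=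
    (hΓ.clm_apply (differentiableAt_const v)).clm_apply (differentiableAt_const w)
  have hΓ' (u v w : E) : fderiv ℝ (fun q => christoffel G q v w) y u
      = fderiv ℝ (christoffel G) y u v w := by
    rw [fderiv_clm_apply_const (hΓ.clm_apply (differentiableAt_const v)),
      fderiv_clm_apply_const hΓ]
  -- the second derivative of the metric, computed from `fderiv_metric`
  have key (u v : E) : fderiv ℝ (fderiv ℝ G) y u v z z' =
      (G y (christoffel G y u (christoffel G y v z)) z'
        + G y (christoffel G y v z) (christoffel G y u z')
        + G y (fderiv ℝ (christoffel G) y u v z) z')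
      + (G y (christoffel G y u z) (christoffel G y v z')
        + G y z (christoffel G y u (christoffel G y v z'))
        + G y z (fderiv ℝ (christoffel G) y u v z')) := by
    have h1 : fderiv ℝ (fun q => fderiv ℝ G q v z z') y u = fderiv ℝ (fderiv ℝ G) y u v z z' := by
      rw [fderiv_clm_apply_const ((hG'.clm_apply (differentiableAt_const v)).clm_apply
        (differentiableAt_const z)), fderiv_clm_apply_const (hG'.clm_apply
        (differentiableAt_const v)), fderiv_clm_apply_const hG']
    have h2 : (fun q => fderiv ℝ G q v z z') =ᶠ[𝓝 y] fun q =>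
        G q (christoffel G q v z) z' + G q z (christoffel G q v z') :=
      hm.mono fun q hq => hq v z z'
    have d1 : DifferentiableAt ℝ (fun q => G q (christoffel G q v z) z') y :=
      (hG0.clm_apply (hΓd v z)).clm_apply (differentiableAt_const z')
    have d2 : DifferentiableAt ℝ (fun q => G q z (christoffel G q v z')) y :=
      (hG0.clm_apply (differentiableAt_const z)).clm_apply (hΓd v z')
    rw [← h1, h2.fderiv_eq, fderiv_fun_add d1 d2, add_apply,
      fderiv_bilin_apply hG0 (hΓd v z) (differentiableAt_const z'),
      fderiv_bilin_apply hG0 (differentiableAt_const z) (hΓd v z'), hΓ', hΓ', hm0, hm0]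
    simp
  have hsymm : fderiv ℝ (fderiv ℝ G) y v w = fderiv ℝ (fderiv ℝ G) y w v :=
    (hG2.isSymmSndFDerivAt (by simp)).eq v w
  have e := key v w
  rw [hsymm, key w v] at e
  simp only [coordCurvature, map_add, map_sub, add_apply, sub_apply]
  linarith

end Coordinates

/-! ### Algebra of the structure tensors at a point -/

section Pointwise

variable {V : Type*} [AddCommGroup V] [Module ℝ V] [TopologicalSpace V] [IsTopologicalAddGroup V]
  [ContinuousSMul ℝ V] {s : ℕ}

/-- The algebraic conditions which the structure tensors `(g, φ, ξ_α, η^α)` of a metric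
`f`-manifold satisfy on a tangent space, for a nondegenerate `g` of any signature;
`ε_α = g(ξ_α, ξ_α)`. -/
structure IsMetricFFrame (g : V →L[ℝ] V →L[ℝ] ℝ) (φ : V →L[ℝ] V) (ξ : Fin s → V)
    (η : Fin s → V →L[ℝ] ℝ) : Prop where
  symm : ∀ v w, g v w = g w v
  nondeg : ∀ v, (∀ w, g v w = 0) → v = 0
  φ_cube : ∀ v, φ (φ (φ v)) + φ v = 0
  φ_sq : ∀ v, φ (φ v) = -v + ∑ α, η α v • ξ α
  η_ξ : ∀ α β, η α (ξ β) = if α = β then 1 else 0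
  eps_sq : ∀ α, g (ξ α) (ξ α) * g (ξ α) (ξ α) = 1
  compat : ∀ v w, g (φ v) (φ w) = g v w - ∑ α, g (ξ α) (ξ α) * η α v * η α w

variable {g : V →L[ℝ] V →L[ℝ] ℝ} {φ : V →L[ℝ] V} {ξ : Fin s → V} {η : Fin s → V →L[ℝ] ℝ}

/-- `η̃(v) = ∑ ε_α η^α(v)` on a single vector space. -/
noncomputable def frameEta (g : V →L[ℝ] V →L[ℝ] ℝ) (ξ : Fin s → V) (η : Fin s → V →L[ℝ] ℝ)
    (v : V) : ℝ :=
  ∑ α, g (ξ α) (ξ α) * η α v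

namespace IsMetricFFrame

variable (h : IsMetricFFrame g φ ξ η)
include h

theorem φ_ξ (α : Fin s) : φ (ξ α) = 0 := by
  have h1 : φ (φ (ξ α)) = 0 := by simp [h.φ_sq, h.η_ξ]
  simpa [h1] using h.φ_cube (ξ α)

theorem η_φ (α : Fin s) (v : V) : η α (φ v) = 0 := by
  have h1 := h.φ_cube v
  rw [h.φ_sq (φ v)] at h1
  simpa [h.η_ξ] using congrArg (η α) h1

theorem g_ξ (α : Fin s) (v : V) : g (ξ α) v = g (ξ α) (ξ α) * η α v := by
  have h1 := h.compat (ξ α) v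
  simp [h.φ_ξ, h.η_ξ] at h1
  linarith

theorem g_φ_right (v w : V) : g v (φ w) = -g (φ v) w := by
  have h1 := h.compat v (φ w)
  simp [h.η_φ, h.φ_sq w] at h1
  have h2 : ∑ α, η α w * g (φ v) (ξ α) = 0 := Finset.sum_eq_zero fun α _ => by
    rw [h.symm, h.g_ξ, h.η_φ]
    simp
  linarith

theorem φ_cube' (v : V) : φ (φ (φ v)) = -φ v := eq_neg_of_add_eq_zero_left (h.φ_cube v)

theorem η_eq (α : Fin s) (v : V) : η α v = g (ξ α) (ξ α) * g (ξ α) v := by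
  rw [h.g_ξ α v, ← mul_assoc, h.eps_sq, one_mul]

theorem g_ξ_ξ {α β : Fin s} (hαβ : α ≠ β) : g (ξ α) (ξ β) = 0 := by
  rw [h.g_ξ, h.η_ξ, if_neg hαβ, mul_zero]

theorem g_φ_φsq (v w : V) : g (φ v) (φ (φ w)) = -g (φ v) w := by
  rw [h.g_φ_right (φ v) (φ w), h.g_φ_right (φ (φ v)) w, h.φ_cube']
  simp

theorem eq_zero_of_φ_eq_zero {v : V} (hφ : φ v = 0) (hη : ∀ α, g (ξ α) v = 0) : v = 0 := by
  have h1 := h.φ_sq v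
  simpa [hφ, h.η_eq, hη] using h1

theorem g_sum_ξ (v : V) : g (∑ α, ξ α) v = frameEta g ξ η v := by
  simp only [map_sum, sum_apply, frameEta]
  exact Finset.sum_congr rfl fun α _ => h.g_ξ α v

theorem frameEta_φ (v : V) : frameEta g ξ η (φ v) = 0 := by
  simp [frameEta, h.η_φ]

theorem frameEta_ξ (α : Fin s) : frameEta g ξ η (ξ α) = g (ξ α) (ξ α) := by
  simp [frameEta, h.η_ξ]

theorem φ_sum_ξ : φ (∑ α, ξ α) = 0 := by
  simp [h.φ_ξ]

end IsMetricFFrame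

/-- The relations between the first covariant derivatives at a point of the structure tensors of an
`S`-manifold with respect to a torsion-free metric connection; `D α x` stands for `∇_x ξ_α` and
`A x y` for `(∇_x φ) y`. They express that the connection is metric, that `Φ = dη^α`, that `Φ` is
closed and that the structure is normal. -/
structure IsSJet (g : V →L[ℝ] V →L[ℝ] ℝ) (φ : V →L[ℝ] V) (ξ : Fin s → V) (η : Fin s → V →L[ℝ] ℝ)
    (D : Fin s → V → V) (A : V → V → V) : Prop where
  frame : IsMetricFFrame g φ ξ η
  A_zero : ∀ y, A 0 y = 0
  D_metric : ∀ α β x, g (D α x) (ξ β) + g (ξ α) (D β x) = 0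
  D_linear : ∀ α x, D α x = -D α (φ (φ x)) + ∑ β, η β x • D α (ξ β)
  A_skew : ∀ x y z, g (A x y) z = -g y (A x z)
  A_ξ : ∀ α x, A x (ξ α) = -φ (D α x)
  A_φ : ∀ x y, φ (A x y) + A x (φ y)
    = ∑ α, ((g (ξ α) (ξ α) * g (D α x) y) • ξ α + η α y • D α x)
  contact : ∀ α x y, g (ξ α) (ξ α) * (g (D α x) y - g (D α y) x) = 2 * g x (φ y)
  closed : ∀ x y z, g y (A x z) + g z (A y x) + g x (A z y) = 0
  normal : ∀ x y, A (φ x) y - A (φ y) x - φ (A x y) + φ (A y x)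
    + (2 * g x (φ y)) • ∑ α, ξ α = 0

namespace IsSJet

variable {D : Fin s → V → V} {A : V → V → V} (h : IsSJet g φ ξ η D A)
include h

theorem g_D_ξ_comm (α β : Fin s) (x : V) : g (D β x) (ξ α) = g (D β (ξ α)) x := by
  have h1 := h.contact β x (ξ α)
  rw [h.frame.φ_ξ, map_zero, mul_zero] at h1
  have h2 : g (ξ β) (ξ β) ≠ 0 := fun h0 => by simpa [h0] using h.frame.eps_sq β
  linarith [(mul_eq_zero.1 h1).resolve_left h2]

theorem g_D_ξ_skew (α β : Fin s) (x : V) : g (D α x) (ξ β) = -g (D β x) (ξ α) := by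
  rw [h.frame.symm (D β x)]
  linarith [h.D_metric α β x]

theorem g_D_ξ_ξ (α β γ : Fin s) : g (D β (ξ γ)) (ξ α) = 0 := by
  -- the expression is symmetric in `α, γ` and skew in `α, β`
  have e1 := h.g_D_ξ_comm α β (ξ γ)
  have e2 := h.g_D_ξ_skew β γ (ξ α)
  have e3 := h.g_D_ξ_comm α γ (ξ β)
  have e4 := h.g_D_ξ_skew γ α (ξ β)
  have e5 := h.g_D_ξ_comm γ α (ξ β)
  have e6 := h.g_D_ξ_skew α β (ξ γ)
  linarith

theorem D_ξ_comm (α β : Fin s) : D β (ξ α) = D α (ξ β) := by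
  have h1 := h.normal (ξ α) (ξ β)
  rw [h.frame.φ_ξ, h.frame.φ_ξ, h.A_zero, h.A_zero, h.A_ξ, h.A_ξ] at h1
  simp only [map_zero, mul_zero, zero_smul, map_neg] at h1
  have h2 : φ (φ (D β (ξ α) - D α (ξ β))) = 0 := by
    rw [map_sub, map_sub, ← h1]
    abel
  have h3 : φ (D β (ξ α) - D α (ξ β)) = 0 := by
    have := h.frame.φ_cube (D β (ξ α) - D α (ξ β))
    rwa [h2, map_zero, zero_add] at this
  refine sub_eq_zero.1 (h.frame.eq_zero_of_φ_eq_zero h3 fun γ => ?_)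
  rw [h.frame.symm, map_sub, sub_apply, h.g_D_ξ_ξ, h.g_D_ξ_ξ, sub_zero]

theorem g_D_ξ (α β : Fin s) (x : V) : g (D β x) (ξ α) = 0 := by
  have e1 := h.g_D_ξ_comm α β x
  have e2 := h.g_D_ξ_comm β α x
  have e3 := h.g_D_ξ_skew α β x
  rw [h.D_ξ_comm] at e1
  linarith

theorem D_ξ (α β : Fin s) : D β (ξ α) = 0 :=
  h.frame.nondeg _ fun x => by rw [← h.g_D_ξ_comm, h.g_D_ξ]

/-- The characteristic vector fields are Killing. -/
theorem killing (α : Fin s) (x y : V) : g (D α x) y + g (D α y) x = 0 := by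
  have hφ (x y : V) : g (D α (φ x)) (φ y) + g (D α (φ y)) (φ x) = 0 := by
    have h1 := h.closed (ξ α) (φ y) x
    have h2 := h.A_skew x (ξ α) (φ y)
    rw [h.A_ξ, ← neg_eq_iff_eq_neg] at h2
    rw [h.A_ξ, ← h2] at h1
    have h3 := congrArg (fun v => g v y) (h.normal x (ξ α))
    simp only [h.A_ξ, h.frame.φ_ξ, h.A_zero, map_zero, mul_zero, zero_smul, add_apply, sub_apply,
      map_add, map_sub, map_neg, neg_apply, add_zero, sub_zero, zero_apply, neg_neg] at h1 h3
    have h4 (v : V) : g (φ v) y = -g v (φ y) := by rw [h.frame.g_φ_right, neg_neg]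
    rw [h4, h4, h4] at h3
    have h5 := h.frame.g_φ_right x (D α (φ y))
    rw [h.frame.symm (A (ξ α) x)] at h3
    rw [h.frame.symm (D α (φ y)) (φ x)]
    linarith
  have hx (x y : V) : g (D α x) y = -g (D α (φ (φ x))) y := by
    rw [h.D_linear α x]
    simp [h.D_ξ]
  have hy (x y : V) : g (D α x) y = -g (D α x) (φ (φ y)) := by
    rw [h.frame.φ_sq y]
    simp [h.g_D_ξ]
  rw [hx x, hx y, hy _ y, hy _ x, neg_neg, neg_neg]
  exact hφ _ _

/-- `∇_x ξ_α = -ε_α φ x`. -/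
theorem D_eq (α : Fin s) (x : V) : D α x = -(g (ξ α) (ξ α) • φ x) := by
  refine sub_eq_zero.1 (h.frame.nondeg _ fun y => ?_)
  have h1 := h.contact α x y
  have h2 := h.killing α x y
  have h3 : g (D α x) y = g (ξ α) (ξ α) * g x (φ y) := by
    calc g (D α x) y = (g (ξ α) (ξ α) * g (ξ α) (ξ α)) * g (D α x) y := by
          rw [h.frame.eps_sq, one_mul]
      _ = g (ξ α) (ξ α) * (g (ξ α) (ξ α) * (g (D α x) y - g (D α y) x) / 2) := by
          rw [← neg_eq_of_add_eq_zero_right h2]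
          ring
      _ = _ := by rw [h1]; ring
  simp [h3, h.frame.g_φ_right]

/-- The covariant derivative of `φ` on an `S`-manifold:
`(∇_x φ) y = g(φx, φy) ξ̃ + η̃(y) φ² x`. With `B` the difference of the two sides, the trilinear
form `b(x, y, z) = g(B_x y, z)` satisfies the homogeneous versions of the relations for `A` in
`IsSJet`, and these force `b = 0`. -/
theorem A_eq (x y : V) :
    A x y = g (φ x) (φ y) • (∑ α, ξ α) + frameEta g ξ η y • φ (φ x) := by
  set C : V → V → V := fun x y => g (φ x) (φ y) • (∑ α, ξ α) + frameEta g ξ η y • φ (φ x) with hC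
  have hF := h.frame
  have hgφ (v w : V) : g (φ (φ v)) w = -g (φ v) (φ w) := by rw [hF.g_φ_right, neg_neg]
  have gC (x y z : V) : g (C x y) z
      = g (φ x) (φ y) * frameEta g ξ η z - frameEta g ξ η y * g (φ x) (φ z) := by
    simp [hC, hF.g_sum_ξ, hgφ, -map_sum]
    ring
  have skew (x y z : V) : g (A x y - C x y) z = -g y (A x z - C x z) := by
    rw [hF.symm y, map_sub, map_sub, sub_apply, sub_apply, h.A_skew, gC, gC, hF.symm y]
    ring
  have anti (x y : V) : φ (A x y - C x y) = -(A x (φ y) - C x (φ y)) := by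
    have h1 := h.A_φ x y
    have h2 : φ (C x y) + C x (φ y)
        = ∑ α, ((g (ξ α) (ξ α) * g (D α x) y) • ξ α + η α y • D α x) := by
      simp only [hC, map_add, map_smul, hF.φ_sum_ξ, hF.frameEta_φ, hF.φ_cube', hF.g_φ_φsq, h.D_eq,
        smul_zero, zero_add, zero_smul, add_zero, map_neg, neg_apply, smul_apply, smul_eq_mul,
        mul_neg, ← mul_assoc, hF.eps_sq, one_mul, Finset.sum_add_distrib, ← Finset.smul_sum,
        smul_neg, smul_smul, Finset.sum_neg_distrib, ← Finset.sum_smul]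
      rw [add_comm]
      congr 3
      rw [frameEta]
      exact Finset.sum_congr rfl fun α _ => mul_comm _ _
    rw [map_sub, neg_sub, sub_eq_sub_iff_add_eq_add, h1, ← h2]
    abel
  have cyc (x y z : V) :
      g (A x y - C x y) z + g (A y z - C y z) x + g (A z x - C z x) y = 0 := by
    have h1 := h.closed x z y
    rw [hF.symm z, hF.symm y, hF.symm x] at h1
    -- the closedness relation runs through the triple in the opposite cyclic order
    have h2 := h.A_skew z x y
    have h3 := h.A_skew y z x
    have h4 := h.A_skew x y z
    rw [hF.symm _ (A _ _)] at h2 h3 h4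
    simp only [map_sub, sub_apply, gC]
    rw [hF.symm (φ y) (φ x), hF.symm (φ z) (φ x), hF.symm (φ z) (φ y)]
    linarith
  have norm (x y z : V) : g (A (φ x) y - C (φ x) y) z - g (A (φ y) x - C (φ y) x) z
      + g (A x y - C x y) (φ z) - g (A y x - C y x) (φ z) = 0 := by
    have h1 := congrArg (fun v => g v z) (h.normal x y)
    have h4 (v w : V) : g (φ v) w = -g v (φ w) := by rw [hF.g_φ_right, neg_neg]
    simp only [map_add, map_sub, add_apply, sub_apply, map_smul, smul_apply, smul_eq_mul, map_zero,
      zero_apply, hF.g_sum_ξ, h4 _ z] at h1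
    have h5 (v w : V) : g (φ (φ v)) (φ w) = g (φ v) w := by rw [hgφ, hF.g_φ_φsq, neg_neg]
    have h6 : g (φ x) y = -g x (φ y) := h4 _ _
    have h7 : g (φ y) x = g x (φ y) := hF.symm _ _
    simp only [map_sub, sub_apply, gC, h5, h6, h7, hF.frameEta_φ, hF.g_φ_φsq]
    linarith
  have gφ (x y z : V) : g (A (φ x) y - C (φ x) y) z = 0 := by
    have key (x y z : V) : g (A (φ x) y - C (φ x) y) z + g (A (φ y) z - C (φ y) z) x
        = g (A (φ z) x - C (φ z) x) y := by
      have h1 := norm x y z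
      have h2 := cyc x y (φ z)
      have h3 := skew (φ y) x z
      have h4 := skew y x (φ z)
      rw [hF.symm x] at h3 h4
      linarith
    have k1 := key x y z
    have k2 := key y z x
    have k3 := key z x y
    linarith
  have gξ (x : V) (α : Fin s) : A x (ξ α) - C x (ξ α) = 0 := by
    rw [h.A_ξ, h.D_eq]
    simp [hC, hF.φ_ξ, hF.frameEta_ξ]
  have ηB (x y : V) (α : Fin s) : g (ξ α) (A x y - C x y) = 0 := by
    rw [← neg_eq_zero, ← skew, gξ]
    simp
  have hBφ (x y : V) : A x (φ y) - C x (φ y) = 0 := by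
    refine hF.eq_zero_of_φ_eq_zero (hF.nondeg _ fun z => ?_) (ηB x (φ y))
    have h1 := cyc x (φ y) (φ z)
    rw [gφ, gφ, hF.g_φ_right] at h1
    linarith
  have hB : A x y - C x y = 0 := by
    refine hF.eq_zero_of_φ_eq_zero ?_ (ηB x y)
    rw [anti, hBφ, neg_zero]
  exact sub_eq_zero.1 hB

end IsSJet

end Pointwise

/-! ### The curvature of an `S`-structure in coordinates -/

section LocalStructure

variable {E : Type*} [NormedAddCommGroup E] [NormedSpace ℝ E] {s : ℕ}
  {G : E → E →L[ℝ] E →L[ℝ] ℝ} {φ : E → E →L[ℝ] E} {ξ : Fin s → E → E} {η : Fin s → E → E →L[ℝ] ℝ}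
  {y : E}

/-- The coordinate expressions of the structure tensors of an `S`-manifold near the point `y` of the
coordinate space `E`, of class `C^k` at `y`. The contact and normality conditions are written out
for constant vector fields, whose Lie brackets vanish. -/
structure IsSGerm (k : WithTop ℕ∞) (G : E → E →L[ℝ] E →L[ℝ] ℝ) (φ : E → E →L[ℝ] E)
    (ξ : Fin s → E → E) (η : Fin s → E → E →L[ℝ] ℝ) (y : E) : Prop where
  smooth_G : ContDiffAt ℝ k G y
  smooth_φ : ContDiffAt ℝ k φ y
  smooth_ξ : ∀ α, ContDiffAt ℝ k (ξ α) y
  smooth_η : ∀ α, ContDiffAt ℝ k (η α) y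
  invertible : ∀ᶠ q in 𝓝 y, (G q).IsInvertible
  frame : ∀ᶠ q in 𝓝 y, IsMetricFFrame (G q) (φ q) (fun α => ξ α q) (fun α => η α q)
  contact : ∀ᶠ q in 𝓝 y, ∀ α v w,
    2 * G q v (φ q w) = fderiv ℝ (η α) q v w - fderiv ℝ (η α) q w v
  normal : ∀ᶠ q in 𝓝 y, ∀ v w,
    fderiv ℝ φ q (φ q v) w - fderiv ℝ φ q (φ q w) v - φ q (fderiv ℝ φ q v w)
      + φ q (fderiv ℝ φ q w v) + (2 * G q v (φ q w)) • ∑ α, ξ α q = 0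

/-- The covariant derivative `∇_v X` in coordinates. -/
noncomputable def covDerivField (G : E → E →L[ℝ] E →L[ℝ] ℝ) (X : E → E) (y v : E) : E :=
  fderiv ℝ X y v + christoffel G y v (X y)

/-- The covariant derivative `(∇_v φ) w` of an endomorphism field in coordinates. -/
noncomputable def covDerivEndo (G : E → E →L[ℝ] E →L[ℝ] ℝ) (φ : E → E →L[ℝ] E) (y v w : E) : E :=
  fderiv ℝ φ y v w + christoffel G y v (φ y w) - φ y (christoffel G y v w)

theorem fderiv_eq_zero_of_mul_self_eq_one {f : E → ℝ} (hf : DifferentiableAt ℝ f y)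
    (h : ∀ᶠ q in 𝓝 y, f q * f q = 1) (v : E) : fderiv ℝ f y v = 0 := by
  have h1 : (fun q => f q * f q) =ᶠ[𝓝 y] fun _ => (1 : ℝ) := h
  have h2 := h1.fderiv_eq (𝕜 := ℝ)
  rw [fderiv_fun_mul hf hf] at h2
  have h3 := congrArg (fun L : E →L[ℝ] ℝ => L v) h2
  have h4 : f y ≠ 0 := fun h0 => by simpa [h0] using h.self_of_nhds
  simp at h3
  exact h3.resolve_left h4

namespace IsSGerm

variable {k : WithTop ℕ∞}

theorem eventually_two (h : IsSGerm ∞ G φ ξ η y) : ∀ᶠ q in 𝓝 y, IsSGerm 2 G φ ξ η q := by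
  have c {F : Type _} [NormedAddCommGroup F] [NormedSpace ℝ F] {f : E → F}
      (hf : ContDiffAt ℝ ∞ f y) : ∀ᶠ q in 𝓝 y, ContDiffAt ℝ 2 f q :=
    (hf.of_le (m := 2) (WithTop.coe_le_coe.2 (le_top : (2 : ℕ∞) ≤ ⊤))).eventually (by simp)
  filter_upwards [c h.smooth_G, c h.smooth_φ, eventually_all.2 fun α => c (h.smooth_ξ α),
    eventually_all.2 fun α => c (h.smooth_η α), h.invertible.eventually_nhds,
    h.frame.eventually_nhds, h.contact.eventually_nhds, h.normal.eventually_nhds]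
    with q h1 h2 h3 h4 h5 h6 h7 h8 using ⟨h1, h2, h3, h4, h5, h6, h7, h8⟩

theorem of_le {m : WithTop ℕ∞} (h : IsSGerm k G φ ξ η y) (hm : m ≤ k) : IsSGerm m G φ ξ η y :=
  ⟨h.smooth_G.of_le hm, h.smooth_φ.of_le hm, fun α => (h.smooth_ξ α).of_le hm,
    fun α => (h.smooth_η α).of_le hm, h.invertible, h.frame, h.contact, h.normal⟩

variable (h : IsSGerm 2 G φ ξ η y)
include h

theorem symm : ∀ᶠ q in 𝓝 y, ∀ v w, G q v w = G q w v := h.frame.mono fun _ hq => hq.symm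

theorem diff_G : DifferentiableAt ℝ G y := h.smooth_G.differentiableAt (by simp)

theorem diff_φ : DifferentiableAt ℝ φ y := h.smooth_φ.differentiableAt (by simp)

theorem diff_ξ (α : Fin s) : DifferentiableAt ℝ (ξ α) y := (h.smooth_ξ α).differentiableAt (by simp)

theorem diff_η (α : Fin s) : DifferentiableAt ℝ (η α) y := (h.smooth_η α).differentiableAt (by simp)

theorem fderiv_G (v w z : E) :
    fderiv ℝ G y v w z = G y (christoffel G y v w) z + G y w (christoffel G y v z) :=
  fderiv_metric h.diff_G h.symm h.invertible.self_of_nhds v w z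

/-- Metric compatibility for arbitrary vector fields. -/
theorem fderiv_G_apply {A B : E → E} (hA : DifferentiableAt ℝ A y) (hB : DifferentiableAt ℝ B y)
    (v : E) : fderiv ℝ (fun q => G q (A q) (B q)) y v
      = G y (covDerivField G A y v) (B y) + G y (A y) (covDerivField G B y v) := by
  rw [fderiv_bilin_apply h.diff_G hA hB, h.fderiv_G]
  simp only [covDerivField, map_add, add_apply]
  ring

theorem fderiv_eps (α : Fin s) (v : E) : fderiv ℝ (fun q => G q (ξ α q) (ξ α q)) y v = 0 :=
  fderiv_eq_zero_of_mul_self_eq_one ((h.diff_G.clm_apply (h.diff_ξ α)).clm_apply (h.diff_ξ α))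
    (h.frame.mono fun _ hq => hq.eps_sq α) v

theorem D_metric (α β : Fin s) (v : E) : G y (covDerivField G (ξ α) y v) (ξ β y)
    + G y (ξ α y) (covDerivField G (ξ β) y v) = 0 := by
  rw [← h.fderiv_G_apply (h.diff_ξ α) (h.diff_ξ β)]
  rcases eq_or_ne α β with rfl | hαβ
  · exact h.fderiv_eps α v
  · have : (fun q => G q (ξ α q) (ξ β q)) =ᶠ[𝓝 y] fun _ => 0 :=
      h.frame.mono fun q hq => hq.g_ξ_ξ hαβ
    rw [this.fderiv_eq]
    simp

/-- `(∇_v η^α)(w) = ε_α g(∇_v ξ_α, w)`. -/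
theorem fderiv_η (α : Fin s) (v w : E) : fderiv ℝ (η α) y v w
    = G y (ξ α y) (ξ α y) * G y (covDerivField G (ξ α) y v) w + η α y (christoffel G y v w) := by
  have hw : DifferentiableAt ℝ (fun _ : E => w) y := differentiableAt_const w
  have h1 : (fun q => η α q w) =ᶠ[𝓝 y] fun q => G q (ξ α q) (ξ α q) * G q (ξ α q) w :=
    h.frame.mono fun q hq => hq.η_eq α w
  have h2 : DifferentiableAt ℝ (fun q => G q (ξ α q) (ξ α q)) y :=
    (h.diff_G.clm_apply (h.diff_ξ α)).clm_apply (h.diff_ξ α)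
  have h3 : DifferentiableAt ℝ (fun q => G q (ξ α q) w) y :=
    (h.diff_G.clm_apply (h.diff_ξ α)).clm_apply hw
  rw [← fderiv_clm_apply_const (h.diff_η α), h1.fderiv_eq, fderiv_fun_mul h2 h3]
  simp only [add_apply, smul_apply, smul_eq_mul, h.fderiv_eps, mul_zero, add_zero]
  rw [h.fderiv_G_apply (h.diff_ξ α) hw, h.frame.self_of_nhds.η_eq α]
  simp [covDerivField]
  ring

theorem A_skew (v w z : E) :
    G y (covDerivEndo G φ y v w) z = -G y w (covDerivEndo G φ y v z) := by
  have hc (w : E) : DifferentiableAt ℝ (fun _ : E => w) y := differentiableAt_const w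
  have hφ (w : E) : DifferentiableAt ℝ (fun q => φ q w) y := h.diff_φ.clm_apply (hc w)
  have h1 : (fun q => G q w (φ q z)) =ᶠ[𝓝 y] fun q => -G q (φ q w) z :=
    h.frame.mono fun q hq => hq.g_φ_right w z
  have h2 := h1.fderiv_eq (𝕜 := ℝ)
  rw [fderiv_fun_neg] at h2
  have h3 := congrArg (fun L : E →L[ℝ] ℝ => L v) h2
  simp only [neg_apply] at h3
  rw [h.fderiv_G_apply (hc w) (hφ z), h.fderiv_G_apply (hφ w) (hc z)] at h3
  have h4 := h.frame.self_of_nhds.g_φ_right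
  have h5 := h4 (christoffel G y v w) z
  have h6 := h4 w (christoffel G y v z)
  simp only [covDerivField, fderiv_clm_apply_const h.diff_φ, fderiv_fun_const, Pi.zero_apply,
    zero_apply, zero_add, map_add, add_apply] at h3
  simp only [covDerivEndo, map_add, map_sub, add_apply, sub_apply]
  linarith

theorem A_ξ (α : Fin s) (v : E) :
    covDerivEndo G φ y v (ξ α y) = -φ y (covDerivField G (ξ α) y v) := by
  have h1 : (fun q => φ q (ξ α q)) =ᶠ[𝓝 y] fun _ => 0 := h.frame.mono fun q hq => hq.φ_ξ α
  have h2 := congrArg (fun L : E →L[ℝ] _ => L v) h1.fderiv_eq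
  simp only [fderiv_clm_apply_apply h.diff_φ (h.diff_ξ α), fderiv_fun_const, Pi.zero_apply,
    zero_apply] at h2
  have h3 : φ y (ξ α y) = 0 := h1.self_of_nhds
  simp only [covDerivEndo, covDerivField, h3, map_zero, map_add, eq_neg_of_add_eq_zero_left h2]
  abel

theorem A_φ (v w : E) : φ y (covDerivEndo G φ y v w) + covDerivEndo G φ y v (φ y w)
    = ∑ α, ((G y (ξ α y) (ξ α y) * G y (covDerivField G (ξ α) y v) w) • ξ α y
      + η α y w • covDerivField G (ξ α) y v) := by
  have hw : DifferentiableAt ℝ (fun _ : E => w) y := differentiableAt_const w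
  have h0 := h.frame.self_of_nhds
  have h1 : (fun q => φ q (φ q w)) =ᶠ[𝓝 y] fun q => -w + ∑ α, η α q w • ξ α q :=
    h.frame.mono fun q hq => hq.φ_sq w
  have h2 := congrArg (fun L : E →L[ℝ] _ => L v) h1.fderiv_eq
  have hηw (α : Fin s) : DifferentiableAt ℝ (fun q => η α q w) y := (h.diff_η α).clm_apply hw
  have h3 (α : Fin s) : fderiv ℝ (fun q => η α q w • ξ α q) y v
      = fderiv ℝ (η α) y v w • ξ α y + η α y w • fderiv ℝ (ξ α) y v := by
    rw [fderiv_fun_smul (hηw α) (h.diff_ξ α)]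
    simp [fderiv_clm_apply_const (h.diff_η α), add_comm]
  simp only [fderiv_clm_apply_apply h.diff_φ (h.diff_φ.clm_apply hw),
    fderiv_clm_apply_const h.diff_φ] at h2
  rw [fderiv_const_add, fderiv_fun_sum fun α _ => (hηw α).fun_smul (h.diff_ξ α),
    sum_apply] at h2
  simp only [h3, h.fderiv_η] at h2
  have h4 : (∑ α, ((G y (ξ α y) (ξ α y) * G y (covDerivField G (ξ α) y v) w) • ξ α y
      + η α y w • covDerivField G (ξ α) y v))
      + ∑ α, η α y (christoffel G y v w) • ξ α y
      = (fderiv ℝ φ y v (φ y w) + φ y (fderiv ℝ φ y v w))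
        + christoffel G y v (∑ α, η α y w • ξ α y) := by
    rw [h2, map_sum, ← Finset.sum_add_distrib, ← Finset.sum_add_distrib]
    refine Finset.sum_congr rfl fun α _ => ?_
    simp only [map_smul, covDerivField]
    module
  have h5 : ∑ α, η α y (christoffel G y v w) • ξ α y
      = φ y (φ y (christoffel G y v w)) + christoffel G y v w := by
    rw [h0.φ_sq]
    abel
  have h6 : ∑ α, η α y w • ξ α y = φ y (φ y w) + w := by
    rw [h0.φ_sq]
    abel
  rw [h5, h6] at h4
  rw [eq_sub_of_add_eq h4]
  simp only [covDerivEndo, map_add, map_sub]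
  abel

theorem christoffel_comm (v w : E) : christoffel G y v w = christoffel G y w v :=
  christoffel_symm h.diff_G h.symm v w

/-- The fundamental form is closed, because it is the exterior derivative of `η^α`. -/
theorem closed (α : Fin s) (u v w : E) : G y v (covDerivEndo G φ y u w)
    + G y w (covDerivEndo G φ y v u) + G y u (covDerivEndo G φ y w v) = 0 := by
  have hc (w : E) : DifferentiableAt ℝ (fun _ : E => w) y := differentiableAt_const w
  have hη' : DifferentiableAt ℝ (fderiv ℝ (η α)) y :=
    ((h.smooth_η α).fderiv_right (m := 1) (by norm_num)).differentiableAt (by norm_num)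
  have hs (u v w : E) : fderiv ℝ (fderiv ℝ (η α)) y u v w = fderiv ℝ (fderiv ℝ (η α)) y v u w := by
    rw [((h.smooth_η α).isSymmSndFDerivAt (by simp)).eq u v]
  have key (u v w : E) : 2 * (G y (christoffel G y u v) (φ y w) + G y v (covDerivEndo G φ y u w)
      + G y v (φ y (christoffel G y u w)))
      = fderiv ℝ (fderiv ℝ (η α)) y u v w - fderiv ℝ (fderiv ℝ (η α)) y u w v := by
    have h1 : (fun q => 2 * G q v (φ q w)) =ᶠ[𝓝 y]
        fun q => fderiv ℝ (η α) q v w - fderiv ℝ (η α) q w v :=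
      h.contact.mono fun q hq => hq α v w
    have h2 := congrArg (fun L : E →L[ℝ] _ => L u) h1.fderiv_eq
    have hd (v w : E) : DifferentiableAt ℝ (fun q => fderiv ℝ (η α) q v w) y :=
      (hη'.clm_apply (hc v)).clm_apply (hc w)
    have hd' (v w : E) : fderiv ℝ (fun q => fderiv ℝ (η α) q v w) y u
        = fderiv ℝ (fderiv ℝ (η α)) y u v w := by
      rw [fderiv_clm_apply_const (hη'.clm_apply (hc v)), fderiv_clm_apply_const hη']
    have hG : DifferentiableAt ℝ (fun q => G q v (φ q w)) y :=
      (h.diff_G.clm_apply (hc v)).clm_apply (h.diff_φ.clm_apply (hc w))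
    simp only [fderiv_fun_sub (hd v w) (hd w v), sub_apply, hd', fderiv_const_mul hG,
      smul_apply, smul_eq_mul] at h2
    rw [← h2, h.fderiv_G_apply (hc v) (h.diff_φ.clm_apply (hc w))]
    simp only [covDerivField, covDerivEndo, fderiv_fun_const, Pi.zero_apply, zero_apply, zero_add,
      fderiv_clm_apply_const h.diff_φ, map_add, map_sub]
    ring
  have k1 := key u v w
  have k2 := key v w u
  have k3 := key w u v
  have hΦ (v w : E) : G y v (φ y w) = -G y w (φ y v) := by
    rw [h.frame.self_of_nhds.g_φ_right v, h.frame.self_of_nhds.symm]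
  rw [hΦ v, h.christoffel_comm u w] at k1
  rw [hΦ w (christoffel G y v u), h.christoffel_comm v u] at k2
  rw [hΦ u, h.christoffel_comm w v] at k3
  rw [hs u v w, hs u w v] at k1
  rw [hs v w u] at k2
  rw [hΦ (christoffel G y u v), hΦ (christoffel G y v w), hΦ (christoffel G y w u)] at *
  linarith

/-- At each point the first covariant derivatives of the structure tensors form an `IsSJet`. -/
theorem isSJet [NeZero s] : IsSJet (G y) (φ y) (fun α => ξ α y) (fun α => η α y)
    (fun α => covDerivField G (ξ α) y) (covDerivEndo G φ y) where
  frame := h.frame.self_of_nhds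
  A_zero w := by simp [covDerivEndo]
  D_metric := h.D_metric
  D_linear α x := by
    have h1 : x = -φ y (φ y x) + ∑ β, η β y x • ξ β y := by
      rw [h.frame.self_of_nhds.φ_sq]
      abel
    let L : E →L[ℝ] E := fderiv ℝ (ξ α) y + (christoffel G y).flip (ξ α y)
    have hL (v : E) : covDerivField G (ξ α) y v = L v := by simp [L, covDerivField]
    simp only [hL]
    conv_lhs => rw [h1]
    simp only [map_add, map_neg, map_sum, map_smul]
  A_skew := h.A_skew
  A_ξ := h.A_ξ
  A_φ := h.A_φ
  contact α v w := by
    have h1 := h.contact.self_of_nhds α v w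
    rw [h.fderiv_η, h.fderiv_η, h.christoffel_comm v w] at h1
    linarith
  closed := h.closed 0
  normal v w := by
    rw [← h.normal.self_of_nhds v w]
    simp only [covDerivEndo, map_add, map_sub]
    rw [h.christoffel_comm (φ y w) (φ y v), h.christoffel_comm (φ y w) v,
      h.christoffel_comm (φ y v) w, h.christoffel_comm w v]
    abel

omit h

/-- The curvature of an `S`-structure in coordinates, applied to a characteristic vector field. -/
theorem coordCurvature_ξ [NeZero s] [CompleteSpace E] (h : IsSGerm ∞ G φ ξ η y) (α : Fin s)
    (v w : E) : coordCurvature G y v w (ξ α y)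
      = G y (ξ α y) (ξ α y) • (frameEta (G y) (fun α => ξ α y) (fun α => η α y) v • φ y (φ y w)
        - frameEta (G y) (fun α => ξ α y) (fun α => η α y) w • φ y (φ y v)) := by
  have h' : IsSGerm 2 G φ ξ η y := h.of_le (WithTop.coe_le_coe.2 (le_top : (2 : ℕ∞) ≤ ⊤))
  have hc (w : E) : DifferentiableAt ℝ (fun _ : E => w) y := differentiableAt_const w
  have hΓ : DifferentiableAt ℝ (christoffel G) y :=
    (contDiffAt_christoffel h.smooth_G h.invertible.self_of_nhds).differentiableAt (by simp)
  have hξ' : DifferentiableAt ℝ (fderiv ℝ (ξ α)) y :=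
    ((h'.smooth_ξ α).fderiv_right (m := 1) (by norm_num)).differentiableAt (by norm_num)
  have heps : DifferentiableAt ℝ (fun q => G q (ξ α q) (ξ α q)) y :=
    (h'.diff_G.clm_apply (h'.diff_ξ α)).clm_apply (h'.diff_ξ α)
  have hD : ∀ᶠ q in 𝓝 y, ∀ w, fderiv ℝ (ξ α) q w + christoffel G q w (ξ α q)
      = -(G q (ξ α q) (ξ α q) • φ q w) :=
    h.eventually_two.mono fun q hq w => hq.isSJet.D_eq α w
  have hD0 (w : E) : fderiv ℝ (ξ α) y w
      = -(G y (ξ α y) (ξ α y) • φ y w) - christoffel G y w (ξ α y) :=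
    eq_sub_of_add_eq (hD.self_of_nhds w)
  -- the derivative of `∇_w ξ_α = -ε_α φ w` in the direction `v`
  have key (v w : E) : fderiv ℝ (fderiv ℝ (ξ α)) y v w + (fderiv ℝ (christoffel G) y v w (ξ α y)
      + christoffel G y w (fderiv ℝ (ξ α) y v))
      = -(G y (ξ α y) (ξ α y) • fderiv ℝ φ y v w) := by
    have h1 : (fun q => fderiv ℝ (ξ α) q w + christoffel G q w (ξ α q)) =ᶠ[𝓝 y]
        fun q => -(G q (ξ α q) (ξ α q) • φ q w) := hD.mono fun q hq => hq w
    have h2 := congrArg (fun L : E →L[ℝ] _ => L v) h1.fderiv_eq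
    have d1 : DifferentiableAt ℝ (fun q => fderiv ℝ (ξ α) q w) y := hξ'.clm_apply (hc w)
    have d2 : DifferentiableAt ℝ (fun q => christoffel G q w) y := hΓ.clm_apply (hc w)
    have d3 : DifferentiableAt ℝ (fun q => φ q w) y := h'.diff_φ.clm_apply (hc w)
    rw [fderiv_fun_add d1 (d2.clm_apply (h'.diff_ξ α)), fderiv_fun_neg,
      fderiv_fun_smul heps d3] at h2
    simpa [fderiv_clm_apply_const hξ', fderiv_clm_apply_apply d2 (h'.diff_ξ α),
      fderiv_clm_apply_const hΓ, h'.fderiv_eps, fderiv_clm_apply_const h'.diff_φ] using h2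
  have hs : fderiv ℝ (fderiv ℝ (ξ α)) y v w = fderiv ℝ (fderiv ℝ (ξ α)) y w v :=
    ((h'.smooth_ξ α).isSymmSndFDerivAt (by simp)).eq v w
  have k1 := key v w
  have k2 := key w v
  rw [hD0] at k1 k2
  have hA : coordCurvature G y v w (ξ α y)
      = -(G y (ξ α y) (ξ α y) • (covDerivEndo G φ y v w - covDerivEndo G φ y w v)) := by
    have k3 := congrArg₂ (· - ·) k1 k2
    simp only [hs, map_sub, map_neg, map_smul] at k3
    simp only [coordCurvature, covDerivEndo]
    rw [h'.christoffel_comm w v]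
    rw [← sub_eq_zero] at k3 ⊢
    rw [← k3]
    module
  rw [hA, h'.isSJet.A_eq, h'.isSJet.A_eq, h'.frame.self_of_nhds.symm (φ y v)]
  module

end IsSGerm

end LocalStructure

/-! ### Passage to the coordinates of a chart -/

section Chart

variable {E : Type*} [NormedAddCommGroup E] [NormedSpace ℝ E]
  {M : Type*} [TopologicalSpace M] [ChartedSpace E M] [IsManifold 𝓘(ℝ, E) ∞ M]

/-- The differential of the chart at `p`, the inverse of `coordFrame p q`. -/
noncomputable def chartDiff (p q : M) : TangentSpace 𝓘(ℝ, E) q →L[ℝ] E :=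
  mvfderiv 𝓘(ℝ, E) (extChartAt 𝓘(ℝ, E) p : M → E) q

theorem isInvertible_chartDiff {p q : M} (hq : q ∈ (extChartAt 𝓘(ℝ, E) p).source) :
    (chartDiff p q : TangentSpace 𝓘(ℝ, E) q →L[ℝ] E).IsInvertible :=
  isInvertible_mfderiv_extChartAt (I := 𝓘(ℝ, E)) hq

theorem chartDiff_coordFrame {p q : M} (hq : q ∈ (extChartAt 𝓘(ℝ, E) p).source) (v : E) :
    chartDiff p q (coordFrame p q v) = v :=
  (isInvertible_chartDiff hq).self_apply_inverse v

theorem coordFrame_chartDiff {p q : M} (hq : q ∈ (extChartAt 𝓘(ℝ, E) p).source)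
    (x : TangentSpace 𝓘(ℝ, E) q) : coordFrame p q (chartDiff p q x : E) = x :=
  (isInvertible_chartDiff hq).inverse_apply_self x

theorem smoothFieldAt_coordFrame [CompleteSpace E] {p q : M}
    (hq : q ∈ (extChartAt 𝓘(ℝ, E) p).source) (v : E) :
    SmoothFieldAt (fun q' => coordFrame p q' v) q := by
  have h1 : ContMDiffAt 𝓘(ℝ, E) 𝓘(ℝ, E).tangent ∞
      (fun x : E => (⟨x, v⟩ : TangentBundle 𝓘(ℝ, E) E)) (extChartAt 𝓘(ℝ, E) p q) :=
    contMDiffAt_vectorSpace_iff_contDiffAt.2 contDiffAt_const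
  exact ContMDiffAt.mpullback_vectorField_preimage (V := fun _ => v) h1
    (contMDiffAt_extChartAt' (by simpa using hq)) (isInvertible_mfderiv_extChartAt hq)
    (n := ∞) le_rfl

/-- The Lie bracket of two vector fields given in the coordinates of a chart. -/
theorem mlieBracket_coordFrame [CompleteSpace E] {p q : M}
    (hq : q ∈ (extChartAt 𝓘(ℝ, E) p).source) {A B : E → E}
    (hA : ContDiffAt ℝ 1 A (extChartAt 𝓘(ℝ, E) p q))
    (hB : ContDiffAt ℝ 1 B (extChartAt 𝓘(ℝ, E) p q)) :
    VectorField.mlieBracket 𝓘(ℝ, E) (fun q' => coordFrame p q' (A (extChartAt 𝓘(ℝ, E) p q')))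
      (fun q' => coordFrame p q' (B (extChartAt 𝓘(ℝ, E) p q'))) q
      = coordFrame p q (fderiv ℝ B (extChartAt 𝓘(ℝ, E) p q) (A (extChartAt 𝓘(ℝ, E) p q))
        - fderiv ℝ A (extChartAt 𝓘(ℝ, E) p q) (B (extChartAt 𝓘(ℝ, E) p q))) := by
  have : IsManifold 𝓘(ℝ, E) (minSmoothness ℝ 2) M := IsManifold.of_le (n := ∞) (by
    rw [minSmoothness_of_isRCLikeNormedField]
    exact WithTop.coe_le_coe.2 (le_top : (2 : ℕ∞) ≤ ⊤))
  have hm {A : E → E} (hA : ContDiffAt ℝ 1 A (extChartAt 𝓘(ℝ, E) p q)) :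
      MDifferentiableAt 𝓘(ℝ, E) 𝓘(ℝ, E).tangent
        (fun x : E => (⟨x, A x⟩ : TangentBundle 𝓘(ℝ, E) E)) (extChartAt 𝓘(ℝ, E) p q) :=
    (contMDiffAt_vectorSpace_iff_contDiffAt.2 hA).mdifferentiableAt one_ne_zero
  have h1 := VectorField.mpullback_mlieBracket (I := 𝓘(ℝ, E)) (I' := 𝓘(ℝ, E)) (n := ∞)
    (f := extChartAt 𝓘(ℝ, E) p) (V := A) (W := B) (x₀ := q) (hm hA) (hm hB)
    (contMDiffAt_extChartAt' (by simpa using hq)) (by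
      rw [minSmoothness_of_isRCLikeNormedField]
      exact WithTop.coe_le_coe.2 (le_top : (2 : ℕ∞) ≤ ⊤))
  have h2 (V W : (x : E) → TangentSpace 𝓘(ℝ, E) x) :
      VectorField.mlieBracket 𝓘(ℝ, E) V W = VectorField.lieBracket ℝ V W := by
    rw [← VectorField.mlieBracketWithin_univ, VectorField.mlieBracketWithin_eq_lieBracketWithin]
    exact VectorField.lieBracketWithin_univ (𝕜 := ℝ) (V := V) (W := W)
  exact h1.symm.trans (congrArg (fun V => VectorField.mpullback 𝓘(ℝ, E) 𝓘(ℝ, E)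
    (extChartAt 𝓘(ℝ, E) p) V q) (h2 A B))

theorem contDiffAt_comp_chart {p : M} {F : Type*} [NormedAddCommGroup F] [NormedSpace ℝ F]
    {f : M → F} (hf : ContMDiffAt 𝓘(ℝ, E) 𝓘(ℝ, F) ∞ f p) :
    ContDiffAt ℝ ∞ (fun y => f ((extChartAt 𝓘(ℝ, E) p).symm y)) (extChartAt 𝓘(ℝ, E) p p) := by
  rw [← contMDiffAt_iff_contDiffAt]
  refine ContMDiffAt.comp (I' := 𝓘(ℝ, E)) _ (by simpa using hf) ?_
  exact (contMDiffOn_extChartAt_symm p).contMDiffAt (extChartAt_target_mem_nhds p)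

/-- A vector field which is smooth at `p` has smooth components in the chart at `p`. -/
theorem contDiffAt_chartDiff {p : M} {X : (q : M) → TangentSpace 𝓘(ℝ, E) q}
    (hX : SmoothFieldAt X p) :
    ContDiffAt ℝ ∞ (fun y => (chartDiff p ((extChartAt 𝓘(ℝ, E) p).symm y)
      (X ((extChartAt 𝓘(ℝ, E) p).symm y)) : E)) (extChartAt 𝓘(ℝ, E) p p) := by
  have h1 : ContMDiffAt 𝓘(ℝ, E) 𝓘(ℝ, E) ∞ (fun q => (chartDiff p q (X q) : E)) p := by
    refine ((Bundle.contMDiffAt_section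
      (E := TangentSpace 𝓘(ℝ, E)) p).1 hX).congr_of_eventuallyEq ?_
    filter_upwards [(chartAt E p).open_source.mem_nhds (mem_chart_source E p)] with q hq
    have h2 := TangentBundle.continuousLinearMapAt_trivializationAt (I := 𝓘(ℝ, E)) hq
    have h3 := congrArg (fun L => L (X q)) h2
    refine h3.symm.trans ?_
    rw [Trivialization.continuousLinearMapAt_apply, Trivialization.coe_linearMapAt]
    exact if_pos (by simpa using hq)
  exact contDiffAt_comp_chart h1

/-- The derivative of a function in the direction of a coordinate field. -/
theorem mvfderiv_coordFrame {p : M} {y : E} (hy : y ∈ (extChartAt 𝓘(ℝ, E) p).target)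
    {f : M → ℝ} (hf : DifferentiableAt ℝ (fun y => f ((extChartAt 𝓘(ℝ, E) p).symm y)) y) (v : E) :
    mvfderiv 𝓘(ℝ, E) f ((extChartAt 𝓘(ℝ, E) p).symm y)
        (coordFrame p ((extChartAt 𝓘(ℝ, E) p).symm y) v)
      = fderiv ℝ (fun y => f ((extChartAt 𝓘(ℝ, E) p).symm y)) y v := by
  have hq := (extChartAt 𝓘(ℝ, E) p).map_target hy
  have hχ : MDifferentiableAt 𝓘(ℝ, E) 𝓘(ℝ, E) (extChartAt 𝓘(ℝ, E) p)
      ((extChartAt 𝓘(ℝ, E) p).symm y) := mdifferentiableAt_extChartAt (by simpa using hq)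
  have h1 : f =ᶠ[𝓝 ((extChartAt 𝓘(ℝ, E) p).symm y)]
      (fun y => f ((extChartAt 𝓘(ℝ, E) p).symm y)) ∘ extChartAt 𝓘(ℝ, E) p := by
    filter_upwards [(isOpen_extChartAt_source (I := 𝓘(ℝ, E)) p).mem_nhds hq] with x hx
    exact congrArg f ((extChartAt 𝓘(ℝ, E) p).left_inv hx).symm
  have h2 := (extChartAt 𝓘(ℝ, E) p).right_inv hy
  have h3 := chartDiff_coordFrame hq v
  have hf' : MDifferentiableAt 𝓘(ℝ, E) 𝓘(ℝ, ℝ) (fun y => f ((extChartAt 𝓘(ℝ, E) p).symm y))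
      (extChartAt 𝓘(ℝ, E) p ((extChartAt 𝓘(ℝ, E) p).symm y)) := by
    rw [h2]
    exact hf.mdifferentiableAt
  have h4 := (h1.mfderiv_eq (I := 𝓘(ℝ, E)) (I' := 𝓘(ℝ, ℝ))).trans (mfderiv_comp _ hf' hχ)
  rw [mfderiv_eq_fderiv] at h4
  have h5 := congrArg (fun L => L (coordFrame p ((extChartAt 𝓘(ℝ, E) p).symm y) v)) h4
  refine h5.trans ?_
  refine (congrArg (fderiv ℝ (fun y => f ((extChartAt 𝓘(ℝ, E) p).symm y)) _) h3).trans ?_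
  rw [h2]

end Chart

section ChartStructure

variable {E : Type*} [NormedAddCommGroup E] [NormedSpace ℝ E]
  {M : Type*} [TopologicalSpace M] [ChartedSpace E M] [IsManifold 𝓘(ℝ, E) ∞ M] {s : ℕ}

/-- The coordinate expression of an endomorphism field in the chart at `p`. -/
noncomputable def chartEndo (φ : (q : M) → TangentSpace 𝓘(ℝ, E) q →L[ℝ] TangentSpace 𝓘(ℝ, E) q)
    (p : M) (y : E) : E →L[ℝ] E :=
  (chartDiff p ((extChartAt 𝓘(ℝ, E) p).symm y)).comp
    ((φ ((extChartAt 𝓘(ℝ, E) p).symm y)).comp (coordFrame p ((extChartAt 𝓘(ℝ, E) p).symm y)))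

/-- The components of a vector field in the chart at `p`. -/
noncomputable def chartField (X : (q : M) → TangentSpace 𝓘(ℝ, E) q) (p : M) (y : E) : E :=
  chartDiff p ((extChartAt 𝓘(ℝ, E) p).symm y) (X ((extChartAt 𝓘(ℝ, E) p).symm y))

/-- The coordinate expression of a `1`-form in the chart at `p`. -/
noncomputable def chartForm (η : (q : M) → TangentSpace 𝓘(ℝ, E) q →L[ℝ] ℝ) (p : M) (y : E) :
    E →L[ℝ] ℝ :=
  (η ((extChartAt 𝓘(ℝ, E) p).symm y)).comp (coordFrame p ((extChartAt 𝓘(ℝ, E) p).symm y))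

theorem chartMetric_apply
    (g : (q : M) → TangentSpace 𝓘(ℝ, E) q →L[ℝ] TangentSpace 𝓘(ℝ, E) q →L[ℝ] ℝ)
    (p : M) (y v w : E) : chartMetric g p y v w = g ((extChartAt 𝓘(ℝ, E) p).symm y)
      (coordFrame p ((extChartAt 𝓘(ℝ, E) p).symm y) v)
      (coordFrame p ((extChartAt 𝓘(ℝ, E) p).symm y) w) := rfl

theorem LorentzMetric.nondeg (g : LorentzMetric E M) (p : M) (v : TangentSpace 𝓘(ℝ, E) p)
    (hv : ∀ w, g.val p v w = 0) : v = 0 := by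
  obtain ⟨t, -, ht⟩ := g.signature p
  by_contra hne
  have := ht v (by rw [g.symm, hv]) hne
  rw [hv] at this
  exact lt_irrefl _ this

theorem IsLorentzianSManifold.frame [NeZero s] {g : LorentzMetric E M} {F : FramedFStructure E M s}
    (hS : IsLorentzianSManifold g F) (p : M) :
    IsMetricFFrame (g.val p) (F.φ p) (fun α => F.ξ α p) (fun α => F.η α p) where
  symm := g.symm p
  nondeg := g.nondeg p
  φ_cube := F.φ_cube p
  φ_sq := F.φ_sq p
  η_ξ α β := F.η_ξ α β p
  eps_sq α := by rcases hS.eps_eq α p with h | h <;> rw [h] <;> norm_num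
  compat := hS.compat p

/-- A metric `f`-frame pulls back along a linear isomorphism `L` with inverse `J`. -/
theorem IsMetricFFrame.pullback {V W : Type*} [AddCommGroup V] [Module ℝ V] [TopologicalSpace V]
    [AddCommGroup W] [Module ℝ W] [TopologicalSpace W]
    {g : V →L[ℝ] V →L[ℝ] ℝ} {φ : V →L[ℝ] V} {ξ : Fin s → V} {η : Fin s → V →L[ℝ] ℝ}
    (h : IsMetricFFrame g φ ξ η) {L : W →L[ℝ] V} {J : V →L[ℝ] W}
    (hJL : ∀ v, J (L v) = v) (hLJ : ∀ v, L (J v) = v) {G : W →L[ℝ] W →L[ℝ] ℝ}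
    (hG : ∀ v w, G v w = g (L v) (L w)) :
    IsMetricFFrame G (J.comp (φ.comp L)) (fun α => J (ξ α)) (fun α => (η α).comp L) where
  symm v w := by rw [hG, hG, h.symm]
  nondeg v hv := by
    have h1 : L v = 0 := h.nondeg _ fun w => by rw [← hLJ w, ← hG, hv]
    rw [← hJL v, h1, map_zero]
  φ_cube v := by simp [hLJ, ← map_add, h.φ_cube]
  φ_sq v := by simp [hLJ, hJL, h.φ_sq]
  η_ξ α β := by simp [hLJ, h.η_ξ]
  eps_sq α := by simp [hG, hLJ, h.eps_sq]
  compat v w := by simp [hG, hLJ, h.compat]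

theorem isInvertible_of_nondeg [FiniteDimensional ℝ E] {B : E →L[ℝ] E →L[ℝ] ℝ}
    (h : ∀ v, (∀ w, B v w = 0) → v = 0) : B.IsInvertible := by
  have hinj : Function.Injective B.toLinearMap := by
    rw [injective_iff_map_eq_zero]
    intro v hv
    exact h v fun w => by simpa using congrArg (fun L : E →L[ℝ] ℝ => L w) hv
  have hdim : finrank ℝ E = finrank ℝ (E →L[ℝ] ℝ) := by
    rw [← (LinearMap.toContinuousLinearMap (𝕜 := ℝ) (E := E) (F' := ℝ)).finrank_eq]
    exact Subspace.dual_finrank_eq.symm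
  exact ⟨(LinearEquiv.ofInjectiveOfFinrankEq B.toLinearMap hinj hdim).toContinuousLinearEquiv,
    by ext v w; rfl⟩

/-- A field of linear maps on a finite-dimensional space is smooth if its values on constant vectors
are. -/
theorem contDiffAt_clm_of_apply [FiniteDimensional ℝ E] {D F : Type*} [NormedAddCommGroup D]
    [NormedSpace ℝ D] [NormedAddCommGroup F] [NormedSpace ℝ F] {k : WithTop ℕ∞}
    {A : D → E →L[ℝ] F} {x : D} (h : ∀ v, ContDiffAt ℝ k (fun q => A q v) x) :
    ContDiffAt ℝ k A x := by
  have h1 : A = fun q => ∑ i, ContinuousLinearMap.smulRightL ℝ E F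
      (LinearMap.toContinuousLinearMap ((Module.finBasis ℝ E).coord i))
      (A q (Module.finBasis ℝ E i)) := by
    ext q v
    simp only [sum_apply, ContinuousLinearMap.smulRightL_apply_apply]
    conv_lhs => rw [← (Module.finBasis ℝ E).sum_repr v, map_sum]
    simp
  rw [h1]
  exact ContDiffAt.sum fun i _ => (ContinuousLinearMap.contDiff _).contDiffAt.comp x (h _)

theorem mlieBracket_of_chart [CompleteSpace E] {p : M} {y : E}
    (hy : y ∈ (extChartAt 𝓘(ℝ, E) p).target) {X Y : (q : M) → TangentSpace 𝓘(ℝ, E) q} {A B : E → E}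
    (hX : X =ᶠ[𝓝 ((extChartAt 𝓘(ℝ, E) p).symm y)]
      fun q => coordFrame p q (A (extChartAt 𝓘(ℝ, E) p q)))
    (hY : Y =ᶠ[𝓝 ((extChartAt 𝓘(ℝ, E) p).symm y)]
      fun q => coordFrame p q (B (extChartAt 𝓘(ℝ, E) p q)))
    (hA : ContDiffAt ℝ 1 A y) (hB : ContDiffAt ℝ 1 B y) :
    VectorField.mlieBracket 𝓘(ℝ, E) X Y ((extChartAt 𝓘(ℝ, E) p).symm y)
      = coordFrame p ((extChartAt 𝓘(ℝ, E) p).symm y)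
        (fderiv ℝ B y (A y) - fderiv ℝ A y (B y)) := by
  have hr := (extChartAt 𝓘(ℝ, E) p).right_inv hy
  rw [hX.mlieBracket_vectorField_eq hY, mlieBracket_coordFrame
    ((extChartAt 𝓘(ℝ, E) p).map_target hy) (by rwa [hr]) (by rwa [hr]), hr]

theorem contDiffAt_chartForm [FiniteDimensional ℝ E] (F : FramedFStructure E M s) (α : Fin s)
    (p : M) : ContDiffAt ℝ ∞ (chartForm (F.η α) p) (extChartAt 𝓘(ℝ, E) p p) := by
  refine contDiffAt_clm_of_apply fun v => contDiffAt_comp_chart (f := fun q => F.η α q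
    (coordFrame p q v)) ?_
  have h1 := ContMDiffAt.clm_bundle_apply (E₁ := TangentSpace 𝓘(ℝ, E))
    (E₂ := fun _ : M => ℝ) (b := fun q : M => q) (F.smooth_η α p)
    (smoothFieldAt_coordFrame (mem_extChartAt_source p) v)
  exact (contMDiffAt_section p).1 h1

theorem contDiffAt_chartEndo [FiniteDimensional ℝ E] (F : FramedFStructure E M s) (p : M) :
    ContDiffAt ℝ ∞ (chartEndo F.φ p) (extChartAt 𝓘(ℝ, E) p p) := by
  refine contDiffAt_clm_of_apply fun v => contDiffAt_chartDiff
    (X := fun q => F.φ q (coordFrame p q v)) ?_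
  exact ContMDiffAt.clm_bundle_apply (E₁ := TangentSpace 𝓘(ℝ, E))
    (E₂ := TangentSpace 𝓘(ℝ, E)) (b := fun q : M => q) (F.smooth_φ p)
    (smoothFieldAt_coordFrame (mem_extChartAt_source p) v)

theorem contDiffAt_chartMetric [FiniteDimensional ℝ E] (g : LorentzMetric E M) (p : M) :
    ContDiffAt ℝ ∞ (chartMetric g.val p) (extChartAt 𝓘(ℝ, E) p p) := by
  refine contDiffAt_clm_of_apply fun v => contDiffAt_clm_of_apply fun w =>
    contDiffAt_comp_chart (f := fun q => g.val q (coordFrame p q v) (coordFrame p q w)) ?_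
  have h1 := ContMDiffAt.clm_bundle_apply₂ (E₁ := TangentSpace 𝓘(ℝ, E))
    (E₂ := TangentSpace 𝓘(ℝ, E)) (E₃ := fun _ : M => ℝ) (b := fun q : M => q) (g.smooth p)
    (smoothFieldAt_coordFrame (mem_extChartAt_source p) v)
    (smoothFieldAt_coordFrame (mem_extChartAt_source p) w)
  exact (contMDiffAt_section p).1 h1

/-- The Nijenhuis tensor on coordinate fields. -/
theorem nijenhuis_coordFrame [CompleteSpace E]
    (φ : (q : M) → TangentSpace 𝓘(ℝ, E) q →L[ℝ] TangentSpace 𝓘(ℝ, E) q) {p : M} {y : E}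
    (hy : y ∈ (extChartAt 𝓘(ℝ, E) p).target) (hφ : ContDiffAt ℝ 1 (chartEndo φ p) y) (v w : E) :
    chartDiff p ((extChartAt 𝓘(ℝ, E) p).symm y)
      (nijenhuis φ (fun q => coordFrame p q v) (fun q => coordFrame p q w)
        ((extChartAt 𝓘(ℝ, E) p).symm y))
      = fderiv ℝ (chartEndo φ p) y (chartEndo φ p y v) w
        - fderiv ℝ (chartEndo φ p) y (chartEndo φ p y w) v
        - chartEndo φ p y (fderiv ℝ (chartEndo φ p) y v w)
        + chartEndo φ p y (fderiv ℝ (chartEndo φ p) y w v) := by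
  have hq := (extChartAt 𝓘(ℝ, E) p).map_target hy
  have hφv (v : E) : ContDiffAt ℝ 1 (fun y => chartEndo φ p y v) y :=
    hφ.clm_apply contDiffAt_const
  have cv (v : E) : ContDiffAt ℝ 1 (fun _ : E => v) y := contDiffAt_const
  have hφd := hφ.differentiableAt one_ne_zero
  have hfield (v : E) : (fun q => φ q (coordFrame p q v))
      =ᶠ[𝓝 ((extChartAt 𝓘(ℝ, E) p).symm y)]
      fun q => coordFrame p q (chartEndo φ p (extChartAt 𝓘(ℝ, E) p q) v) := by
    filter_upwards [(isOpen_extChartAt_source (I := 𝓘(ℝ, E)) p).mem_nhds hq] with q hq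
    have h1 := (extChartAt 𝓘(ℝ, E) p).left_inv hq
    simp only [chartEndo, ContinuousLinearMap.comp_apply]
    rw [h1, coordFrame_chartDiff hq]
  have hconst (v : E) : (fun q => coordFrame p q v) =ᶠ[𝓝 ((extChartAt 𝓘(ℝ, E) p).symm y)]
      fun q => coordFrame p q v := EventuallyEq.rfl
  have b1 := mlieBracket_of_chart hy (X := fun q => coordFrame p q v)
    (Y := fun q => coordFrame p q w) (A := fun _ => v) (B := fun _ => w)
    (hconst v) (hconst w) (cv v) (cv w)
  have b2 := mlieBracket_of_chart hy (X := fun q => φ q (coordFrame p q v))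
    (Y := fun q => φ q (coordFrame p q w)) (A := fun y => chartEndo φ p y v)
    (B := fun y => chartEndo φ p y w) (hfield v) (hfield w) (hφv v) (hφv w)
  have b3 := mlieBracket_of_chart hy (X := fun q => φ q (coordFrame p q v))
    (Y := fun q => coordFrame p q w) (A := fun y => chartEndo φ p y v) (B := fun _ => w)
    (hfield v) (hconst w) (hφv v) (cv w)
  have b4 := mlieBracket_of_chart hy (X := fun q => coordFrame p q v)
    (Y := fun q => φ q (coordFrame p q w)) (A := fun _ => v) (B := fun y => chartEndo φ p y w)
    (hconst v) (hfield w) (cv v) (hφv w)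
  simp only [fderiv_fun_const, Pi.zero_apply, zero_apply, sub_self, map_zero,
    fderiv_clm_apply_const hφd, zero_sub, sub_zero] at b1 b2 b3 b4
  rw [nijenhuis, b1, b2, b3, b4]
  simp only [map_sub, map_neg, map_zero, chartDiff_coordFrame hq, zero_add, chartEndo,
    ContinuousLinearMap.comp_apply]
  abel

/-- In the chart at `p`, the structure tensors of a Lorentzian `S`-manifold form an `IsSGerm`. -/
theorem IsLorentzianSManifold.isSGerm [FiniteDimensional ℝ E] [NeZero s] {g : LorentzMetric E M}
    {F : FramedFStructure E M s} (hS : IsLorentzianSManifold g F) (p : M) :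
    IsSGerm ∞ (chartMetric g.val p) (chartEndo F.φ p) (fun α => chartField (F.ξ α) p)
      (fun α => chartForm (F.η α) p) (extChartAt 𝓘(ℝ, E) p p) := by
  have hsrc {y : E} (hy : y ∈ (extChartAt 𝓘(ℝ, E) p).target) :=
    (extChartAt 𝓘(ℝ, E) p).map_target hy
  have htgt : ∀ᶠ y in 𝓝 (extChartAt 𝓘(ℝ, E) p p), y ∈ (extChartAt 𝓘(ℝ, E) p).target :=
    extChartAt_target_mem_nhds p
  have hframe {y : E} (hy : y ∈ (extChartAt 𝓘(ℝ, E) p).target) :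
      IsMetricFFrame (chartMetric g.val p y) (chartEndo F.φ p y)
        (fun α => chartField (F.ξ α) p y) (fun α => chartForm (F.η α) p y) :=
    (hS.frame _).pullback (chartDiff_coordFrame (hsrc hy)) (coordFrame_chartDiff (hsrc hy))
      (chartMetric_apply g.val p y)
  have one_le : (1 : WithTop ℕ∞) ≤ ∞ := WithTop.coe_le_coe.2 (le_top : (1 : ℕ∞) ≤ ⊤)
  have hη1 : ∀ᶠ y in 𝓝 (extChartAt 𝓘(ℝ, E) p p), ∀ α,
      DifferentiableAt ℝ (chartForm (F.η α) p) y :=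
    eventually_all.2 fun α => (((contDiffAt_chartForm F α p).of_le one_le).eventually
      (by simp)).mono fun y hy => hy.differentiableAt one_ne_zero
  have hφ1 : ∀ᶠ y in 𝓝 (extChartAt 𝓘(ℝ, E) p p), ContDiffAt ℝ 1 (chartEndo F.φ p) y :=
    ((contDiffAt_chartEndo F p).of_le one_le).eventually (by simp)
  -- the exterior derivative on coordinate fields
  have hext {y : E} (hy : y ∈ (extChartAt 𝓘(ℝ, E) p).target)
      (hη : ∀ α, DifferentiableAt ℝ (chartForm (F.η α) p) y) (α : Fin s) (v w : E) :
      2 * extDer (F.η α) (fun q => coordFrame p q v) (fun q => coordFrame p q w)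
        ((extChartAt 𝓘(ℝ, E) p).symm y)
      = fderiv ℝ (chartForm (F.η α) p) y v w - fderiv ℝ (chartForm (F.η α) p) y w v := by
    have h1 (v w : E) : mvfderiv 𝓘(ℝ, E) (fun q => F.η α q (coordFrame p q w))
        ((extChartAt 𝓘(ℝ, E) p).symm y) (coordFrame p ((extChartAt 𝓘(ℝ, E) p).symm y) v)
        = fderiv ℝ (chartForm (F.η α) p) y v w := by
      rw [← fderiv_clm_apply_const (hη α)]
      exact mvfderiv_coordFrame (f := fun q => F.η α q (coordFrame p q w)) hy
        ((hη α).clm_apply (differentiableAt_const w)) v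
    have h2 := mlieBracket_coordFrame (hsrc hy) (A := fun _ => v) (B := fun _ => w)
      contDiffAt_const contDiffAt_const
    simp only [fderiv_fun_const, Pi.zero_apply, zero_apply, sub_self, map_zero] at h2
    rw [extDer, h1, h1, h2, map_zero]
    ring
  have hcontact {y : E} (hy : y ∈ (extChartAt 𝓘(ℝ, E) p).target) (α : Fin s) (v w : E) :
      chartMetric g.val p y v (chartEndo F.φ p y w)
        = extDer (F.η α) (fun q => coordFrame p q v) (fun q => coordFrame p q w)
          ((extChartAt 𝓘(ℝ, E) p).symm y) := by
    rw [← hS.contact α _ _ _ (smoothFieldAt_coordFrame (hsrc hy) v)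
      (smoothFieldAt_coordFrame (hsrc hy) w), chartMetric_apply]
    exact congrArg _ (coordFrame_chartDiff (hsrc hy) _)
  refine ⟨contDiffAt_chartMetric g p, contDiffAt_chartEndo F p,
    fun α => contDiffAt_chartDiff (F.smooth_ξ α p), fun α => contDiffAt_chartForm F α p,
    htgt.mono fun y hy => isInvertible_of_nondeg (hframe hy).nondeg,
    htgt.mono fun y hy => hframe hy, ?_, ?_⟩
  · filter_upwards [htgt, hη1] with y hy hηy α v w
    rw [← hext hy hηy, hcontact hy α]
  · filter_upwards [htgt, hφ1] with y hy hφy v w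
    have hn := hS.normal _ _ _ (smoothFieldAt_coordFrame (hsrc hy) v)
      (smoothFieldAt_coordFrame (hsrc hy) w)
    simp only [← hcontact hy] at hn
    rw [← nijenhuis_coordFrame F.φ hy hφy]
    have h1 := congrArg (chartDiff p ((extChartAt 𝓘(ℝ, E) p).symm y)) hn
    simp only [← Finset.smul_sum, map_add, map_smul, map_sum, map_zero, smul_smul] at h1
    exact h1

end ChartStructure

/-! ### Algebraic curvature tensors -/

section CurvatureTensors

variable {V : Type*} [AddCommGroup V] [Module ℝ V]

/-- `R` is an algebraic curvature tensor of type `(1,3)` for the bilinear form `B`: linear in the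
first variable, skew in the first two, with skew-adjoint endomorphisms `R x y`, and satisfying the
first Bianchi identity. Linearity in the other variables follows. -/
structure IsCurvatureTensor (B : V →ₗ[ℝ] V →ₗ[ℝ] ℝ) (R : V → V → V → V) : Prop where
  add_left : ∀ x x' y z, R (x + x') y z = R x y z + R x' y z
  smul_left : ∀ (c : ℝ) x y z, R (c • x) y z = c • R x y z
  swap : ∀ x y z, R y x z = -R x y z
  bianchi : ∀ x y z, R x y z + R y z x + R z x y = 0
  skew : ∀ x y z w, B (R x y z) w = -B z (R x y w)

namespace IsCurvatureTensor

variable {B : V →ₗ[ℝ] V →ₗ[ℝ] ℝ} {R R' : V → V → V → V}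

section

variable (h : IsCurvatureTensor B R)
include h

theorem add_mid (x y y' z : V) : R x (y + y') z = R x y z + R x y' z := by
  rw [h.swap, h.add_left, h.swap x y, h.swap x y']
  abel

theorem smul_mid (c : ℝ) (x y z : V) : R x (c • y) z = c • R x y z := by
  rw [h.swap, h.smul_left, h.swap x y, smul_neg, neg_neg]

theorem eq_bianchi (x y z : V) : R x y z = -R y z x - R z x y := by
  have := h.bianchi x y z
  rw [← sub_eq_zero, ← this]
  abel

theorem add_right (x y z z' : V) : R x y (z + z') = R x y z + R x y z' := by
  rw [h.eq_bianchi x y, h.eq_bianchi x y z, h.eq_bianchi x y z', h.add_mid, h.add_left]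
  abel

theorem smul_right (c : ℝ) (x y z : V) : R x y (c • z) = c • R x y z := by
  rw [h.eq_bianchi x y, h.eq_bianchi x y z, h.smul_mid, h.smul_left]
  module

theorem self_left (x z : V) : R x x z = 0 := by
  have e : (2 : ℝ) • R x x z = 0 := by
    rw [two_smul]
    exact add_eq_zero_iff_eq_neg.2 (h.swap x x z)
  exact (smul_eq_zero.1 e).resolve_left two_ne_zero

theorem zero_right (x y : V) : R x y 0 = 0 := by simpa using h.smul_right 0 x y 0

theorem pair_symm (hB : ∀ x y, B x y = B y x) (x y z w : V) :
    B (R x y z) w = B (R z w x) y := by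
  have sk (x y z w : V) : B (R x y z) w = -B (R x y w) z := by rw [h.skew, hB z]
  have sw (x y z w : V) : B (R x y z) w = -B (R y x z) w := by simp [h.swap x y]
  have bi (x y z w : V) : B (R x y z) w + B (R y z x) w + B (R z x y) w = 0 := by
    simpa using congrArg (fun v => B v w) (h.bianchi x y z)
  linarith [bi x y z w, bi y z w x, bi z w x y, bi w x y z, sk x y z w, sk y z x w, sk z x y w,
    sk y z w x, sk z w y x, sk w y z x, sk z w x y, sk w x z y, sk x z w y, sk w x y z, sk x y w z,
    sk y w x z, sw x y z w, sw z x y w, sw w y z x, sw x z w y, sw z w x y, sw y w x z, sw x y w z,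
    sw w x z y]

/-- An algebraic curvature tensor with vanishing sectional curvatures is zero. -/
theorem eq_zero (hB : ∀ x y, B x y = B y x) (hnd : ∀ x, (∀ y, B x y = 0) → x = 0)
    (h0 : ∀ x y, B (R y x x) y = 0) (x y z : V) : R x y z = 0 := by
  have h1 (x y : V) : R y x x = 0 := by
    refine hnd _ fun w => ?_
    have e := h0 x (y + w)
    have e1 := h.pair_symm hB y x x w
    rw [h.swap w x y, map_neg, LinearMap.neg_apply, h.skew w x y, neg_neg, hB y] at e1
    simp only [h.add_left, map_add, LinearMap.add_apply, h0] at e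
    linarith
  have h2 (x y z : V) : R x y z = -R x z y := by
    have e := h1 (y + z) x
    simp only [h.add_mid, h.add_right, h1, zero_add, add_zero] at e
    exact eq_neg_of_add_eq_zero_left e
  have e := h.bianchi x y z
  have e1 : R y z x = R x y z := by rw [h2 y z x, h.swap x y z, neg_neg]
  have e2 : R z x y = R x y z := by rw [h2 z x y, h.swap y z x, neg_neg, e1]
  have e3 : (3 : ℝ) • R x y z = 0 := by
    rw [e1, e2] at e
    rw [← e]
    module
  exact (smul_eq_zero.1 e3).resolve_left three_ne_zero

end

theorem smul (h : IsCurvatureTensor B R) (c : ℝ) :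
    IsCurvatureTensor B fun x y z => c • R x y z where
  add_left x x' y z := by rw [h.add_left, smul_add]
  smul_left a x y z := by rw [h.smul_left, smul_comm]
  swap x y z := by rw [h.swap, smul_neg]
  bianchi x y z := by rw [← smul_add, ← smul_add, h.bianchi, smul_zero]
  skew x y z w := by simp [h.skew]

theorem add (h : IsCurvatureTensor B R) (h' : IsCurvatureTensor B R') :
    IsCurvatureTensor B fun x y z => R x y z + R' x y z where
  add_left x x' y z := by rw [h.add_left, h'.add_left]; abel
  smul_left a x y z := by rw [h.smul_left, h'.smul_left, smul_add]
  swap x y z := by rw [h.swap, h'.swap]; abel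
  bianchi x y z := by
    have e := congrArg₂ (· + ·) (h.bianchi x y z) (h'.bianchi x y z)
    simp only [add_zero] at e
    rw [← e]
    abel
  skew x y z w := by simp [h.skew, h'.skew, add_comm]

theorem sub (h : IsCurvatureTensor B R) (h' : IsCurvatureTensor B R') :
    IsCurvatureTensor B fun x y z => R x y z - R' x y z := by
  simpa [sub_eq_add_neg] using h.add (h'.smul (-1))

/-- The curvature tensor built from a self-adjoint operator `A`; for `A = 1` it is the curvature
tensor of constant sectional curvature `1`. -/
theorem of_selfAdjoint (hB : ∀ x y, B x y = B y x) (A : V →ₗ[ℝ] V)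
    (hA : ∀ x y, B (A x) y = B x (A y)) :
    IsCurvatureTensor B fun x y z => B (A y) z • A x - B (A x) z • A y where
  add_left x x' y z := by simp only [map_add, LinearMap.add_apply]; module
  smul_left a x y z := by simp only [map_smul, LinearMap.smul_apply, smul_eq_mul]; module
  swap x y z := by abel
  bianchi x y z := by
    rw [hA z x, hA z y, hA y x, hB z, hB z, hB y (A x)]
    abel
  skew x y z w := by
    simp only [map_sub, map_smul, LinearMap.sub_apply, LinearMap.smul_apply, smul_eq_mul]
    rw [hB z, hB z]
    ring

/-- The curvature tensor built from a skew-adjoint operator `A`. -/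
theorem of_skewAdjoint (hB : ∀ x y, B x y = B y x) (A : V →ₗ[ℝ] V)
    (hA : ∀ x y, B (A x) y = -B x (A y)) :
    IsCurvatureTensor B fun x y z =>
      B (A y) z • A x - B (A x) z • A y + (2 * B x (A y)) • A z where
  add_left x x' y z := by simp only [map_add, LinearMap.add_apply]; module
  smul_left a x y z := by simp only [map_smul, LinearMap.smul_apply, smul_eq_mul]; module
  swap x y z := by
    rw [← neg_eq_iff_eq_neg.2 (hA y x), hB (A y) x]
    module
  bianchi x y z := by
    rw [hB x (A y), hB y (A z), hB z (A x), hA z x, hA x y, hA y z, hB z (A x), hB x (A y),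
      hB y (A z)]
    module
  skew x y z w := by
    simp only [map_add, map_sub, map_smul, LinearMap.add_apply, LinearMap.sub_apply,
      LinearMap.smul_apply, smul_eq_mul]
    rw [hB z (A x), hB z (A y), hB z (A w), hA z w, hB z (A w)]
    ring

end IsCurvatureTensor

end CurvatureTensors

/-! ### Curvature tensors whose Jacobi operators have rank one -/

section RankOne

variable {W : Type*} [AddCommGroup W] [Module ℝ W] {B : W →ₗ[ℝ] W →ₗ[ℝ] ℝ} {K : W → W → W → W}

/-- Comparison of coefficients in the rank one condition along a line. -/
theorem coeff_of_rank_one {b r p cy cr : ℝ}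
    (h : ∀ t : ℝ, (b ^ 2 + 2 * t * cy) * (r ^ 2 + 2 * t * cr + t ^ 2) = (b * r + 2 * t * p) ^ 2) :
    b ^ 2 = (2 * p) ^ 2 ∧ b ^ 2 * cr = b * r * (2 * p) := by
  have h1 := h 1
  have h2 := h (-1)
  have h3 := h 2
  have hcy : cy = 0 := by linarith
  subst hcy
  constructor <;> linarith

theorem mul_eq_mul_of_sq {p r P R : ℝ} (h1 : p ^ 2 = P ^ 2) (h2 : r ^ 2 = R ^ 2)
    (h3 : p ^ 2 * R = p * r * P) : p * r = P * R := by
  rcases eq_or_ne p 0 with rfl | hp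
  · have : P = 0 := by
      rw [← sq_eq_zero_iff, ← h1]
      norm_num
    simp [this]
  · have h4 : p * R = r * P := mul_left_cancel₀ hp (by linarith)
    rcases eq_or_ne r 0 with rfl | hr
    · have : R = 0 := by
        rw [← sq_eq_zero_iff, ← h2]
        norm_num
      simp [this]
    · refine mul_right_cancel₀ hr ?_
      calc p * r * r = p * R * R := by rw [mul_assoc, ← sq, h2]; ring
        _ = P * R * r := by rw [h4]; ring

/-- If the Jacobi operators of an algebraic curvature tensor are `K(·, x)x = e(x) ⊗ e(x)`, then
`e(x)` can be replaced by a linear function of `x`. For a fixed unit vector `x₀` and `a = e(x₀)` the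
linear function is read off from the polarization `½(K(a, x)x₀ + K(a, x₀)x)`; that it has the
required squares follows from the rank one condition along the lines `x + t x₀` and, for the
component along `a`, from the pair symmetry `B(a, e(x))² = B(x, e(a))²`. -/
theorem exists_linear_of_rank_one (hB : ∀ x y, B x y = B y x) (hK : IsCurvatureTensor B K)
    (e : W → W) (he : ∀ x y, K y x x = B y (e x) • e x) {x₀ : W} (h₀ : B (e x₀) (e x₀) = 1) :
    ∃ J : W →ₗ[ℝ] W, ∀ x y, B y (J x) ^ 2 = B y (e x) ^ 2 := by
  set a := e x₀ with ha
  let c (x y z : W) : ℝ := 2⁻¹ * (B (K y x x₀) z + B (K y x₀ x) z)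
  have hq (x y z : W) : B (K y x x) z = B y (e x) * B z (e x) := by
    rw [he, map_smul, LinearMap.smul_apply, smul_eq_mul, hB z]
  have hline (x y z : W) (t : ℝ) : B (y) (e (x + t • x₀)) * B z (e (x + t • x₀))
      = B y (e x) * B z (e x) + 2 * t * c x y z + t ^ 2 * (B y a * B z a) := by
    rw [← hq, ← hq, ha, ← hq x₀]
    simp only [c, hK.add_mid, hK.add_right, hK.smul_mid, hK.smul_right, map_add, map_smul,
      LinearMap.add_apply, LinearMap.smul_apply, smul_eq_mul]
    ring
  have hcsymm (x y z : W) : c x y z = c x z y := by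
    have h1 := hline x y z 1
    have h2 := hline x z y 1
    linarith
  have hcaa (x : W) : B a (e x) ^ 2 = c x a a ^ 2 := by
    have hp (x : W) : B a (e x) * B a (e x) = B x (e a) * B x (e a) := by
      rw [← hq, ← hq, hK.pair_symm hB]
    have h1 := hline x a a 1
    have h2 := hp x
    have h3 := hp x₀
    rw [hp] at h1
    rw [← ha, h₀] at h3
    simp only [map_add, one_smul, LinearMap.add_apply, h₀] at h1
    have h4 : c x a a = B x (e a) * B x₀ (e a) := by linarith
    rw [h4, mul_pow, sq (B x₀ (e a)), ← h3]
    linarith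
  have hperp (x y : W) (hy : B y a = 0) :
      B y (e x) ^ 2 = (2 * c x y a) ^ 2
        ∧ B y (e x) ^ 2 * c x a a = B y (e x) * B a (e x) * (2 * c x y a) := by
    refine coeff_of_rank_one (cy := c x y y) fun t => ?_
    have h1 := hline x y y t
    have h2 := hline x a a t
    have h3 := hline x y a t
    rw [hy] at h1 h3
    rw [h₀] at h2
    have h4 : (B y (e (x + t • x₀)) * B y (e (x + t • x₀)))
        * (B a (e (x + t • x₀)) * B a (e (x + t • x₀)))
        = (B y (e (x + t • x₀)) * B a (e (x + t • x₀))) ^ 2 := by ring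
    rw [h1, h2, h3] at h4
    linarith
  have hw (x y : W) : B y (K a x x₀ + K a x₀ x) = 2 * c x a y := by
    simp only [c, map_add, LinearMap.add_apply, hB y]
    ring
  let J : W →ₗ[ℝ] W :=
    { toFun := fun x => (K a x x₀ + K a x₀ x) - (2⁻¹ * B a (K a x x₀ + K a x₀ x)) • a
      map_add' := fun x y => by
        simp only [hK.add_mid, hK.add_right, map_add]
        module
      map_smul' := fun r x => by
        simp only [hK.smul_mid, hK.smul_right, map_add, map_smul, smul_eq_mul, RingHom.id_apply]
        module }
  have hJ (x y : W) : B y (J x) = 2 * c x a y - c x a a * B y a := by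
    have : J x = (K a x x₀ + K a x₀ x) - (2⁻¹ * B a (K a x x₀ + K a x₀ x)) • a := rfl
    rw [this, map_sub, map_smul, hw, hw, smul_eq_mul]
    ring
  refine ⟨J, fun x y => ?_⟩
  have hya : B (y - B y a • a) a = 0 := by simp [h₀]
  obtain ⟨h1, h2⟩ := hperp x (y - B y a • a) hya
  have h3 : B (y - B y a • a) (J x) = 2 * c x (y - B y a • a) a := by
    rw [hJ, hya, mul_zero, sub_zero, hcsymm]
  have h4 : B a (J x) = c x a a := by
    rw [hJ, h₀]
    ring
  rw [← h3] at h1 h2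
  have h5 := mul_eq_mul_of_sq h1 (hcaa x) h2
  have h6 (v : W) : B y v = B (y - B y a • a) v + B y a * B a v := by simp
  rw [h6 (J x), h6 (e x), h4]
  linear_combination (-1 : ℝ) * h1 - B y a ^ 2 * hcaa x - 2 * B y a * h5

/-- An algebraic curvature tensor on a Euclidean space whose Jacobi operators `K(·, x)x` of unit
vectors are the orthogonal projections onto lines is determined by an orthogonal complex
structure. -/
theorem exists_complex_structure (hB : ∀ x y, B x y = B y x) (hpos : ∀ x, x ≠ 0 → 0 < B x x)
    (hK : IsCurvatureTensor B K)
    (he : ∀ x, B x x = 1 → ∃ e, B e e = 1 ∧ ∀ y, K y x x = B y e • e) :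
    ∃ J : W →ₗ[ℝ] W, (∀ x, J (J x) = -x) ∧ (∀ x y, B (J x) (J y) = B x y) ∧
      ∀ x y z, K x y z = (3⁻¹ : ℝ) • (B (J y) z • J x - B (J x) z • J y
        + (2 * B x (J y)) • J z) := by
  have hnd (x : W) (hx : ∀ y, B x y = 0) : x = 0 := by
    by_contra hne
    exact (hpos x hne).ne' (hx x)
  have hnn (x : W) : 0 ≤ B x x := by
    rcases eq_or_ne x 0 with rfl | hx
    · simp
    · exact (hpos x hx).le
  have hunit (x : W) (hx : x ≠ 0) :
      ∃ u, B u u = 1 ∧ x = Real.sqrt (B x x) • u := by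
    have hs : Real.sqrt (B x x) ≠ 0 := (Real.sqrt_pos.2 (hpos x hx)).ne'
    refine ⟨(Real.sqrt (B x x))⁻¹ • x, ?_, by rw [smul_smul, mul_inv_cancel₀ hs, one_smul]⟩
    have h1 := Real.mul_self_sqrt (hnn x)
    simp only [map_smul, LinearMap.smul_apply, smul_eq_mul]
    nth_rw 3 [← h1]
    field_simp
  have he' (x : W) : ∃ e, B e e = B x x ∧ ∀ y, K y x x = B y e • e := by
    rcases eq_or_ne x 0 with rfl | hx
    · exact ⟨0, by simp, fun y => by simp [hK.zero_right]⟩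
    · obtain ⟨u, hu, hxu⟩ := hunit x hx
      obtain ⟨e, he1, he2⟩ := he u hu
      refine ⟨Real.sqrt (B x x) • e, ?_, fun y => ?_⟩
      · simp [he1, Real.mul_self_sqrt (hnn x)]
      · conv_lhs => rw [hxu]
        rw [hK.smul_mid, hK.smul_right, he2, map_smul]
        simp only [smul_smul, smul_eq_mul]
        congr 1
        ring
  choose e he1 he2 using he'
  obtain ⟨J, hJ⟩ : ∃ J : W →ₗ[ℝ] W, ∀ x y, B y (J x) ^ 2 = B y (e x) ^ 2 := by
    by_cases hW : ∃ x : W, x ≠ 0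
    · obtain ⟨x, hx⟩ := hW
      obtain ⟨u, hu, -⟩ := hunit x hx
      exact exists_linear_of_rank_one hB hK e he2 (x₀ := u) (by rw [he1, hu])
    · have hz (x : W) : x = 0 := by
        by_contra hx
        exact hW ⟨x, hx⟩
      exact ⟨0, fun x y => by rw [hz y]; simp⟩
  have hxJ (x : W) : B x (J x) = 0 := by
    rw [← sq_eq_zero_iff, hJ, sq, ← smul_eq_mul, ← map_smul, ← he2, hK.self_left, map_zero]
  have hJJ (x : W) : B (J x) (J x) = B x x := by
    have h1 := hJ x (J x)
    have h2 := hJ x (e x)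
    rw [hB (e x), ← h1, he1] at h2
    exact (sq_eq_sq₀ (hnn _) (hnn _)).1 h2
  have hskew (x y : W) : B (J x) y = -B x (J y) := by
    have h1 := hxJ (x + y)
    simp only [map_add, LinearMap.add_apply, hxJ] at h1
    rw [hB]
    linarith
  have hiso (x y : W) : B (J x) (J y) = B x y := by
    have h1 := hJJ (x + y)
    simp only [map_add, LinearMap.add_apply, hJJ] at h1
    rw [hB (J y) (J x), hB y x] at h1
    linarith
  refine ⟨J, fun x => ?_, hiso, fun x y z => ?_⟩
  · rw [eq_neg_iff_add_eq_zero]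
    refine hnd _ fun y => ?_
    rw [map_add, LinearMap.add_apply, hskew, hiso, neg_add_cancel]
  · refine sub_eq_zero.1 ((hK.sub ((IsCurvatureTensor.of_skewAdjoint hB J hskew).smul
      3⁻¹)).eq_zero hB hnd (fun x y => ?_) x y z)
    simp only [map_sub, map_smul, map_add, LinearMap.sub_apply, LinearMap.smul_apply,
      LinearMap.add_apply, smul_eq_mul, he2, hB (J x) x, hxJ, hB (e x) y, hB (J x) y]
    rw [← sq, ← hJ, hskew y x]
    ring

end RankOne

/-! ### The curvature of a Lorentzian `S`-manifold at a point -/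

section CurvatureAtPoint

variable {E : Type*} [NormedAddCommGroup E] [NormedSpace ℝ E]
  {M : Type*} [TopologicalSpace M] [ChartedSpace E M] [IsManifold 𝓘(ℝ, E) ∞ M] {s : ℕ}

/-- The metric at `p` as a bilinear form. -/
noncomputable def metricForm (g : LorentzMetric E M) (p : M) :
    TangentSpace 𝓘(ℝ, E) p →ₗ[ℝ] TangentSpace 𝓘(ℝ, E) p →ₗ[ℝ] ℝ :=
  LinearMap.mk₂ ℝ (fun x y => g.val p x y) (by simp) (by simp) (by simp) (by simp)

theorem metricForm_apply (g : LorentzMetric E M) (p : M) (x y : TangentSpace 𝓘(ℝ, E) p) :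
    metricForm g p x y = g.val p x y := rfl

theorem chartMetric_self
    (g : (q : M) → TangentSpace 𝓘(ℝ, E) q →L[ℝ] TangentSpace 𝓘(ℝ, E) q →L[ℝ] ℝ)
    (p : M) (v w : E) : chartMetric g p (extChartAt 𝓘(ℝ, E) p p) v w
      = g p (coordFrame p p v) (coordFrame p p w) := by
  rw [chartMetric_apply, extChartAt_to_inv]

theorem chartEndo_self (φ : (q : M) → TangentSpace 𝓘(ℝ, E) q →L[ℝ] TangentSpace 𝓘(ℝ, E) q)
    (p : M) (v : E) : chartEndo φ p (extChartAt 𝓘(ℝ, E) p p) v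
      = chartDiff p p (φ p (coordFrame p p v)) := by
  rw [chartEndo, extChartAt_to_inv]
  rfl

theorem chartField_self (X : (q : M) → TangentSpace 𝓘(ℝ, E) q) (p : M) :
    chartField X p (extChartAt 𝓘(ℝ, E) p p) = chartDiff p p (X p) := by
  rw [chartField, extChartAt_to_inv]

theorem chartForm_self (η : (q : M) → TangentSpace 𝓘(ℝ, E) q →L[ℝ] ℝ) (p : M) (v : E) :
    chartForm η p (extChartAt 𝓘(ℝ, E) p p) v = η p (coordFrame p p v) := by
  rw [chartForm, extChartAt_to_inv]
  rfl

theorem curvature_def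
    (g : (q : M) → TangentSpace 𝓘(ℝ, E) q →L[ℝ] TangentSpace 𝓘(ℝ, E) q →L[ℝ] ℝ)
    (p : M) (x y z : TangentSpace 𝓘(ℝ, E) p) : curvature g p x y z
      = coordFrame p p (coordCurvature (chartMetric g p) (extChartAt 𝓘(ℝ, E) p p)
        (chartDiff p p x) (chartDiff p p y) (chartDiff p p z)) := rfl

namespace IsLorentzianSManifold

variable [FiniteDimensional ℝ E] [NeZero s] {g : LorentzMetric E M} {F : FramedFStructure E M s}
  (hS : IsLorentzianSManifold g F) (p : M)
include hS

theorem isCurvatureTensor : IsCurvatureTensor (metricForm g p) (curvature g.val p) := by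
  have h := hS.isSGerm p
  have h2 := h.eventually_two
  have hG : ∀ᶠ q in nhds (extChartAt 𝓘(ℝ, E) p p), DifferentiableAt ℝ (chartMetric g.val p) q :=
    h2.mono fun q hq => hq.diff_G
  have hs := h2.self_of_nhds.symm
  have hΓ : DifferentiableAt ℝ (christoffel (chartMetric g.val p)) (extChartAt 𝓘(ℝ, E) p p) :=
    (contDiffAt_christoffel h.smooth_G h.invertible.self_of_nhds).differentiableAt (by simp)
  refine ⟨fun x x' y z => ?_, fun c x y z => ?_, fun x y z => ?_, fun x y z => ?_,
    fun x y z w => ?_⟩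
  · simp only [curvature_def, map_add, coordCurvature_add]
  · simp only [curvature_def, map_smul, coordCurvature_smul]
  · rw [curvature_def, coordCurvature_swap, map_neg, ← curvature_def]
  · simp only [curvature_def]
    rw [← map_add, ← map_add, coordCurvature_bianchi hG hs hΓ, map_zero]
  · have h3 := metric_coordCurvature_swap hG h2.self_of_nhds.smooth_G hs h.invertible hΓ
      (chartDiff p p x) (chartDiff p p y) (chartDiff p p z) (chartDiff p p w)
    rw [chartMetric_self, chartMetric_self, coordFrame_chartDiff (mem_extChartAt_source p),
      coordFrame_chartDiff (mem_extChartAt_source p)] at h3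
    exact h3

/-- `R(x, y)ξ_α = ε_α (η̃(x) φ² y - η̃(y) φ² x)`. -/
theorem curvature_ξ (α : Fin s) (x y : TangentSpace 𝓘(ℝ, E) p) :
    curvature g.val p x y (F.ξ α p) = g.val p (F.ξ α p) (F.ξ α p) •
      (etaTilde g F p x • F.φ p (F.φ p y) - etaTilde g F p y • F.φ p (F.φ p x)) := by
  have hsrc := mem_extChartAt_source (I := 𝓘(ℝ, E)) p
  have h := (hS.isSGerm p).coordCurvature_ξ α (chartDiff p p x) (chartDiff p p y)
  have hη (x : TangentSpace 𝓘(ℝ, E) p) :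
      frameEta (chartMetric g.val p (extChartAt 𝓘(ℝ, E) p p))
        (fun α => chartField (F.ξ α) p (extChartAt 𝓘(ℝ, E) p p))
        (fun α => chartForm (F.η α) p (extChartAt 𝓘(ℝ, E) p p)) (chartDiff p p x)
        = etaTilde g F p x := by
    simp only [frameEta, etaTilde, chartField_self, chartMetric_self, chartForm_self,
      coordFrame_chartDiff hsrc]
  rw [hη, hη] at h
  simp only [chartField_self, chartMetric_self, chartEndo_self, coordFrame_chartDiff hsrc] at h
  rw [curvature_def, h]
  simp only [map_smul, map_sub, coordFrame_chartDiff hsrc]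

/-! ### Comparison of curvature tensors on `Im(φ_p)` -/

theorem mem_imφ_iff (x : TangentSpace 𝓘(ℝ, E) p) : x ∈ imφ F p ↔ F.φ p (F.φ p x) = -x := by
  constructor
  · rintro ⟨v, rfl⟩
    exact (hS.frame p).φ_cube' v
  · intro h
    have h1 : x = F.φ p (-F.φ p x) := by rw [map_neg, h, neg_neg]
    rw [h1]
    exact ⟨_, rfl⟩

theorem η_of_mem {x : TangentSpace 𝓘(ℝ, E) p} (hx : x ∈ imφ F p) (α : Fin s) :
    F.η α p x = 0 := by
  obtain ⟨v, rfl⟩ := hx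
  exact (hS.frame p).η_φ α v

theorem mem_imφ_of_η {x : TangentSpace 𝓘(ℝ, E) p} (hx : ∀ α, F.η α p x = 0) : x ∈ imφ F p := by
  rw [hS.mem_imφ_iff, F.φ_sq]
  simp [hx]

theorem etaTilde_of_mem {x : TangentSpace 𝓘(ℝ, E) p} (hx : x ∈ imφ F p) :
    etaTilde g F p x = 0 := by
  simp [etaTilde, hS.η_of_mem p hx]

theorem g_ξ_of_mem {x : TangentSpace 𝓘(ℝ, E) p} (hx : x ∈ imφ F p) (α : Fin s) :
    g.val p (F.ξ α p) x = 0 := by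
  have h := (hS.frame p).g_ξ α x
  rw [h]
  simp [hS.η_of_mem p hx]

theorem metricForm_symm (x y : TangentSpace 𝓘(ℝ, E) p) :
    metricForm g p x y = metricForm g p y x := g.symm p x y

theorem metricForm_nondeg (x : TangentSpace 𝓘(ℝ, E) p) (h : ∀ y, metricForm g p x y = 0) : x = 0 :=
  g.nondeg p x h

/-- Two curvature tensors on `T_pM` which agree on `Im(φ_p)` and on the characteristic vectors
agree. -/
theorem curvatureTensor_ext
    {R R' : TangentSpace 𝓘(ℝ, E) p → TangentSpace 𝓘(ℝ, E) p → TangentSpace 𝓘(ℝ, E) p →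
      TangentSpace 𝓘(ℝ, E) p}
    (hR : IsCurvatureTensor (metricForm g p) R) (hR' : IsCurvatureTensor (metricForm g p) R')
    (hξ : ∀ x y α, R x y (F.ξ α p) = R' x y (F.ξ α p))
    (him : ∀ x ∈ imφ F p, ∀ y ∈ imφ F p, ∀ z ∈ imφ F p, R x y z = R' x y z)
    (x y z : TangentSpace 𝓘(ℝ, E) p) : R x y z = R' x y z := by
  have hD := hR.sub hR'
  set D := fun x y z => R x y z - R' x y z with hDdef
  have hsym := hS.metricForm_symm p
  have hDξ (x y : TangentSpace 𝓘(ℝ, E) p) (a : Fin s → ℝ) : D x y (∑ α, a α • F.ξ α p) = 0 := by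
    refine Finset.sum_induction _ (fun v => D x y v = 0) (fun v w hv hw => ?_)
      (hD.zero_right x y) (fun α _ => ?_)
    · rw [hD.add_right, hv, hw, add_zero]
    · rw [hD.smul_right]
      simp [hDdef, hξ]
  have hDξ' (y z : TangentSpace 𝓘(ℝ, E) p) (a : Fin s → ℝ) : D (∑ α, a α • F.ξ α p) y z = 0 := by
    refine hS.metricForm_nondeg p _ fun w => ?_
    rw [hD.pair_symm hsym, hDξ]
    simp
  have hdec (x : TangentSpace 𝓘(ℝ, E) p) :
      x = -F.φ p (F.φ p x) + ∑ α, F.η α p x • F.ξ α p := by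
    rw [F.φ_sq]
    abel
  have hmem (x : TangentSpace 𝓘(ℝ, E) p) : -F.φ p (F.φ p x) ∈ imφ F p :=
    neg_mem ⟨F.φ p x, rfl⟩
  refine sub_eq_zero.1 (?_ : D x y z = 0)
  rw [hdec x, hD.add_left, hDξ', add_zero, hdec y, hD.swap, hD.add_left, hDξ', add_zero, hdec z,
    hD.add_right, hDξ, add_zero]
  simp [hDdef, him _ (hmem y) _ (hmem x) _ (hmem z)]

/-! ### The model curvature tensor -/

theorem etaTilde_add (x y : TangentSpace 𝓘(ℝ, E) p) :
    etaTilde g F p (x + y) = etaTilde g F p x + etaTilde g F p y := by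
  simp only [etaTilde, map_add, mul_add, Finset.sum_add_distrib]

theorem etaTilde_smul (c : ℝ) (x : TangentSpace 𝓘(ℝ, E) p) :
    etaTilde g F p (c • x) = c * etaTilde g F p x := by
  simp only [etaTilde, map_smul, smul_eq_mul, Finset.mul_sum]
  exact Finset.sum_congr rfl fun _ _ => by ring

theorem g_φsq_left (x y : TangentSpace 𝓘(ℝ, E) p) :
    g.val p (F.φ p (F.φ p x)) y = -g.val p (F.φ p x) (F.φ p y) := by
  have := (hS.frame p).g_φ_right (F.φ p x) y
  linarith

theorem isCurvatureTensor_tensorT : IsCurvatureTensor (metricForm g p) (tensorT g F p) where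
  add_left x x' y z := by
    simp only [tensorT, map_add, add_apply, hS.etaTilde_add]
    module
  smul_left c x y z := by
    simp only [tensorT, map_smul, smul_apply, hS.etaTilde_smul, smul_eq_mul]
    module
  swap x y z := by
    simp only [tensorT]
    module
  bianchi x y z := by
    simp only [tensorT]
    rw [g.symm p (F.φ p z) (F.φ p x), g.symm p (F.φ p y) (F.φ p x), g.symm p (F.φ p z) (F.φ p y)]
    module
  skew x y z w := by
    have hξ (w : TangentSpace 𝓘(ℝ, E) p) : g.val p (xiTilde F p) w = etaTilde g F p w :=
      (hS.frame p).g_sum_ξ w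
    simp only [metricForm_apply, tensorT]
    rw [g.symm p z]
    simp only [map_add, map_sub, map_smul, add_apply, sub_apply, smul_apply, smul_eq_mul, hξ,
      hS.g_φsq_left]
    ring

theorem g_φsq_φsq (x y : TangentSpace 𝓘(ℝ, E) p) :
    g.val p (F.φ p (F.φ p x)) (F.φ p (F.φ p y)) = g.val p (F.φ p x) (F.φ p y) := by
  rw [hS.g_φsq_left, (hS.frame p).φ_cube', map_neg, neg_neg]

theorem g_φ_φ_of_mem {x : TangentSpace 𝓘(ℝ, E) p} (hx : x ∈ imφ F p)
    (y : TangentSpace 𝓘(ℝ, E) p) : g.val p (F.φ p x) (F.φ p y) = g.val p x y := by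
  rw [← neg_neg (g.val p (F.φ p x) (F.φ p y)), ← hS.g_φsq_left, (hS.mem_imφ_iff p x).1 hx]
  simp

theorem isCurvatureTensor_tensorS : IsCurvatureTensor (metricForm g p) (tensorS g F p) := by
  convert IsCurvatureTensor.of_selfAdjoint (hS.metricForm_symm p)
    ((F.φ p).toLinearMap.comp (F.φ p).toLinearMap) (fun x y => ?_) using 4 with x y z
  · change _ = g.val p (F.φ p (F.φ p y)) z • F.φ p (F.φ p x)
      - g.val p (F.φ p (F.φ p x)) z • F.φ p (F.φ p y)
    rw [tensorS, hS.g_φsq_left, hS.g_φsq_left]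
    module
  · change g.val p (F.φ p (F.φ p x)) y = g.val p x (F.φ p (F.φ p y))
    rw [g.symm p x, hS.g_φsq_left, hS.g_φsq_left, g.symm p (F.φ p x)]

theorem tensorR0_eq (x y z : TangentSpace 𝓘(ℝ, E) p) :
    tensorR0 g F p x y z = -tensorS g F p x y z := by
  rw [tensorR0, tensorS, hS.g_φsq_φsq, hS.g_φsq_φsq]
  abel

theorem φsq_coe (x : imφ F p) : φsq F p x = -x :=
  Subtype.ext ((hS.mem_imφ_iff p x).1 x.2)

theorem g_φsq_of_mem {x : TangentSpace 𝓘(ℝ, E) p} (hx : x ∈ imφ F p)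
    (y : TangentSpace 𝓘(ℝ, E) p) : g.val p x (φsq F p y) = -g.val p x y := by
  change g.val p x (F.φ p (F.φ p y)) = _
  rw [g.symm, hS.g_φsq_left, g.symm, hS.g_φ_φ_of_mem p hx]

theorem isAlmostHermitian_skew {J : imφ F p →ₗ[ℝ] imφ F p} (hJ : IsAlmostHermitian g F p J)
    (x y : imφ F p) :
    g.val p (J x : TangentSpace 𝓘(ℝ, E) p) y = -g.val p (x : TangentSpace 𝓘(ℝ, E) p) (J y) := by
  rw [← hJ.2 (J x) y, hJ.1]
  simp

theorem isCurvatureTensor_tensorRJ {J : imφ F p →ₗ[ℝ] imφ F p} (hJ : IsAlmostHermitian g F p J) :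
    IsCurvatureTensor (metricForm g p) (tensorRJ g F p J) := by
  have key (x y : TangentSpace 𝓘(ℝ, E) p) :
      g.val p (J (φsq F p x) : TangentSpace 𝓘(ℝ, E) p) (φsq F p y)
        = -g.val p (J (φsq F p x) : TangentSpace 𝓘(ℝ, E) p) y :=
    hS.g_φsq_of_mem p (J (φsq F p x)).2 y
  -- `J φ²` is a skew-adjoint operator on the whole tangent space
  convert (IsCurvatureTensor.of_skewAdjoint (hS.metricForm_symm p)
    ((imφ F p).subtype.comp (J.comp ((F.φ p).toLinearMap.rangeRestrict.comp
      (F.φ p).toLinearMap))) (fun x y => ?_)).smul (-1) using 4 with x y z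
  · change _ = (-1 : ℝ) • (g.val p (J (φsq F p y) : TangentSpace 𝓘(ℝ, E) p) z
          • (J (φsq F p x) : TangentSpace 𝓘(ℝ, E) p)
        - g.val p (J (φsq F p x) : TangentSpace 𝓘(ℝ, E) p) z
          • (J (φsq F p y) : TangentSpace 𝓘(ℝ, E) p)
        + (2 * g.val p x (J (φsq F p y))) • (J (φsq F p z) : TangentSpace 𝓘(ℝ, E) p))
    rw [tensorRJ, key, key, g.symm p (φsq F p x), key, g.symm p x]
    module
  · change g.val p (J (φsq F p x) : TangentSpace 𝓘(ℝ, E) p) y = -g.val p x (J (φsq F p y))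
    rw [g.symm p x, ← key, g.symm, hS.isAlmostHermitian_skew p hJ, g.symm p (φsq F p y),
      key, neg_neg, g.symm p y]

/-- The tensor `T - S - c₂ R⁰ - ((c₁ - c₂)/3) R^J`. -/
theorem isCurvatureTensor_model {J : imφ F p →ₗ[ℝ] imφ F p} (hJ : IsAlmostHermitian g F p J)
    (c₁ c₂ : ℝ) : IsCurvatureTensor (metricForm g p) fun x y z =>
      tensorT g F p x y z - tensorS g F p x y z - c₂ • tensorR0 g F p x y z
        - ((c₁ - c₂) / 3) • tensorRJ g F p J x y z := by
  simp only [hS.tensorR0_eq]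
  simp only [← neg_one_smul ℝ (tensorS g F p _ _ _)]
  exact (((hS.isCurvatureTensor_tensorT p).sub (hS.isCurvatureTensor_tensorS p)).sub
    (((hS.isCurvatureTensor_tensorS p).smul (-1)).smul c₂)).sub
    ((hS.isCurvatureTensor_tensorRJ p hJ).smul ((c₁ - c₂) / 3))

theorem model_ξ (J : imφ F p →ₗ[ℝ] imφ F p) (c₁ c₂ : ℝ) (x y : TangentSpace 𝓘(ℝ, E) p)
    (α : Fin s) :
    tensorT g F p x y (F.ξ α p) - tensorS g F p x y (F.ξ α p) - c₂ • tensorR0 g F p x y (F.ξ α p)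
        - ((c₁ - c₂) / 3) • tensorRJ g F p J x y (F.ξ α p)
      = g.val p (F.ξ α p) (F.ξ α p) •
        (etaTilde g F p x • F.φ p (F.φ p y) - etaTilde g F p y • F.φ p (F.φ p x)) := by
  have hφ : F.φ p (F.ξ α p) = 0 := (hS.frame p).φ_ξ α
  have hsq : φsq F p (F.ξ α p) = 0 := Subtype.ext (by simp [φsq, hφ])
  have hη : etaTilde g F p (F.ξ α p) = g.val p (F.ξ α p) (F.ξ α p) :=
    by simp [etaTilde, F.η_ξ]
  rw [hS.tensorR0_eq]
  simp only [tensorT, tensorS, tensorRJ, hφ, hsq, hη, map_zero, ZeroMemClass.coe_zero]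
  module

theorem model_of_mem (J : imφ F p →ₗ[ℝ] imφ F p) (c₁ c₂ : ℝ) (x y z : imφ F p) :
    tensorT g F p x y z - tensorS g F p x y z - c₂ • tensorR0 g F p x y z
        - ((c₁ - c₂) / 3) • tensorRJ g F p J x y z
      = (c₂ - 1) • (g.val p (y : TangentSpace 𝓘(ℝ, E) p) z • (x : TangentSpace 𝓘(ℝ, E) p)
          - g.val p (x : TangentSpace 𝓘(ℝ, E) p) z • (y : TangentSpace 𝓘(ℝ, E) p))
        + ((c₁ - c₂) / 3) • (g.val p (J y : TangentSpace 𝓘(ℝ, E) p) z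
            • (J x : TangentSpace 𝓘(ℝ, E) p)
          - g.val p (J x : TangentSpace 𝓘(ℝ, E) p) z • (J y : TangentSpace 𝓘(ℝ, E) p)
          + (2 * g.val p (x : TangentSpace 𝓘(ℝ, E) p) (J y))
            • (J z : TangentSpace 𝓘(ℝ, E) p)) := by
  rw [hS.tensorR0_eq]
  simp only [tensorT, tensorS, tensorRJ, hS.φsq_coe, hS.etaTilde_of_mem p x.2,
    hS.etaTilde_of_mem p y.2, (hS.mem_imφ_iff p x).1 x.2, (hS.mem_imφ_iff p y).1 y.2,
    hS.g_φ_φ_of_mem p x.2, hS.g_φ_φ_of_mem p y.2, map_neg, NegMemClass.coe_neg, neg_apply]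
  module

/-- The curvature tensor is `T - S - c₂ R⁰ - ((c₁ - c₂)/3) R^J` as soon as this holds on
`Im(φ_p)`, since both tensors have the same values on the characteristic vectors. -/
theorem curvature_eq_model {J : imφ F p →ₗ[ℝ] imφ F p} (hJ : IsAlmostHermitian g F p J)
    (c₁ c₂ : ℝ)
    (h : ∀ x y z : imφ F p, curvature g.val p x y z
      = (c₂ - 1) • (g.val p (y : TangentSpace 𝓘(ℝ, E) p) z • (x : TangentSpace 𝓘(ℝ, E) p)
          - g.val p (x : TangentSpace 𝓘(ℝ, E) p) z • (y : TangentSpace 𝓘(ℝ, E) p))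
        + ((c₁ - c₂) / 3) • (g.val p (J y : TangentSpace 𝓘(ℝ, E) p) z
            • (J x : TangentSpace 𝓘(ℝ, E) p)
          - g.val p (J x : TangentSpace 𝓘(ℝ, E) p) z • (J y : TangentSpace 𝓘(ℝ, E) p)
          + (2 * g.val p (x : TangentSpace 𝓘(ℝ, E) p) (J y))
            • (J z : TangentSpace 𝓘(ℝ, E) p)))
    (x y z : TangentSpace 𝓘(ℝ, E) p) :
    curvature g.val p x y z = tensorT g F p x y z - tensorS g F p x y z
      - c₂ • tensorR0 g F p x y z - ((c₁ - c₂) / 3) • tensorRJ g F p J x y z := by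
  refine hS.curvatureTensor_ext p (hS.isCurvatureTensor p) (hS.isCurvatureTensor_model p hJ c₁ c₂)
    (fun x y α => ?_) (fun x hx y hy z hz => ?_) x y z
  · rw [hS.model_ξ, hS.curvature_ξ]
  · rw [hS.model_of_mem p J c₁ c₂ ⟨x, hx⟩ ⟨y, hy⟩ ⟨z, hz⟩]
    exact h ⟨x, hx⟩ ⟨y, hy⟩ ⟨z, hz⟩

end IsLorentzianSManifold

end CurvatureAtPoint

/-! ### Jacobi operators with respect to vectors of the null congruence -/

namespace IsLorentzianSManifold

variable {E : Type*} [NormedAddCommGroup E] [NormedSpace ℝ E] [FiniteDimensional ℝ E]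
  {M : Type*} [TopologicalSpace M] [ChartedSpace E M] [IsManifold 𝓘(ℝ, E) ∞ M] {s : ℕ} [NeZero s]
  {g : LorentzMetric E M} {F : FramedFStructure E M s}
  (hS : IsLorentzianSManifold g F) (p : M)
include hS

/-- The metric is positive definite on `Im(φ_p)`, being so on the orthogonal complement of the
timelike vector `ξ₀`. -/
theorem g_pos_of_mem {x : TangentSpace 𝓘(ℝ, E) p} (hx : x ∈ imφ F p) (h0 : x ≠ 0) :
    0 < g.val p x x := by
  obtain ⟨t, -, ht⟩ := g.signature p
  have h1 := hS.timelike p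
  have h2 : g.val p (F.ξ 0 p) x = 0 := hS.g_ξ_of_mem p hx 0
  have h3 : g.val p x (F.ξ 0 p) = 0 := by rw [g.symm, h2]
  -- a vector of the plane of `ξ₀` and `x` which is orthogonal to `t`
  let v := g.val p t x • F.ξ 0 p - g.val p t (F.ξ 0 p) • x
  have hv0 : g.val p t v = 0 := by
    simp only [v, map_sub, map_smul, smul_eq_mul]
    ring
  have hvv : g.val p v v = -g.val p t x ^ 2 + g.val p t (F.ξ 0 p) ^ 2 * g.val p x x := by
    simp only [v, map_sub, map_smul, sub_apply, smul_apply, smul_eq_mul, h1, h2, h3]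
    ring
  by_cases hv : v = 0
  · have h4 : g.val p (F.ξ 0 p) v = -g.val p t x := by
      simp only [v, map_sub, map_smul, smul_eq_mul, h1, h2]
      ring
    rw [hv, map_zero] at h4
    exact ht x (by linarith) h0
  · have h5 := ht v hv0 hv
    rw [hvv] at h5
    have h6 : 0 < g.val p t (F.ξ 0 p) ^ 2 * g.val p x x := by
      linarith [sq_nonneg (g.val p t x)]
    exact pos_of_mul_pos_right h6 (sq_nonneg _)

theorem finrank_imφ (n : ℕ) (hdim : finrank ℝ E = 2 * n + s) : finrank ℝ (imφ F p) = 2 * n := by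
  have hdim' : finrank ℝ (TangentSpace 𝓘(ℝ, E) p) = 2 * n + s := hdim
  have : FiniteDimensional ℝ (TangentSpace 𝓘(ℝ, E) p) := inferInstanceAs (FiniteDimensional ℝ E)
  let f : TangentSpace 𝓘(ℝ, E) p →ₗ[ℝ] (Fin s → ℝ) :=
    LinearMap.pi fun α => (F.η α p).toLinearMap
  have hker : LinearMap.ker f = imφ F p := by
    ext x
    rw [LinearMap.mem_ker]
    exact ⟨fun h => hS.mem_imφ_of_η p fun α => congrFun h α,
      fun h => funext fun α => hS.η_of_mem p h α⟩
  have hrange : LinearMap.range f = ⊤ := by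
    refine LinearMap.range_eq_top.2 fun a => ⟨∑ α, a α • F.ξ α p, funext fun β => ?_⟩
    change F.η β p _ = _
    simp [F.η_ξ]
  have h := f.finrank_range_add_finrank_ker
  rw [hrange, hker, finrank_top, finrank_fin_fun, hdim'] at h
  omega

theorem curvature_mem_imφ {x y : TangentSpace 𝓘(ℝ, E) p} (hx : x ∈ imφ F p) (hy : y ∈ imφ F p)
    (z : TangentSpace 𝓘(ℝ, E) p) : curvature g.val p x y z ∈ imφ F p := by
  refine hS.mem_imφ_of_η p fun α => ?_
  have h := (hS.isCurvatureTensor p).skew x y (F.ξ α p) z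
  rw [hS.curvature_ξ, hS.etaTilde_of_mem p hx, hS.etaTilde_of_mem p hy] at h
  simp only [zero_smul, sub_zero, smul_zero, map_zero, LinearMap.zero_apply] at h
  rw [(hS.frame p).η_eq]
  change _ * metricForm g p (F.ξ α p) _ = 0
  rw [← neg_eq_zero, ← mul_neg, ← h, mul_zero]

/-- The mixed curvature operators of the characteristic vectors. -/
theorem curvature_ξ_mid (α : Fin s) (y z : TangentSpace 𝓘(ℝ, E) p) :
    curvature g.val p y (F.ξ α p) z = -g.val p (F.ξ α p) (F.ξ α p) •
      (etaTilde g F p z • F.φ p (F.φ p y) + g.val p (F.φ p y) (F.φ p z) • xiTilde F p) := by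
  have hR := hS.isCurvatureTensor p
  refine sub_eq_zero.1 (hS.metricForm_nondeg p _ fun w => ?_)
  rw [map_sub, LinearMap.sub_apply, hR.pair_symm (hS.metricForm_symm p), hR.skew, hS.curvature_ξ]
  have hξ : g.val p (xiTilde F p) w = etaTilde g F p w := (hS.frame p).g_sum_ξ w
  simp only [map_smul, map_sub, map_add, LinearMap.smul_apply, LinearMap.add_apply,
    smul_eq_mul, metricForm_apply, hξ, hS.g_φsq_left]
  rw [g.symm p y, g.symm p y, hS.g_φsq_left, hS.g_φsq_left, g.symm p (F.φ p w),
    g.symm p (F.φ p z)]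
  ring

theorem etaTilde_ξ_add {x : TangentSpace 𝓘(ℝ, E) p} (hx : x ∈ imφ F p) :
    etaTilde g F p (F.ξ 0 p + x) = -1 := by
  rw [hS.etaTilde_add, hS.etaTilde_of_mem p hx]
  simp [etaTilde, F.η_ξ, hS.timelike]

theorem φ_ξ_add (x : TangentSpace 𝓘(ℝ, E) p) : F.φ p (F.ξ 0 p + x) = F.φ p x := by
  rw [map_add, (hS.frame p).φ_ξ, zero_add]

theorem jacobi_of_mem {x y : TangentSpace 𝓘(ℝ, E) p} (hx : x ∈ imφ F p) (hy : y ∈ imφ F p)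
    (hxy : g.val p x y = 0) :
    curvature g.val p y (F.ξ 0 p + x) (F.ξ 0 p + x) = y + curvature g.val p y x x := by
  have hR := hS.isCurvatureTensor p
  rw [hR.add_mid, hS.curvature_ξ_mid, hS.etaTilde_ξ_add p hx, hS.φ_ξ_add, hS.g_φ_φ_of_mem p hy,
    g.symm p y, hxy, hR.add_right, hS.curvature_ξ, hS.etaTilde_of_mem p hx,
    hS.etaTilde_of_mem p hy, (hS.mem_imφ_iff p y).1 hy, hS.timelike]
  module

theorem jacobi_ξ {x : TangentSpace 𝓘(ℝ, E) p} (hx : x ∈ imφ F p) (hxx : g.val p x x = 1)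
    (α : Fin s) : curvature g.val p (F.ξ α p) (F.ξ 0 p + x) (F.ξ 0 p + x)
      = g.val p (F.ξ α p) (F.ξ α p) • (x + xiTilde F p) := by
  rw [(hS.isCurvatureTensor p).swap, hS.curvature_ξ_mid, hS.etaTilde_ξ_add p hx, hS.φ_ξ_add,
    hS.g_φ_φ_of_mem p hx, hxx, (hS.mem_imφ_iff p x).1 hx]
  module

theorem ξ_add_mem_phiNullCongruence_iff (x : TangentSpace 𝓘(ℝ, E) p) :
    F.ξ 0 p + x ∈ phiNullCongruence g F p ↔ x ∈ imφ F p ∧ g.val p x x = 1 := by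
  rw [phiNullCongruence, Set.mem_ofPred_eq, add_sub_cancel_left]
  refine ⟨fun h => ⟨h.1, h.2.2⟩, fun h => ⟨h.1, ?_, h.2⟩⟩
  rw [g.symm]
  exact hS.g_ξ_of_mem p h.1 0

theorem mem_phiV_iff (x y : TangentSpace 𝓘(ℝ, E) p) :
    y ∈ phiV g F p (F.ξ 0 p + x) ↔ g.val p x y = 0 ∧ y ∈ imφ F p := by
  rw [phiV, add_sub_cancel_left, Submodule.mem_inf]
  rfl

theorem finrank_phiV (n : ℕ) (hdim : finrank ℝ E = 2 * n + s) {x : TangentSpace 𝓘(ℝ, E) p}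
    (hx : x ∈ imφ F p) (hxx : g.val p x x = 1) :
    finrank ℝ (phiV g F p (F.ξ 0 p + x)) + 1 = 2 * n := by
  have : FiniteDimensional ℝ (TangentSpace 𝓘(ℝ, E) p) := inferInstanceAs (FiniteDimensional ℝ E)
  let f : Dual ℝ (imφ F p) := (g.val p x).toLinearMap.comp (imφ F p).subtype
  have hf : f ≠ 0 := fun h => by
    have h1 : f ⟨x, hx⟩ = 1 := hxx
    rw [h] at h1
    exact zero_ne_one h1
  have hle : phiV g F p (F.ξ 0 p + x) ≤ imφ F p := inf_le_right
  have hker : (phiV g F p (F.ξ 0 p + x)).comap (imφ F p).subtype = LinearMap.ker f := by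
    ext y
    rw [Submodule.mem_comap, Submodule.subtype_apply, hS.mem_phiV_iff, LinearMap.mem_ker]
    exact ⟨fun h => h.1, fun h => ⟨h, y.2⟩⟩
  rw [← (Submodule.comapSubtypeEquivOfLe hle).finrank_eq, hker,
    Dual.finrank_ker_add_one_of_ne_zero hf, hS.finrank_imφ p n hdim]

/-- The eigenvectors of `R̄_u^φ`, in terms of the Jacobi operator of the unit vector `x`. -/
theorem mem_phiNullJacobiEigenspace_iff {x : TangentSpace 𝓘(ℝ, E) p} (hx : x ∈ imφ F p)
    (c : ℝ) (y : phiV g F p (F.ξ 0 p + x)) :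
    y ∈ phiNullJacobiEigenspace g F p (F.ξ 0 p + x) c
      ↔ curvature g.val p y x x = (c - 1) • (y : TangentSpace 𝓘(ℝ, E) p) := by
  obtain ⟨hxy, hy⟩ := (hS.mem_phiV_iff p x y).1 y.2
  have h1 : y ∈ phiNullJacobiEigenspace g F p (F.ξ 0 p + x) c ↔
      curvature g.val p y (F.ξ 0 p + x) (F.ξ 0 p + x) - c • (y : TangentSpace 𝓘(ℝ, E) p)
        ∈ Submodule.span ℝ {F.ξ 0 p + x} := by
    rw [phiNullJacobiEigenspace, LinearMap.mem_ker, ← Submodule.Quotient.mk_eq_zero]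
    rfl
  rw [h1, hS.jacobi_of_mem p hx hy hxy, Submodule.mem_span_singleton]
  have hmem : (y : TangentSpace 𝓘(ℝ, E) p) + curvature g.val p y x x
      - c • (y : TangentSpace 𝓘(ℝ, E) p) ∈ imφ F p :=
    sub_mem (add_mem hy (hS.curvature_mem_imφ p hy hx x)) (Submodule.smul_mem _ c hy)
  constructor
  · rintro ⟨a, ha⟩
    have h2 := hS.η_of_mem p hmem 0
    rw [← ha] at h2
    have h3 : a = 0 := by simpa [F.η_ξ, hS.η_of_mem p hx] using h2
    rw [h3, zero_smul] at ha
    refine sub_eq_zero.1 (Eq.trans ?_ ha.symm)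
    module
  · intro h
    refine ⟨0, ?_⟩
    rw [h]
    module

end IsLorentzianSManifold

/-! ### The two-eigenvalue condition -/

namespace IsLorentzianSManifold

variable {E : Type*} [NormedAddCommGroup E] [NormedSpace ℝ E] [FiniteDimensional ℝ E]
  {M : Type*} [TopologicalSpace M] [ChartedSpace E M] [IsManifold 𝓘(ℝ, E) ∞ M] {s : ℕ} [NeZero s]
  {g : LorentzMetric E M} {F : FramedFStructure E M s}
  (hS : IsLorentzianSManifold g F) (p : M)
include hS

/-- If `R̄_u^φ` has the eigenvalues `c₁`, `c₂` of multiplicities `1`, `2n - 2`, then it is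
`c₂ + (c₁ - c₂) e ⊗ e` for a unit vector `e`. -/
theorem exists_unit_of_hasTwoEigenvalues {n : ℕ} (hn : 1 < n) (hdim : finrank ℝ E = 2 * n + s)
    {x : TangentSpace 𝓘(ℝ, E) p} (hx : x ∈ imφ F p) (hxx : g.val p x x = 1) {c₁ c₂ : ℝ}
    (h : HasTwoEigenvalues g F p (F.ξ 0 p + x) c₁ c₂ 1 (2 * n - 2)) :
    ∃ e ∈ imφ F p, g.val p e e = 1 ∧ ∀ y ∈ imφ F p, curvature g.val p y x x
      = (c₂ - 1) • (y - g.val p y x • x) + ((c₁ - c₂) * g.val p y e) • e := by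
  have : FiniteDimensional ℝ (TangentSpace 𝓘(ℝ, E) p) := inferInstanceAs (FiniteDimensional ℝ E)
  have hR := hS.isCurvatureTensor p
  obtain ⟨hc, -, hd1, hd2⟩ := h
  have hmem (c : ℝ) (y : phiV g F p (F.ξ 0 p + x)) :=
    hS.mem_phiNullJacobiEigenspace_iff p hx c y
  have hV := hS.finrank_phiV p n hdim hx hxx
  obtain ⟨v, hv0, hv⟩ := finrank_eq_one_iff'.1 hd1
  have hv1 := (hmem c₁ v).1 v.2
  obtain ⟨hxv, hvim⟩ := (hS.mem_phiV_iff p x v).1 v.1.2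
  have hvne : (v : TangentSpace 𝓘(ℝ, E) p) ≠ 0 := fun h0 => hv0 (Subtype.ext (Subtype.ext h0))
  have hvpos := hS.g_pos_of_mem p hvim hvne
  set r := Real.sqrt (g.val p v v) with hr
  have hrpos : 0 < r := Real.sqrt_pos.2 hvpos
  have hrr : r * r = g.val p v v := Real.mul_self_sqrt hvpos.le
  -- eigenvectors for different eigenvalues are orthogonal
  have horth (f : phiV g F p (F.ξ 0 p + x))
      (hf : f ∈ phiNullJacobiEigenspace g F p (F.ξ 0 p + x) c₂) : g.val p f v = 0 := by
    have hf1 := (hmem c₂ f).1 hf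
    have h1 : g.val p (curvature g.val p f x x) v = g.val p (curvature g.val p v x x) f := by
      have h2 := hR.pair_symm (hS.metricForm_symm p) f x x v
      rw [hR.swap (v : TangentSpace 𝓘(ℝ, E) p) x, map_neg, LinearMap.neg_apply,
        hR.skew (v : TangentSpace 𝓘(ℝ, E) p), neg_neg] at h2
      exact h2.trans (g.symm p _ _)
    rw [hf1, hv1] at h1
    simp only [map_smul, smul_apply, smul_eq_mul] at h1
    rw [g.symm p v f] at h1
    have h3 : (c₁ - c₂) * g.val p f v = 0 := by linarith
    exact (mul_eq_zero.1 h3).resolve_left (sub_ne_zero.2 hc)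
  have htop : phiNullJacobiEigenspace g F p (F.ξ 0 p + x) c₁
      ⊔ phiNullJacobiEigenspace g F p (F.ξ 0 p + x) c₂ = ⊤ := by
    refine Submodule.eq_top_of_disjoint _ _ (by omega) (Submodule.disjoint_def.2 fun y h1 h2 => ?_)
    have h3 := ((hmem c₁ y).1 h1).symm.trans ((hmem c₂ y).1 h2)
    rw [← sub_eq_zero, ← sub_smul] at h3
    refine Subtype.ext ((smul_eq_zero.1 h3).resolve_left ?_)
    rw [sub_sub_sub_cancel_right]
    exact sub_ne_zero.2 hc
  refine ⟨r⁻¹ • v, Submodule.smul_mem _ _ hvim, ?_, fun y hy => ?_⟩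
  · simp only [map_smul, smul_apply, smul_eq_mul, ← hrr]
    field_simp
  have hy' : y - g.val p y x • x ∈ phiV g F p (F.ξ 0 p + x) := by
    rw [hS.mem_phiV_iff]
    refine ⟨?_, sub_mem hy (Submodule.smul_mem _ _ hx)⟩
    rw [map_sub, map_smul, hxx, smul_eq_mul, mul_one, g.symm p x, sub_self]
  obtain ⟨w, hw, f, hf, hwf⟩ := Submodule.mem_sup.1
    (htop ▸ Submodule.mem_top : (⟨_, hy'⟩ : phiV g F p (F.ξ 0 p + x)) ∈ _)
  obtain ⟨a, ha⟩ := hv ⟨w, hw⟩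
  have hwa : (w : TangentSpace 𝓘(ℝ, E) p) = a • (v : TangentSpace 𝓘(ℝ, E) p) :=
    (congrArg (fun q : phiNullJacobiEigenspace g F p (F.ξ 0 p + x) c₁ =>
      ((q : phiV g F p (F.ξ 0 p + x)) : TangentSpace 𝓘(ℝ, E) p)) ha).symm
  have hyd : y - g.val p y x • x = a • (v : TangentSpace 𝓘(ℝ, E) p) + f := by
    rw [← hwa]
    exact (congrArg Subtype.val hwf).symm
  have hyv : g.val p y v = a * (r * r) := by
    have h1 := congrArg (fun q => g.val p q v) hyd
    simp only [map_sub, map_add, map_smul, sub_apply, add_apply, smul_apply, smul_eq_mul, hxv,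
      horth f hf, ← hrr] at h1
    linarith
  have hRy : curvature g.val p y x x
      = (c₁ - 1) • a • (v : TangentSpace 𝓘(ℝ, E) p) + (c₂ - 1) • (f : TangentSpace 𝓘(ℝ, E) p) := by
    have h1 : y = (a • (v : TangentSpace 𝓘(ℝ, E) p) + f) + g.val p y x • x := by
      rw [← hyd]
      abel
    rw [h1, hR.add_left, hR.smul_left, hR.self_left, hR.add_left, hR.smul_left, hv1,
      (hmem c₂ f).1 hf]
    module
  have hra : (c₁ - c₂) * (r⁻¹ * (a * (r * r))) * r⁻¹ = (c₁ - c₂) * a := by field_simp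
  rw [hRy, hyd, map_smul, hyv, smul_eq_mul, smul_smul _ r⁻¹, hra]
  module

/-- The converse of `exists_unit_of_hasTwoEigenvalues`. -/
theorem hasTwoEigenvalues_of_unit {n : ℕ} (hn : 1 < n) (hdim : finrank ℝ E = 2 * n + s)
    {x e : TangentSpace 𝓘(ℝ, E) p} (hx : x ∈ imφ F p) (hxx : g.val p x x = 1) (he : e ∈ imφ F p)
    (hee : g.val p e e = 1) (hxe : g.val p x e = 0) {c₁ c₂ : ℝ} (hc : c₁ ≠ c₂)
    (h : ∀ y ∈ imφ F p, g.val p x y = 0 →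
      curvature g.val p y x x = (c₂ - 1) • y + ((c₁ - c₂) * g.val p y e) • e) :
    HasTwoEigenvalues g F p (F.ξ 0 p + x) c₁ c₂ 1 (2 * n - 2) := by
  have : FiniteDimensional ℝ (TangentSpace 𝓘(ℝ, E) p) := inferInstanceAs (FiniteDimensional ℝ E)
  have hV := hS.finrank_phiV p n hdim hx hxx
  let e' : phiV g F p (F.ξ 0 p + x) := ⟨e, (hS.mem_phiV_iff p x e).2 ⟨hxe, he⟩⟩
  have he' : e' ≠ 0 := fun h0 => by
    have h1 : e = 0 := congrArg Subtype.val h0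
    simp [h1] at hee
  have hmem (c : ℝ) (y : phiV g F p (F.ξ 0 p + x)) :
      y ∈ phiNullJacobiEigenspace g F p (F.ξ 0 p + x) c
        ↔ ((c₁ - c₂) * g.val p y e) • e = (c - c₂) • (y : TangentSpace 𝓘(ℝ, E) p) := by
    obtain ⟨hxy, hy⟩ := (hS.mem_phiV_iff p x y).1 y.2
    rw [hS.mem_phiNullJacobiEigenspace_iff p hx, h y hy hxy, ← sub_eq_zero,
      ← sub_eq_zero (b := _ • _)]
    refine Eq.congr ?_ rfl
    module
  have h1 : phiNullJacobiEigenspace g F p (F.ξ 0 p + x) c₁ = Submodule.span ℝ {e'} := by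
    ext y
    rw [hmem, mul_smul, Submodule.mem_span_singleton]
    constructor
    · exact fun h2 => ⟨_, Subtype.ext (smul_right_injective _ (sub_ne_zero.2 hc) h2)⟩
    · rintro ⟨a, rfl⟩
      have h2 : g.val p (a • e' : phiV g F p (F.ξ 0 p + x)) e = a := by
        change g.val p (a • e) e = a
        simp [hee]
      rw [h2]
      rfl
  let f : Dual ℝ (phiV g F p (F.ξ 0 p + x)) :=
    (g.val p e).toLinearMap.comp (phiV g F p (F.ξ 0 p + x)).subtype
  have h2 : phiNullJacobiEigenspace g F p (F.ξ 0 p + x) c₂ = LinearMap.ker f := by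
    ext y
    rw [hmem, sub_self, zero_smul, LinearMap.mem_ker, g.symm p y]
    change _ ↔ g.val p e y = 0
    constructor
    · intro h3
      have h4 := congrArg (fun q => g.val p q e) h3
      simp only [map_smul, smul_apply, hee, map_zero, zero_apply, smul_eq_mul, mul_one] at h4
      exact (mul_eq_zero.1 h4).resolve_left (sub_ne_zero.2 hc)
    · intro h3
      rw [h3, mul_zero, zero_smul]
  have hf : f ≠ 0 := fun h0 => by
    have h3 : f e' = 1 := hee
    rw [h0] at h3
    exact zero_ne_one h3
  have hd1 : finrank ℝ (phiNullJacobiEigenspace g F p (F.ξ 0 p + x) c₁) = 1 := by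
    rw [h1, finrank_span_singleton he']
  have hd2 : finrank ℝ (phiNullJacobiEigenspace g F p (F.ξ 0 p + x) c₂) = 2 * n - 2 := by
    have h3 := Dual.finrank_ker_add_one_of_ne_zero hf
    rw [h2]
    omega
  refine ⟨hc, fun c => ⟨fun hne => ?_, ?_⟩, hd1, hd2⟩
  · by_contra hcc
    rw [not_or] at hcc
    refine hne (Submodule.eq_bot_iff _ |>.2 fun y hy => ?_)
    have h3 := (hmem c y).1 hy
    have h4 := congrArg (fun q => g.val p q e) h3
    simp only [map_smul, smul_apply, hee, smul_eq_mul, mul_one] at h4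
    have h5 : (c₁ - c) * g.val p y e = 0 := by linarith
    have h6 := (mul_eq_zero.1 h5).resolve_left (sub_ne_zero.2 fun h => hcc.1 h.symm)
    rw [h6, mul_zero, zero_smul] at h3
    exact Subtype.ext ((smul_eq_zero.1 h3.symm).resolve_left (sub_ne_zero.2 hcc.2))
  · rintro (rfl | rfl) h0
    · rw [h0, finrank_bot] at hd1
      omega
    · rw [h0, finrank_bot] at hd2
      omega

end IsLorentzianSManifold

/-! ### The eigenspaces of the full Jacobi operators -/

section

variable {E : Type*} [NormedAddCommGroup E] [NormedSpace ℝ E]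
  {M : Type*} [TopologicalSpace M] [ChartedSpace E M] [IsManifold 𝓘(ℝ, E) ∞ M] {s : ℕ} [NeZero s]

/-- The eigenvectors for `c` of `R̄_u` in the span of the classes of `ξ_α`, `α ≠ 0`, in the
coordinates `a` with `a 0 = 0`: there `R̄_u(ξ_α) = ε_α ∑_{β ≠ 0} ξ_β`, for every `u`. -/
noncomputable def charEigenspace (g : LorentzMetric E M) (F : FramedFStructure E M s) (p : M)
    (c : ℝ) : Submodule ℝ (Fin s → ℝ) where
  carrier := {a | a 0 = 0 ∧ ∀ α ≠ 0, ∑ β, a β * g.val p (F.ξ β p) (F.ξ β p) = c * a α}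
  zero_mem' := by simp
  add_mem' := by
    rintro a b ⟨ha0, ha⟩ ⟨hb0, hb⟩
    refine ⟨by simp [ha0, hb0], fun α hα => ?_⟩
    simp only [Pi.add_apply, add_mul, Finset.sum_add_distrib, ha α hα, hb α hα, mul_add]
  smul_mem' := by
    rintro r a ⟨ha0, ha⟩
    refine ⟨by simp [ha0], fun α hα => ?_⟩
    simp only [Pi.smul_apply, smul_eq_mul, mul_assoc, ← Finset.mul_sum, ha α hα]
    ring

theorem mem_nullJacobiEigenspace_iff (g : LorentzMetric E M) (p : M) (u : TangentSpace 𝓘(ℝ, E) p)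
    (c : ℝ) (v : perp g.val p u) :
    (Submodule.Quotient.mk v : NullQuotient g.val p u) ∈ nullJacobiEigenspace g.val p u c
      ↔ curvature g.val p v u u - c • (v : TangentSpace 𝓘(ℝ, E) p) ∈ Submodule.span ℝ {u} := by
  rw [nullJacobiEigenspace, LinearMap.mem_ker, ← Submodule.Quotient.mk_eq_zero]
  rfl

end

namespace IsLorentzianSManifold

variable {E : Type*} [NormedAddCommGroup E] [NormedSpace ℝ E] [FiniteDimensional ℝ E]
  {M : Type*} [TopologicalSpace M] [ChartedSpace E M] [IsManifold 𝓘(ℝ, E) ∞ M] {s : ℕ} [NeZero s]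
  {g : LorentzMetric E M} {F : FramedFStructure E M s}
  (hS : IsLorentzianSManifold g F) (p : M)
include hS

theorem η_sum_ξ (a : Fin s → ℝ) (α : Fin s) : F.η α p (∑ β, a β • F.ξ β p) = a α := by
  simp [F.η_ξ]

/-- The vectors of `Im(φ_p)` are linearly independent of the characteristic vectors. -/
theorem eq_zero_of_add_sum_ξ {w : TangentSpace 𝓘(ℝ, E) p} (hw : w ∈ imφ F p) {a : Fin s → ℝ}
    (h : w + ∑ β, a β • F.ξ β p = 0) : w = 0 ∧ a = 0 := by
  have ha : a = 0 := funext fun α => by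
    have h1 := congrArg (F.η α p) h
    rwa [map_add, hS.η_of_mem p hw, hS.η_sum_ξ, zero_add, map_zero] at h1
  refine ⟨?_, ha⟩
  simpa [ha] using h

theorem jacobi_sum_ξ {x : TangentSpace 𝓘(ℝ, E) p} (hx : x ∈ imφ F p) (hxx : g.val p x x = 1)
    (a : Fin s → ℝ) :
    curvature g.val p (∑ β, a β • F.ξ β p) (F.ξ 0 p + x) (F.ξ 0 p + x)
      = (∑ β, a β * g.val p (F.ξ β p) (F.ξ β p)) • (x + xiTilde F p) := by
  change jacobiMap g.val p (F.ξ 0 p + x) _ = _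
  rw [map_sum, Finset.sum_smul]
  refine Finset.sum_congr rfl fun β _ => ?_
  rw [map_smul, mul_smul]
  exact congrArg _ (hS.jacobi_ξ p hx hxx β)

/-- In the decomposition of `u^⊥ / span(u)` into `x^⊥ ∩ Im(φ_p)` and the span of the classes of
`ξ_α`, `α ≠ 0`, the operator `R̄_u` is block diagonal. -/
theorem eigenvector_iff {x : TangentSpace 𝓘(ℝ, E) p} (hx : x ∈ imφ F p) (hxx : g.val p x x = 1)
    (c : ℝ) (y : phiV g F p (F.ξ 0 p + x)) {a : Fin s → ℝ} (ha : a 0 = 0) :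
    curvature g.val p (y + ∑ β, a β • F.ξ β p) (F.ξ 0 p + x) (F.ξ 0 p + x)
        - c • (y + ∑ β, a β • F.ξ β p) ∈ Submodule.span ℝ {F.ξ 0 p + x}
      ↔ y ∈ phiNullJacobiEigenspace g F p (F.ξ 0 p + x) c ∧ a ∈ charEigenspace g F p c := by
  obtain ⟨hxy, hy⟩ := (hS.mem_phiV_iff p x y).1 y.2
  rw [hS.mem_phiNullJacobiEigenspace_iff p hx, (hS.isCurvatureTensor p).add_left,
    hS.jacobi_of_mem p hx hy hxy, hS.jacobi_sum_ξ p hx hxx]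
  set σ := ∑ β, a β * g.val p (F.ξ β p) (F.ξ β p) with hσ
  let b : Fin s → ℝ := fun β => (if β = 0 then 0 else σ) - c * a β
  have hb : ∑ β, b β • F.ξ β p = σ • xiTilde F p - σ • F.ξ 0 p - c • ∑ β, a β • F.ξ β p := by
    have h1 (β : Fin s) : b β • F.ξ β p
        = σ • F.ξ β p - (if β = 0 then σ else 0) • F.ξ β p - c • a β • F.ξ β p := by
      by_cases h : β = 0
      · simp only [b, if_pos h]
        module
      · simp only [b, if_neg h]
        module
    simp only [h1, Finset.sum_sub_distrib, ← Finset.smul_sum, ite_smul, zero_smul,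
      Finset.sum_ite_eq', Finset.mem_univ, if_true, xiTilde]
  set w := (y : TangentSpace 𝓘(ℝ, E) p) + curvature g.val p y x x
    - c • (y : TangentSpace 𝓘(ℝ, E) p) with hwdef
  have hw : w ∈ imφ F p :=
    sub_mem (add_mem hy (hS.curvature_mem_imφ p hy hx x)) (Submodule.smul_mem _ c hy)
  -- modulo `u`, the vector in question is `w + ∑ b β ξ β`, with `b 0 = 0`
  have hsplit : (y : TangentSpace 𝓘(ℝ, E) p) + curvature g.val p y x x + σ • (x + xiTilde F p)
      - c • ((y : TangentSpace 𝓘(ℝ, E) p) + ∑ β, a β • F.ξ β p)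
      = (w + ∑ β, b β • F.ξ β p) + σ • (F.ξ 0 p + x) := by
    rw [hb]
    module
  have hwiff : w = 0 ↔ curvature g.val p y x x = (c - 1) • (y : TangentSpace 𝓘(ℝ, E) p) := by
    rw [← sub_eq_zero (a := curvature g.val p y x x)]
    refine Eq.congr ?_ rfl
    module
  have hbiff : b = 0 ↔ a ∈ charEigenspace g F p c := by
    constructor
    · refine fun h => ⟨ha, fun α hα => ?_⟩
      have h1 := congrFun h α
      simp only [b, if_neg hα, Pi.zero_apply] at h1
      linarith
    · refine fun h => funext fun α => ?_
      by_cases hα : α = 0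
      · simp [b, hα, ha]
      · have h1 := h.2 α hα
        simp only [b, if_neg hα, Pi.zero_apply]
        linarith
  rw [hsplit, Submodule.add_mem_iff_left _
    (Submodule.smul_mem _ _ (Submodule.mem_span_singleton_self _)), ← hwiff, ← hbiff]
  constructor
  · intro h
    obtain ⟨t, ht⟩ := Submodule.mem_span_singleton.1 h
    have h1 := congrArg (F.η 0 p) ht
    rw [map_add (F.η 0 p) w, hS.η_of_mem p hw, hS.η_sum_ξ, map_smul, map_add, hS.η_of_mem p hx,
      F.η_ξ] at h1
    have ht0 : t = 0 := by simpa [b, ha] using h1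
    rw [ht0, zero_smul] at ht
    exact hS.eq_zero_of_add_sum_ξ p hw ht.symm
  · rintro ⟨h1, h2⟩
    simp [h1, h2]

/-- The multiplicity of an eigenvalue of `R̄_u` is that of `R̄_u^φ`, up to a summand which does not
depend on `u`. -/
theorem finrank_nullJacobiEigenspace {x : TangentSpace 𝓘(ℝ, E) p} (hx : x ∈ imφ F p)
    (hxx : g.val p x x = 1) (c : ℝ) :
    finrank ℝ (nullJacobiEigenspace g.val p (F.ξ 0 p + x) c)
      = finrank ℝ (phiNullJacobiEigenspace g F p (F.ξ 0 p + x) c)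
        + finrank ℝ (charEigenspace g F p c) := by
  have : FiniteDimensional ℝ (TangentSpace 𝓘(ℝ, E) p) := inferInstanceAs (FiniteDimensional ℝ E)
  have hξx : g.val p (F.ξ 0 p) x = 0 := hS.g_ξ_of_mem p hx 0
  have hperp {y : TangentSpace 𝓘(ℝ, E) p} (hy : y ∈ imφ F p) (hxy : g.val p x y = 0)
      {a : Fin s → ℝ} (ha : a 0 = 0) :
      y + ∑ β, a β • F.ξ β p ∈ perp g.val p (F.ξ 0 p + x) := by
    change g.val p (F.ξ 0 p + x) (y + ∑ β, a β • F.ξ β p) = 0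
    have h1 : g.val p x (∑ β, a β • F.ξ β p) = 0 := by
      rw [map_sum]
      refine Finset.sum_eq_zero fun β _ => ?_
      rw [map_smul, g.symm, hS.g_ξ_of_mem p hx, smul_zero]
    have h2 : g.val p (F.ξ 0 p) (∑ β, a β • F.ξ β p) = 0 := by
      have h3 := (hS.frame p).g_ξ 0 (∑ β, a β • F.ξ β p)
      rw [hS.η_sum_ξ, ha, mul_zero] at h3
      exact h3
    rw [map_add, map_add, add_apply, add_apply, h1, h2, hxy, hS.g_ξ_of_mem p hy]
    simp
  let f₀ : (phiNullJacobiEigenspace g F p (F.ξ 0 p + x) c × charEigenspace g F p c)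
      →ₗ[ℝ] TangentSpace 𝓘(ℝ, E) p :=
    ((phiV g F p (F.ξ 0 p + x)).subtype.comp (Submodule.subtype _)).coprod
      ((Fintype.linearCombination ℝ fun β => F.ξ β p).comp (Submodule.subtype _))
  have hf₀ (q) : f₀ q = (q.1.1 : TangentSpace 𝓘(ℝ, E) p)
      + ∑ β, (q.2 : Fin s → ℝ) β • F.ξ β p := by
    simp [f₀, Fintype.linearCombination_apply]
  have hmem (q) : f₀ q ∈ perp g.val p (F.ξ 0 p + x) := by
    obtain ⟨hxy, hy⟩ := (hS.mem_phiV_iff p x q.1.1).1 q.1.1.2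
    rw [hf₀]
    exact hperp hy hxy q.2.2.1
  let f : (phiNullJacobiEigenspace g F p (F.ξ 0 p + x) c × charEigenspace g F p c)
      →ₗ[ℝ] NullQuotient g.val p (F.ξ 0 p + x) :=
    (Submodule.mkQ _).comp (f₀.codRestrict _ hmem)
  have hinj : Function.Injective f := by
    refine (injective_iff_map_eq_zero f).2 fun q hq => ?_
    have h1 : f₀ q ∈ Submodule.span ℝ {F.ξ 0 p + x} := by
      have h2 := (Submodule.Quotient.mk_eq_zero _).1 hq
      exact h2
    obtain ⟨t, ht⟩ := Submodule.mem_span_singleton.1 h1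
    obtain ⟨hxy, hy⟩ := (hS.mem_phiV_iff p x q.1.1).1 q.1.1.2
    have h3 := congrArg (F.η 0 p) ht
    rw [hf₀, map_add (F.η 0 p) (q.1.1 : TangentSpace 𝓘(ℝ, E) p), hS.η_of_mem p hy, hS.η_sum_ξ,
      map_smul, map_add, hS.η_of_mem p hx, F.η_ξ, q.2.2.1] at h3
    have ht0 : t = 0 := by simpa using h3
    rw [ht0, zero_smul, hf₀] at ht
    obtain ⟨h4, h5⟩ := hS.eq_zero_of_add_sum_ξ p hy ht.symm
    exact Prod.ext (Subtype.ext (Subtype.ext h4)) (Subtype.ext h5)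
  have hrange : LinearMap.range f = nullJacobiEigenspace g.val p (F.ξ 0 p + x) c := by
    ext q
    constructor
    · rintro ⟨q, rfl⟩
      refine (mem_nullJacobiEigenspace_iff g p _ c ⟨f₀ q, hmem q⟩).2 ?_
      rw [show ((⟨f₀ q, hmem q⟩ : perp g.val p (F.ξ 0 p + x)) : TangentSpace 𝓘(ℝ, E) p) = f₀ q
        from rfl, hf₀]
      exact (hS.eigenvector_iff p hx hxx c q.1.1 q.2.2.1).2 ⟨q.1.2, q.2.2⟩
    · intro hq
      obtain ⟨v, rfl⟩ := Submodule.Quotient.mk_surjective _ q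
      -- the representative `v - η⁰(v) u` of the class of `v`
      let v' : TangentSpace 𝓘(ℝ, E) p := v - F.η 0 p v • (F.ξ 0 p + x)
      let y : TangentSpace 𝓘(ℝ, E) p := -F.φ p (F.φ p v')
      let a : Fin s → ℝ := fun β => F.η β p v'
      have ha : a 0 = 0 := by
        simp [a, v', F.η_ξ, hS.η_of_mem p hx]
      have hy : y ∈ imφ F p := neg_mem ⟨F.φ p v', rfl⟩
      have hya : v' = y + ∑ β, a β • F.ξ β p := by
        simp only [y, a]
        rw [F.φ_sq]
        abel
      have hxv : g.val p x v' = 0 := by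
        have h1 : g.val p (F.ξ 0 p + x) v = 0 := v.2
        have h2 := (hS.frame p).g_ξ 0 (v : TangentSpace 𝓘(ℝ, E) p)
        simp only [hS.timelike] at h2
        simp only [map_add, add_apply] at h1
        simp only [v', map_sub, map_smul, map_add, hxx, smul_eq_mul, g.symm p x (F.ξ 0 p), hξx]
        linarith
      have hxy : g.val p x y = 0 := by
        have h1 : g.val p x (F.φ p (F.φ p v')) = -g.val p x v' := hS.g_φsq_of_mem p hx v'
        rw [map_neg, h1, hxv]
        simp
      have hv' : v' ∈ perp g.val p (F.ξ 0 p + x) := hya ▸ hperp hy hxy ha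
      have hvv' : (Submodule.Quotient.mk v : NullQuotient g.val p (F.ξ 0 p + x))
          = Submodule.Quotient.mk ⟨v', hv'⟩ := by
        refine (Submodule.Quotient.eq _).2 (Submodule.mem_span_singleton.2 ⟨F.η 0 p v, ?_⟩)
        change _ = (v : TangentSpace 𝓘(ℝ, E) p) - (v - F.η 0 p v • (F.ξ 0 p + x))
        abel
      have h3 := hq
      rw [hvv', mem_nullJacobiEigenspace_iff,
        show ((⟨v', hv'⟩ : perp g.val p (F.ξ 0 p + x)) : TangentSpace 𝓘(ℝ, E) p) = v' from rfl,
        hya] at h3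
      have h4 := (hS.eigenvector_iff p hx hxx c ⟨y, (hS.mem_phiV_iff p x y).2 ⟨hxy, hy⟩⟩ ha).1 h3
      refine ⟨(⟨_, h4.1⟩, ⟨a, h4.2⟩), ?_⟩
      rw [hvv']
      refine congrArg Submodule.Quotient.mk (Subtype.ext ?_)
      change f₀ _ = v'
      rw [hf₀, hya]
  rw [← hrange, LinearMap.finrank_range_of_inj hinj, finrank_prod]

/-- If every `R̄_u^φ` has the two eigenvalues `c₁`, `c₂` with fixed multiplicities, then the
multiplicities of the eigenvalues of `R̄_u` do not depend on `u`. -/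
theorem isPhiNullOsserman {c₁ c₂ : ℝ} {m₁ m₂ : ℕ}
    (h : ∀ u ∈ phiNullCongruence g F p, HasTwoEigenvalues g F p u c₁ c₂ m₁ m₂) :
    IsPhiNullOsserman g F p := by
  have key : ∀ u ∈ phiNullCongruence g F p, ∀ c : ℝ,
      finrank ℝ (nullJacobiEigenspace g.val p u c)
        = (if c = c₁ then m₁ else if c = c₂ then m₂ else 0)
          + finrank ℝ (charEigenspace g F p c) := by
    intro u hu c
    obtain ⟨-, h1, h2, h3⟩ := h u hu
    obtain ⟨x, rfl⟩ : ∃ x, u = F.ξ 0 p + x := ⟨u - F.ξ 0 p, by abel⟩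
    obtain ⟨hx, hxx⟩ := (hS.ξ_add_mem_phiNullCongruence_iff p x).1 hu
    rw [hS.finrank_nullJacobiEigenspace p hx hxx]
    congr 1
    split_ifs with hc1 hc2
    · rw [hc1, h2]
    · rw [hc2, h3]
    · have h4 : phiNullJacobiEigenspace g F p (F.ξ 0 p + x) c = ⊥ := by
        by_contra h5
        exact ((h1 c).1 h5).elim hc1 hc2
      rw [h4, finrank_bot]
  intro u hu u' hu' c
  rw [key u hu, key u' hu']

/-! ### The curvature on `Im(φ_p)` -/

/-- The Jacobi operators of the unit vectors of `Im(φ_p)` determine the curvature. -/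
theorem exists_almostHermitian {c₁ c₂ : ℝ} (hc : c₁ ≠ c₂)
    (h : ∀ x ∈ imφ F p, g.val p x x = 1 → ∃ e ∈ imφ F p, g.val p e e = 1 ∧ ∀ y ∈ imφ F p,
      curvature g.val p y x x
        = (c₂ - 1) • (y - g.val p y x • x) + ((c₁ - c₂) * g.val p y e) • e) :
    ∃ J : imφ F p →ₗ[ℝ] imφ F p, IsAlmostHermitian g F p J ∧
      ∀ x y z : TangentSpace 𝓘(ℝ, E) p, curvature g.val p x y z =
        tensorT g F p x y z - tensorS g F p x y z - c₂ • tensorR0 g F p x y z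
          - ((c₁ - c₂) / 3) • tensorRJ g F p J x y z := by
  have hR := hS.isCurvatureTensor p
  have hk : c₁ - c₂ ≠ 0 := sub_ne_zero.2 hc
  let B := (metricForm g p).domRestrict₁₂ (imφ F p) (imφ F p)
  have hBapply (x y : imφ F p) : B x y = g.val p (x : TangentSpace 𝓘(ℝ, E) p) y := rfl
  have hB (x y : imφ F p) : B x y = B y x := g.symm p _ _
  have hRW : IsCurvatureTensor B fun x y z : imφ F p =>
      (⟨curvature g.val p x y z, hS.curvature_mem_imφ p x.2 y.2 z⟩ : imφ F p) :=
    { add_left := fun x x' y z => Subtype.ext (hR.add_left _ _ _ _)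
      smul_left := fun c x y z => Subtype.ext (hR.smul_left _ _ _ _)
      swap := fun x y z => Subtype.ext (hR.swap _ _ _)
      bianchi := fun x y z => Subtype.ext (hR.bianchi _ _ _)
      skew := fun x y z w => hR.skew _ _ _ _ }
  -- after subtracting a multiple of the constant curvature tensor, the Jacobi operators have
  -- rank one
  have hK := (hRW.sub ((IsCurvatureTensor.of_selfAdjoint hB LinearMap.id
    fun _ _ => rfl).smul (c₂ - 1))).smul (c₁ - c₂)⁻¹
  obtain ⟨J, hJ1, hJ2, hJ3⟩ := exists_complex_structure hB
    (fun x hx => hS.g_pos_of_mem p x.2 fun h0 => hx (Subtype.ext h0)) hK fun x hx => by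
      obtain ⟨e, he, hee, h1⟩ := h x x.2 hx
      refine ⟨⟨e, he⟩, hee, fun y => ?_⟩
      refine Subtype.ext ?_
      simp only [LinearMap.id_coe, id_eq, hx, Submodule.coe_smul, AddSubgroupClass.coe_sub,
        h1 y y.2, hBapply]
      rw [one_smul, add_sub_cancel_left, smul_smul, inv_mul_cancel_left₀ hk]
  have hJ : IsAlmostHermitian g F p J := ⟨hJ1, hJ2⟩
  refine ⟨J, hJ, hS.curvature_eq_model p hJ c₁ c₂ fun x y z => ?_⟩
  have h2 := congrArg (fun q : imφ F p => (c₁ - c₂) • (q : TangentSpace 𝓘(ℝ, E) p)) (hJ3 x y z)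
  simp only [LinearMap.id_coe, id_eq, Submodule.coe_smul, AddSubgroupClass.coe_sub,
    Submodule.coe_add, hBapply, smul_smul, mul_inv_cancel₀ hk, one_smul] at h2
  rw [sub_eq_iff_eq_add] at h2
  rw [h2]
  module

/-- For the curvature tensor of the model, `R̄_u^φ` is `c₂ + (c₁ - c₂) Jx ⊗ Jx`. -/
theorem hasTwoEigenvalues_of_model {n : ℕ} (hn : 1 < n) (hdim : finrank ℝ E = 2 * n + s)
    {c₁ c₂ : ℝ} (hc : c₁ ≠ c₂) {J : imφ F p →ₗ[ℝ] imφ F p} (hJ : IsAlmostHermitian g F p J)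
    (h : ∀ x y z : TangentSpace 𝓘(ℝ, E) p, curvature g.val p x y z =
      tensorT g F p x y z - tensorS g F p x y z - c₂ • tensorR0 g F p x y z
        - ((c₁ - c₂) / 3) • tensorRJ g F p J x y z)
    {x : TangentSpace 𝓘(ℝ, E) p} (hx : x ∈ imφ F p) (hxx : g.val p x x = 1) :
    HasTwoEigenvalues g F p (F.ξ 0 p + x) c₁ c₂ 1 (2 * n - 2) := by
  have hsk := hS.isAlmostHermitian_skew p hJ
  have hJx : g.val p (J ⟨x, hx⟩ : TangentSpace 𝓘(ℝ, E) p) x = 0 := by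
    have h1 := hsk ⟨x, hx⟩ ⟨x, hx⟩
    rw [g.symm p x] at h1
    linarith
  refine hS.hasTwoEigenvalues_of_unit p hn hdim hx hxx (J ⟨x, hx⟩).2
    ((hJ.2 _ _).trans hxx) (by rw [g.symm, hJx]) hc fun y hy hxy => ?_
  have h2 := hsk ⟨y, hy⟩ ⟨x, hx⟩
  rw [h, hS.model_of_mem p J c₁ c₂ ⟨y, hy⟩ ⟨x, hx⟩ ⟨x, hx⟩]
  simp only at h2 ⊢
  rw [hxx, g.symm p y x, hxy, hJx, h2]
  module

end IsLorentzianSManifold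

end LorentzS

theorem mainTheorem1
    {E : Type*} [NormedAddCommGroup E] [NormedSpace ℝ E] [FiniteDimensional ℝ E]
    {M : Type*} [TopologicalSpace M] [T2Space M] [SecondCountableTopology M] [ConnectedSpace M]
    [ChartedSpace E M] [IsManifold 𝓘(ℝ, E) ∞ M]
    (n s : ℕ) [NeZero s] (hn : 1 < n) (hdim : finrank ℝ E = 2 * n + s)
    (g : LorentzS.LorentzMetric E M) (F : LorentzS.FramedFStructure E M s)
    (hS : LorentzS.IsLorentzianSManifold g F) (p : M) (c₁ c₂ : ℝ) (hc : c₁ ≠ c₂) :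
    (LorentzS.IsPhiNullOsserman g F p ∧
      ∀ u ∈ LorentzS.phiNullCongruence g F p,
        LorentzS.HasTwoEigenvalues g F p u c₁ c₂ 1 (2 * n - 2)) ↔
    ∃ J : LorentzS.imφ F p →ₗ[ℝ] LorentzS.imφ F p,
      LorentzS.IsAlmostHermitian g F p J ∧
      ∀ x y z : TangentSpace 𝓘(ℝ, E) p,
        LorentzS.curvature g.val p x y z =
          LorentzS.tensorT g F p x y z - LorentzS.tensorS g F p x y z
            - c₂ • LorentzS.tensorR0 g F p x y z
            - ((c₁ - c₂) / 3) • LorentzS.tensorRJ g F p J x y z := by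
  constructor
  · rintro ⟨-, h⟩
    exact hS.exists_almostHermitian p hc fun x hx hxx =>
      hS.exists_unit_of_hasTwoEigenvalues p hn hdim hx hxx
        (h _ ((hS.ξ_add_mem_phiNullCongruence_iff p x).2 ⟨hx, hxx⟩))
  · rintro ⟨J, hJ, h⟩
    have h1 : ∀ u ∈ LorentzS.phiNullCongruence g F p,
        LorentzS.HasTwoEigenvalues g F p u c₁ c₂ 1 (2 * n - 2) := by
      intro u hu
      obtain ⟨x, rfl⟩ : ∃ x, u = F.ξ 0 p + x := ⟨u - F.ξ 0 p, by abel⟩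
      obtain ⟨hx, hxx⟩ := (hS.ξ_add_mem_phiNullCongruence_iff p x).1 hu
      exact hS.hasTwoEigenvalues_of_model p hn hdim hc hJ h hx hxx
    exact ⟨hS.isPhiNullOsserman p h1, h1⟩
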